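/- Let $\mu^\star\in\mathbb R^d$ and $\Sigma^\star\in\mathbb R^{d\times d}$ with $\Sigma^\star\succ 0$, and let $(x_1,y_1^\star),\dots,(x_n,y_n^\star)\in\mathbb R^d\times\{\pm1\}$ be i.i.d. with $\mathbb P(y_i^\star=1)=\mathbb P(y_i^\star=-1)=1/2$ and $x_i\mid y_i^\star\sim N(y_i^\star\mu^\star,\Sigma^\star)$. Put $\mathrm{SNR}=\mu^{\star\top}(\Sigma^\star)^{-1}\mu^\star$ and $\sigma=1/\sqrt{\mathrm{SNR}+1}$. For $y,y'\in\{\pm1\}^n$ let $$\mathcal R(y,y')=n^{-1}\min_{s=\pm1}|\{i\in[n]: s y_i\ne y'_i\}|.$$ The spectral algorithm takes the data matrix $X=(x_1,\dots,x_n)^\top\in\mathbb R^{n\times d}$, forms $W=\sqrt n\,X(X^\top X)^{-1/2}$ with rows $w_1^\top,\dots,w_n^\top$ (if $X^\top X$ is singular, the pseudoinverse is used in place of the inverse) and $$S=\frac1n\sum_{i=1}^n(\|w_i\|_2^2-d)\,w_iw_i^\top,$$ picks any unit eigenvector $v$ of $S$ associated with its smallest eigenvalue, and outputs $\widehat y^{\mathrm{spec}}=\mathrm{sgn}(Wv)$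 entrywise, where $\mathrm{sgn}(t)=1$ for $t\ge0$ and $\mathrm{sgn}(t)=-1$ for $t<0$. Theorem (Spectral initialization). For all constants $\delta\in(0,1)$, $c>0$ and $C_1>0$ there is a constant $C_2>0$, depending only on $\delta$, $c$ and $C_1$, such that for all $n$, $d$, $\mu^\star$ and $\Sigma^\star\succ0$ with $\sigma<1-\delta$ and $n>c\,d^2\log^3 n$, $$\mathbb P\left[\mathcal R(\widehat y^{\mathrm{spec}},y^\star)\le C_2\left(\sigma^2+\frac{d^2\log^3 n}{n}\right)\right]\ge 1-n^{-C_1},$$ whichever bottom eigenvectors $v$ are chosen. -/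

import Mathlib

open MeasureTheory ProbabilityTheory

noncomputable section

/-- `sgn t = 1` if `t ≥ 0` and `sgn t = -1` otherwise; labels live in `ℤˣ = {1, -1}`. -/
def sgn (t : ℝ) : ℤˣ := if 0 ≤ t then 1 else -1

/-- The signal-to-noise ratio `μᵀ Σ⁻¹ μ`. -/
def snr {d : ℕ} (m : EuclideanSpace ℝ (Fin d)) (Sig : Matrix (Fin d) (Fin d) ℝ) : ℝ :=
  m.ofLp ⬝ᵥ (Sig⁻¹).mulVec m.ofLp

/-- The noise level `σ = 1 / √(SNR + 1)`. -/
def noiseLevel {d : ℕ} (m : EuclideanSpace ℝ (Fin d)) (Sig : Matrix (Fin d) (Fin d) ℝ) : ℝ :=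
  1 / √(snr m Sig + 1)

/-- The pairs `(x i, y i)` are i.i.d. samples of the symmetric two-component Gaussian mixture:
`y i` is a uniform sign and, given `y i = s`, the vector `x i` has law `N(s • m, Sig)`. -/
structure IsMixtureSample {Ω : Type*} [MeasurableSpace Ω] (P : Measure Ω) {n d : ℕ}
    (m : EuclideanSpace ℝ (Fin d)) (Sig : Matrix (Fin d) (Fin d) ℝ)
    (x : Fin n → Ω → EuclideanSpace ℝ (Fin d)) (y : Fin n → Ω → ℤˣ) : Prop where
  measurable_x : ∀ i, Measurable (x i)
  measurable_y : ∀ i, Measurable (y i)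
  indep : iIndepFun (fun i ω => (x i ω, y i ω)) P
  prob_label : ∀ i (s : ℤˣ), P (y i ⁻¹' {s}) = 1 / 2
  law_cond : ∀ i (s : ℤˣ),
    (cond P (y i ⁻¹' {s})).map (x i) = multivariateGaussian (((s : ℤ) : ℝ) • m) Sig

/-- The data matrix whose `i`-th row is the `i`-th sample. -/
def dataMatrix {n d : ℕ} (x : Fin n → EuclideanSpace ℝ (Fin d)) : Matrix (Fin n) (Fin d) ℝ :=
  Matrix.of fun i j => x i j

/-- `A^{-1/2}` for a positive semidefinite matrix `A`, by functional calculus. For singular `A`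
the zero eigenvalues are sent to `0`, which gives the square root of the pseudoinverse. -/
def invSqrt {d : ℕ} (A : Matrix (Fin d) (Fin d) ℝ) : Matrix (Fin d) (Fin d) ℝ :=
  cfc (fun t : ℝ => (√t)⁻¹) A

/-- Whitened data `W = √n X (XᵀX)^{-1/2}`. -/
def whiten {n d : ℕ} (X : Matrix (Fin n) (Fin d) ℝ) : Matrix (Fin n) (Fin d) ℝ :=
  √(n : ℝ) • (X * invSqrt (X.transpose * X))

/-- Weighted sample covariance `n⁻¹ ∑ i, (‖w i‖² - d) w i (w i)ᵀ`, with `w i` the `i`-th row of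
`W`. -/
def weightedCov {n d : ℕ} (W : Matrix (Fin n) (Fin d) ℝ) : Matrix (Fin d) (Fin d) ℝ :=
  (n : ℝ)⁻¹ • ∑ i, ((∑ j, W i j ^ 2) - (d : ℝ)) • Matrix.vecMulVec (W i) (W i)

/-- `v` is a unit eigenvector of `S` associated with its smallest eigenvalue. -/
def IsBottomEigenvector {d : ℕ} (S : Matrix (Fin d) (Fin d) ℝ) (v : EuclideanSpace ℝ (Fin d)) :
    Prop :=
  ‖v‖ = 1 ∧ ∃ l : ℝ, IsLeast {t : ℝ | Module.End.HasEigenvalue (Matrix.toEuclideanLin S) t} l ∧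
    Matrix.toEuclideanLin S v = l • v

/-- `yhat` is an output of the spectral algorithm on the data matrix `X`: the sign vector of `W v`
for some choice of the bottom unit eigenvector `v` of the weighted covariance. -/
def IsSpectralOutput {n d : ℕ} (X : Matrix (Fin n) (Fin d) ℝ) (yhat : Fin n → ℤˣ) : Prop :=
  ∃ v : EuclideanSpace ℝ (Fin d), IsBottomEigenvector (weightedCov (whiten X)) v ∧
    yhat = fun i => sgn ((whiten X).mulVec v.ofLp i)

/-- Misclassification proportion `n⁻¹ min_{s = ±1} |{i : s yhat i ≠ y i}|`. -/
def misclass {n : ℕ} (yhat y : Fin n → ℤˣ) : ℝ :=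
  (n : ℝ)⁻¹ * min ((Finset.univ.filter fun i => yhat i ≠ y i).card : ℝ)
    ((Finset.univ.filter fun i => -yhat i ≠ y i).card : ℝ)

end

/-! ### Bernstein-type bounds for sums of independent variables. -/

section Concentration

variable {Ω : Type*} [MeasurableSpace Ω] {P : Measure Ω} [IsProbabilityMeasure P]

/-! Whitening makes the algorithm invariant under invertible linear maps of the data. So the sample
may be replaced by vectors `u i` with independent coordinates of mean 0 and variance 1: one
coordinate `k₀` is `ρ y + σ γ` with `γ` Gaussian and `ρ² + σ² = 1`, the others are standard Gaussian
(`IsMixtureSample.exists_whitened`). The population form `E (‖u‖² - d) ⟪w, u⟫²` is then diagonal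
with entries `E u_k⁴ - 1` (`IsIsotropic.integral_weight_inner_sq`). These are 2 at the Gaussian
coordinates and at most 1/4 at `k₀` when `σ` is small, since a sign has fourth moment 1. Hence the
bottom eigenvector points along `k₀`, where the projection is the label up to noise of variance
`σ²`.

For the sample version, `exists_decomposition_of_bottom` writes the eigenvector as `α e + b` with
`‖b‖` at most a constant times `T = d (log n)^{3/2} / √n`. A Chebyshev count of sign errors gives a
proportion of order `σ² + ‖b‖²`, and `T² = d² log³ n / n`. Three estimates feed the perturbation
bound.

The true weights `‖w i‖²` are the leverages `u iᵀ Ĝ⁻¹ u i`, with `Ĝ` the sample second moment. They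
are within order `T` of `‖u i‖²`: expand to second order and treat the first-order term by
leave-one-out independence (`IsGoodSample.abs_leverage_sub_le`).

The cross terms between `e` and its complement are averages of quartic variables with tails `exp
(-√t)`; truncation controls them entry by entry (`measureReal_sum_ge_le_of_exp_sqrt`).

On the complement of `e` only a lower bound is needed. The weights are at least `-d`, so the lower
tail is `exp (-c n / d)`, which beats a net of `n^{7d}` points once `n` is large compared with `d²
log n` (`measureReal_sum_weight_inner_sq_lt_le`).

If `σ²` or `T²` is not small, or `n` is below a constant, the choice of `C₂` makes the claim
trivial. -/

theorem exp_le_one_add_add_sq_mul_exp (x : ℝ) :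
    Real.exp x ≤ 1 + x + x ^ 2 * Real.exp (max x 0) := by
  by_cases h : |x| ≤ 1
  · have h1 := (abs_le.1 (Real.abs_exp_sub_one_sub_id_le h)).2
    have h2 : 1 ≤ Real.exp (max x 0) := Real.one_le_exp (le_max_right _ _)
    nlinarith [sq_nonneg x]
  · rcases lt_abs.1 (not_le.1 h) with hx | hx
    · rw [max_eq_left (by linarith)]
      have := Real.exp_pos x
      nlinarith [mul_pos this (show 0 < x ^ 2 - 1 by nlinarith)]
    · rw [max_eq_right (by linarith), Real.exp_zero]
      have : Real.exp x ≤ 1 := Real.exp_le_one_iff.2 (by linarith)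
      nlinarith

/-- A one-sided Bernstein bound for the moment generating function: only the positive part of `f`
has to be exponentially integrable. -/
theorem mgf_le_exp_of_sq_mul_exp_le {f g : Ω → ℝ} {lam m V : ℝ} (hlam : 0 ≤ lam)
    (hf : Integrable f P) (hm : ∫ ω, f ω ∂P ≤ m) (hg : Integrable g P)
    (hfg : ∀ ω, f ω ^ 2 * Real.exp (lam * max (f ω) 0) ≤ g ω) (hV : ∫ ω, g ω ∂P ≤ V) :
    Integrable (fun ω => Real.exp (lam * f ω)) P ∧
      mgf f P lam ≤ Real.exp (lam * m + lam ^ 2 * V) := by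
  have key : ∀ ω, Real.exp (lam * f ω) ≤ 1 + lam * f ω + lam ^ 2 * g ω := by
    intro ω
    have h1 := exp_le_one_add_add_sq_mul_exp (lam * f ω)
    have h2 : max (lam * f ω) 0 = lam * max (f ω) 0 := by
      rw [mul_max_of_nonneg _ _ hlam, mul_zero]
    rw [h2, mul_pow, mul_assoc] at h1
    have h3 := mul_le_mul_of_nonneg_left (hfg ω) (sq_nonneg lam)
    linarith
  have hI : Integrable (fun ω => 1 + lam * f ω + lam ^ 2 * g ω) P :=
    ((integrable_const 1).add (hf.const_mul lam)).add (hg.const_mul _)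
  have hE : Integrable (fun ω => Real.exp (lam * f ω)) P :=
    hI.mono' (by have := hf.aestronglyMeasurable.aemeasurable; fun_prop)
      (.of_forall fun ω => by rw [Real.norm_eq_abs, Real.abs_exp]; exact key ω)
  refine ⟨hE, ?_⟩
  calc mgf f P lam ≤ ∫ ω, (1 + lam * f ω + lam ^ 2 * g ω) ∂P := integral_mono hE hI key
    _ = 1 + lam * ∫ ω, f ω ∂P + lam ^ 2 * ∫ ω, g ω ∂P := by
      have h1 : Integrable (fun ω => 1 + lam * f ω) P :=
        (integrable_const 1).add (hf.const_mul lam)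
      rw [integral_add h1 (hg.const_mul _),
        integral_add (integrable_const 1) (hf.const_mul lam), integral_const_mul,
        integral_const_mul]
      simp
    _ ≤ 1 + (lam * m + lam ^ 2 * V) := by
      have := mul_le_mul_of_nonneg_left hm hlam
      have := mul_le_mul_of_nonneg_left hV (sq_nonneg lam)
      linarith
    _ ≤ _ := by rw [add_comm]; exact Real.add_one_le_exp _

/-- The Chernoff bound for a sum of independent variables. -/
theorem measureReal_sum_ge_le_exp {ι : Type*} {f : ι → Ω → ℝ} (hind : iIndepFun f P)
    (hmeas : ∀ i, Measurable (f i)) {lam b : ℝ} (hlam : 0 ≤ lam) (s : Finset ι)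
    (hfint : ∀ i, Integrable (fun ω => Real.exp (lam * f i ω)) P)
    (hmgf : ∀ i, mgf (f i) P lam ≤ Real.exp b) (t : ℝ) :
    P.real {ω | t ≤ ∑ i ∈ s, f i ω} ≤ Real.exp (-lam * t + s.card * b) := by
  have h1 := measure_ge_le_exp_mul_mgf (μ := P) (X := ∑ i ∈ s, f i) t hlam
    (hind.integrable_exp_mul_sum hmeas fun i _ => hfint i)
  rw [hind.mgf_sum hmeas] at h1
  simp only [Finset.sum_apply] at h1
  refine h1.trans ?_
  rw [Real.exp_add]
  gcongr
  calc ∏ i ∈ s, mgf (f i) P lam ≤ ∏ _i ∈ s, Real.exp b :=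
        Finset.prod_le_prod (fun _ _ => mgf_nonneg) fun i _ => hmgf i
    _ = _ := by rw [Finset.prod_const, ← Real.exp_nat_mul]

theorem pow_two_le_exp_half {x : ℝ} (hx : 0 ≤ x) : x ^ 2 ≤ 16 * Real.exp (x / 2) := by
  have h1 : x / 4 ≤ Real.exp (x / 4) := by linarith [Real.add_one_le_exp (x / 4)]
  have h2 : (x / 4) ^ 2 ≤ Real.exp (x / 4) ^ 2 := by gcongr
  rw [← Real.exp_nat_mul] at h2
  have h3 : ((2 : ℕ) : ℝ) * (x / 4) = x / 2 := by push_cast; ring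
  rw [h3] at h2
  nlinarith

theorem pow_four_le_exp {x : ℝ} (hx : 0 ≤ x) : x ^ 4 ≤ 256 * Real.exp x := by
  have h1 := pow_two_le_exp_half hx
  have h2 : (x ^ 2) ^ 2 ≤ (16 * Real.exp (x / 2)) ^ 2 := by gcongr
  rw [mul_pow, ← Real.exp_nat_mul] at h2
  have h3 : ((2 : ℕ) : ℝ) * (x / 2) = x := by push_cast; ring
  rw [h3] at h2
  nlinarith

/-- Upper deviations of a sum of `n` independent variables with tails of order `exp (-√t)` have
Gaussian size `√(n log n)` with polynomially small failure probability. -/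
theorem measureReal_sum_ge_le_of_exp_sqrt {n : ℕ} {f : Fin n → Ω → ℝ} (hind : iIndepFun f P)
    (hmeas : ∀ i, Measurable (f i)) {κ K m : ℝ} (hκ : 1 ≤ κ) (hn : 3 ≤ n)
    (hfint : ∀ i, Integrable (fun ω => Real.exp √|f i ω|) P)
    (hK : ∀ i, ∫ ω, Real.exp √|f i ω| ∂P ≤ K) (hm : ∀ i, ∫ ω, f i ω ∂P ≤ m)
    (hsmall : √(Real.log n / n) * ((κ + 1) * Real.log n) ^ 2 ≤ 1) :
    P.real {ω | n * m + (768 * K + κ) * √(n * Real.log n) ≤ ∑ i, f i ω} ≤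
      (Real.exp (16 * K) + K) * (n : ℝ) ^ (-κ) := by
  have hn0 : (0 : ℝ) < n := by positivity
  have hn3 : (3 : ℝ) ≤ n := by exact_mod_cast hn
  set L := Real.log n with hL
  have hL1 : 1 ≤ L := by
    rw [hL, Real.le_log_iff_exp_le hn0]
    exact (Real.exp_one_lt_d9.le.trans (by norm_num)).trans hn3
  have hLn : L ≤ n := (Real.log_le_sub_one_of_pos hn0).trans (by linarith)
  set A := κ + 1 with hA
  -- With this choice `n * lam ^ 2` and `lam * √(n * L)` both equal `L`, so the Chernoff exponent is
  -- a multiple of `log n`.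
  set lam := √(L / n) with hlamdef
  have hlam0 : 0 ≤ lam := Real.sqrt_nonneg _
  have hlam1 : lam ≤ 1 := by
    rw [hlamdef, Real.sqrt_le_one, div_le_one hn0]; exact hLn
  have hlamsq : n * lam ^ 2 = L := by
    rw [hlamdef, Real.sq_sqrt (by positivity)]; field_simp
  have hlamt : lam * √(n * L) = L := by
    rw [hlamdef, ← Real.sqrt_mul (by positivity),
      show L / n * (n * L) = L ^ 2 by field_simp, Real.sqrt_sq (by linarith)]
  have hK0 : 0 ≤ K := by
    have i : Fin n := ⟨0, by omega⟩
    exact (integral_nonneg fun ω => (Real.exp_pos _).le).trans (hK i)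
  have hexpL : Real.exp (-L) = (n : ℝ)⁻¹ := by rw [Real.exp_neg, hL, Real.exp_log hn0]
  have hrpow : ∀ x : ℝ, Real.exp (-(x * L)) = (n : ℝ) ^ (-x) := by
    intro x; rw [Real.rpow_def_of_pos hn0, hL]; ring_nf
  -- Truncation level: `hsmall` keeps `lam * g` at most 1, while `A = κ + 1` makes the union of the
  -- `n` discarded tails cost `n * n ^ (-A) = n ^ (-κ)`.
  let g : Fin n → Ω → ℝ := fun i ω => if |f i ω| ≤ (A * L) ^ 2 then f i ω else 0
  let φ : ℝ → ℝ := fun x => if |x| ≤ (A * L) ^ 2 then x else 0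
  have hφ : Measurable φ := by
    refine Measurable.ite (measurableSet_le (by fun_prop) (by fun_prop)) measurable_id
      measurable_const
  have hgm : ∀ i, Measurable (g i) := fun i => hφ.comp (hmeas i)
  have hgind : iIndepFun g P := hind.comp (fun _ => φ) fun _ => hφ
  have hsq : ∀ i ω, |f i ω| = √|f i ω| ^ 2 := fun i ω => (Real.sq_sqrt (abs_nonneg _)).symm
  have hgabs : ∀ i ω, |g i ω| ≤ |f i ω| := by
    intro i ω; simp only [g]; split_ifs
    · rfl
    · simp
  have hfabs : ∀ i ω, |f i ω| ≤ 16 * Real.exp √|f i ω| := by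
    intro i ω
    have h := pow_two_le_exp_half (Real.sqrt_nonneg |f i ω|)
    have h2 : Real.exp (√|f i ω| / 2) ≤ Real.exp √|f i ω| :=
      Real.exp_le_exp.2 (by linarith [Real.sqrt_nonneg |f i ω|])
    linarith [hsq i ω]
  have hfi : ∀ i, Integrable (f i) P := fun i =>
    ((hfint i).const_mul 16).mono' (hmeas i).aestronglyMeasurable (.of_forall fun ω => hfabs i ω)
  have hgi : ∀ i, Integrable (g i) P := fun i =>
    ((hfint i).const_mul 16).mono' (hgm i).aestronglyMeasurable
      (.of_forall fun ω => (hgabs i ω).trans (hfabs i ω))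
  have hAL : 0 ≤ A * L := by positivity
  -- On the discarded event `√|f|` exceeds `A * L ≥ 2 * L`, so `exp (√|f| / 2) ≤ exp √|f| / n`:
  -- truncation raises the mean by at most `16 * K / n`.
  have hgf : ∀ i ω, g i ω ≤ f i ω + 16 / n * Real.exp √|f i ω| := by
    intro i ω
    simp only [g]
    split_ifs with h
    · have : 0 ≤ 16 / n * Real.exp √|f i ω| := by positivity
      linarith
    · rw [not_le] at h
      have hx : A * L < √|f i ω| := Real.lt_sqrt_of_sq_lt h
      have h1 := pow_two_le_exp_half (Real.sqrt_nonneg |f i ω|)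
      rw [← hsq] at h1
      have h2 : Real.exp (√|f i ω| / 2) ≤ (n : ℝ)⁻¹ * Real.exp √|f i ω| := by
        rw [← hexpL, ← Real.exp_add, Real.exp_le_exp]
        nlinarith
      have h3 := neg_abs_le (f i ω)
      have h4 : 16 / (n : ℝ) * Real.exp √|f i ω| = 16 * ((n : ℝ)⁻¹ * Real.exp √|f i ω|) := by
        ring
      rw [h4]; linarith
  have hgint : ∀ i, ∫ ω, g i ω ∂P ≤ m + 16 * K / n := by
    intro i
    calc ∫ ω, g i ω ∂P ≤ ∫ ω, (f i ω + 16 / n * Real.exp √|f i ω|) ∂P :=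
          integral_mono (hgi i) ((hfi i).add ((hfint i).const_mul _)) (hgf i)
      _ = ∫ ω, f i ω ∂P + 16 / n * ∫ ω, Real.exp √|f i ω| ∂P := by
          rw [integral_add (hfi i) ((hfint i).const_mul _), integral_const_mul]
      _ ≤ m + 16 / n * K := by
          have := hm i
          have := hK i
          gcongr
      _ = _ := by ring
  have hmgf : ∀ i, Integrable (fun ω => Real.exp (lam * g i ω)) P ∧
      mgf (g i) P lam ≤ Real.exp (lam * (m + 16 * K / n) + lam ^ 2 * (768 * K)) := by
    intro i
    refine mgf_le_exp_of_sq_mul_exp_le (g := fun ω => 768 * Real.exp √|f i ω|) hlam0 (hgi i)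
      (hgint i) ((hfint i).const_mul _) (fun ω => ?_) ?_
    · have h1 : lam * max (g i ω) 0 ≤ 1 := by
        refine le_trans ?_ hsmall
        refine mul_le_mul_of_nonneg_left ?_ hlam0
        simp only [g]
        split_ifs with h
        · exact max_le ((le_abs_self _).trans h) (by positivity)
        · simp; positivity
      have h2 : Real.exp (lam * max (g i ω) 0) ≤ 3 :=
        (Real.exp_le_exp.2 h1).trans (Real.exp_one_lt_d9.le.trans (by norm_num))
      have h3 : g i ω ^ 2 ≤ 256 * Real.exp √|f i ω| := by
        refine le_trans ?_ (pow_four_le_exp (Real.sqrt_nonneg |f i ω|))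
        have := hgabs i ω
        calc g i ω ^ 2 = |g i ω| ^ 2 := (sq_abs _).symm
          _ ≤ |f i ω| ^ 2 := by gcongr
          _ = √|f i ω| ^ 4 := by
            nth_rewrite 1 [hsq i ω]; ring
      have h4 := mul_le_mul h3 h2 (Real.exp_pos _).le (by positivity)
      linarith
    · rw [integral_const_mul]; linarith [hK i]
  have hch := measureReal_sum_ge_le_exp hgind hgm hlam0 Finset.univ (fun i => (hmgf i).1)
    (fun i => (hmgf i).2) (n * m + (768 * K + κ) * √(n * L))
  have htail : ∀ i, P.real {ω | (A * L) ^ 2 < |f i ω|} ≤ K * (n : ℝ) ^ (-A) := by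
    intro i
    have h1 := mul_meas_ge_le_integral_of_nonneg
      (.of_forall fun ω => (Real.exp_pos (√|f i ω|)).le) (hfint i) (Real.exp (A * L))
    have h2 : P.real {ω | (A * L) ^ 2 < |f i ω|} ≤
        P.real {ω | Real.exp (A * L) ≤ Real.exp √|f i ω|} := by
      refine measureReal_mono fun ω hω => ?_
      exact Real.exp_le_exp.2 (Real.lt_sqrt_of_sq_lt hω).le
    rw [← hrpow, Real.exp_neg, ← div_eq_mul_inv, le_div_iff₀ (Real.exp_pos _), mul_comm]
    calc _ ≤ _ := mul_le_mul_of_nonneg_left h2 (Real.exp_pos _).le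
      _ ≤ _ := h1
      _ ≤ K := hK i
  have hsub : {ω | n * m + (768 * K + κ) * √(n * L) ≤ ∑ i, f i ω} ⊆
      {ω | n * m + (768 * K + κ) * √(n * L) ≤ ∑ i, g i ω} ∪
        ⋃ i, {ω | (A * L) ^ 2 < |f i ω|} := by
    intro ω hω
    by_cases h : ∃ i, (A * L) ^ 2 < |f i ω|
    · exact Or.inr (Set.mem_iUnion.2 h)
    · push Not at h
      left
      have : ∀ i, g i ω = f i ω := fun i => if_pos (h i)
      simpa [this] using hω
  calc _ ≤ _ := measureReal_mono hsub
    _ ≤ _ := measureReal_union_le _ _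
    _ ≤ Real.exp (16 * K) * (n : ℝ) ^ (-κ) + n * (K * (n : ℝ) ^ (-A)) := by
      refine add_le_add (hch.trans ?_) ((measureReal_iUnion_fintype_le _).trans ?_)
      · rw [← hrpow, ← Real.exp_add, Real.exp_le_exp, Finset.card_univ, Fintype.card_fin]
        have e1 : (n : ℝ) * (16 * K / n) = 16 * K := by field_simp
        have e2 : lam * (16 * K) ≤ 16 * K := by nlinarith
        calc -lam * (n * m + (768 * K + κ) * √(n * L)) +
              n * (lam * (m + 16 * K / n) + lam ^ 2 * (768 * K))
            = -(768 * K + κ) * (lam * √(n * L)) + lam * (n * (16 * K / n)) +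
              (n * lam ^ 2) * (768 * K) := by ring
          _ = -κ * L + lam * (16 * K) := by rw [hlamt, e1, hlamsq]; ring
          _ ≤ _ := by linarith
      · calc _ ≤ ∑ _i : Fin n, K * (n : ℝ) ^ (-A) := Finset.sum_le_sum fun i _ => htail i
          _ = _ := by simp
    _ = _ := by
      have : (n : ℝ) * (n : ℝ) ^ (-A) = (n : ℝ) ^ (-κ) := by
        rw [← Real.rpow_one_add' hn0.le (by rw [hA]; linarith), hA]; congr 1; ring
      rw [add_mul, ← this]; ring

end Concentration

/-! ### Squares of subgaussian variables and moments of isotropic vectors. -/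

section Subgaussian

set_option linter.unusedSectionVars false

variable {Ω : Type*} [MeasurableSpace Ω] {P : Measure Ω} [IsProbabilityMeasure P]

theorem lintegral_exp_sq_div_four_gaussianReal_le :
    ∫⁻ h, ENNReal.ofReal (Real.exp (h ^ 2 / 4)) ∂(gaussianReal 0 1) ≤ 2 := by
  rw [gaussianReal_of_var_ne_zero _ one_ne_zero,
    lintegral_withDensity_eq_lintegral_mul _ (measurable_gaussianPDF 0 1) (by fun_prop)]
  have h1 : ∀ h : ℝ, (gaussianPDF 0 1 * fun h => ENNReal.ofReal (Real.exp (h ^ 2 / 4))) h =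
      ENNReal.ofReal ((√(2 * Real.pi))⁻¹ * Real.exp (-(1 / 4) * h ^ 2)) := by
    intro h
    rw [Pi.mul_apply, gaussianPDF, ← ENNReal.ofReal_mul (gaussianPDFReal_nonneg _ _ _),
      gaussianPDFReal, mul_assoc, ← Real.exp_add]
    simp only [NNReal.coe_one, mul_one]
    ring_nf
  simp_rw [h1]
  rw [← ofReal_integral_eq_lintegral_ofReal
    ((integrable_exp_neg_mul_sq (by norm_num)).const_mul _)
    (.of_forall fun h => by positivity), integral_const_mul, integral_gaussian]
  rw [show (2 : ENNReal) = ENNReal.ofReal 2 by simp]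
  refine ENNReal.ofReal_le_ofReal ?_
  rw [inv_mul_le_iff₀ (by positivity), Real.sqrt_le_iff]
  refine ⟨by positivity, ?_⟩
  rw [mul_pow, Real.sq_sqrt (by positivity)]
  nlinarith [Real.pi_pos]

/-- Gaussian linearisation: `exp (Y² / 4)` is the mean of `exp (z Y / √2)` over a standard Gaussian
`z`. By Tonelli the subgaussian bound applies for fixed `z`, which leaves the mean of `exp (z² /
4)`. -/
theorem ProbabilityTheory.HasSubgaussianMGF.integrable_exp_sq {Y : Ω → ℝ} (hY : Measurable Y)
    (h : HasSubgaussianMGF Y 1 P) :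
    Integrable (fun ω => Real.exp (Y ω ^ 2 / 4)) P ∧
      ∫ ω, Real.exp (Y ω ^ 2 / 4) ∂P ≤ 2 := by
  have key : ∫⁻ ω, ENNReal.ofReal (Real.exp (Y ω ^ 2 / 4)) ∂P ≤ 2 := by
    have h2 : (√2 : ℝ) ^ 2 = 2 := Real.sq_sqrt (by norm_num)
    have e1 : ∀ ω, ENNReal.ofReal (Real.exp (Y ω ^ 2 / 4)) =
        ∫⁻ z, ENNReal.ofReal (Real.exp (z / √2 * Y ω)) ∂(gaussianReal 0 1) := by
      intro ω
      have := mgf_gaussianReal (p := gaussianReal 0 1) (X := id) (μ := 0) (v := 1)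
        (by simp) (Y ω / √2)
      rw [mgf] at this
      have hi : Integrable (fun z : ℝ => Real.exp (Y ω / √2 * id z)) (gaussianReal 0 1) :=
        integrable_exp_mul_gaussianReal _
      have e : ∀ z : ℝ, z / √2 * Y ω = Y ω / √2 * id z := fun z => by simp; ring
      simp_rw [e]
      rw [← ofReal_integral_eq_lintegral_ofReal hi (.of_forall fun _ => (Real.exp_pos _).le),
        this]
      congr 2
      rw [div_pow, h2, NNReal.coe_one]; ring
    simp_rw [e1]
    rw [lintegral_lintegral_swap (by fun_prop)]
    refine le_trans (lintegral_mono fun z => ?_) lintegral_exp_sq_div_four_gaussianReal_le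
    rw [← ofReal_integral_eq_lintegral_ofReal (h.integrable_exp_mul _)
      (.of_forall fun _ => (Real.exp_pos _).le)]
    refine ENNReal.ofReal_le_ofReal ((h.mgf_le (z / √2)).trans (le_of_eq ?_))
    rw [div_pow, h2, NNReal.coe_one]; ring_nf
  have hi : Integrable (fun ω => Real.exp (Y ω ^ 2 / 4)) P := by
    refine ⟨by fun_prop, ?_⟩
    rw [hasFiniteIntegral_iff_ofReal (.of_forall fun _ => (Real.exp_pos _).le)]
    exact key.trans_lt (by simp)
  refine ⟨hi, ?_⟩
  rw [integral_eq_lintegral_of_nonneg_ae (.of_forall fun _ => (Real.exp_pos _).le)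
    (by fun_prop)]
  exact ENNReal.toReal_le_of_le_ofReal (by norm_num) (by simpa using key)

theorem exp_quarter_le : Real.exp (1 / 4) ≤ 2 := by
  have h := Real.exp_bound_div_one_sub_of_interval (x := 1 / 4) (by norm_num) (by norm_num)
  linarith

/-- For `|lam| ≤ 1 / 8` the second-order remainder of either sign is dominated by `512 * exp (Y² /
4)`, whose mean is at most 1024. -/
theorem ProbabilityTheory.HasSubgaussianMGF.mgf_sq_sub_one_le {Y : Ω → ℝ} (hY : Measurable Y)
    (h : HasSubgaussianMGF Y 1 P) (h2 : ∫ ω, Y ω ^ 2 ∂P = 1) {lam : ℝ} (hlam : |lam| ≤ 1 / 8) :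
    Integrable (fun ω => Real.exp (lam * (Y ω ^ 2 - 1))) P ∧
      mgf (fun ω => Y ω ^ 2 - 1) P lam ≤ Real.exp (1024 * lam ^ 2) := by
  obtain ⟨hi, hle⟩ := h.integrable_exp_sq hY
  -- A non-integrable function has Bochner integral 0, so `h2` already forces integrability.
  have hsq : Integrable (fun ω => Y ω ^ 2) P := by
    by_contra hc
    rw [integral_undef hc] at h2
    norm_num at h2
  have hbd : ∀ ω, (Y ω ^ 2 - 1) ^ 2 * Real.exp ((Y ω ^ 2 + 1) / 8) ≤
      512 * Real.exp (Y ω ^ 2 / 4) := by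
    intro ω
    have h1 := pow_two_le_exp_half (x := (Y ω ^ 2 + 1) / 4) (by positivity)
    have h3 : Real.exp ((Y ω ^ 2 + 1) / 4 / 2) * Real.exp ((Y ω ^ 2 + 1) / 8) =
        Real.exp (Y ω ^ 2 / 4) * Real.exp (1 / 4) := by
      rw [← Real.exp_add, ← Real.exp_add]; ring_nf
    have h4 := exp_quarter_le
    have h5 : (Y ω ^ 2 - 1) ^ 2 ≤ (Y ω ^ 2 + 1) ^ 2 := by nlinarith [sq_nonneg (Y ω)]
    calc (Y ω ^ 2 - 1) ^ 2 * Real.exp ((Y ω ^ 2 + 1) / 8)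
        ≤ (256 * Real.exp ((Y ω ^ 2 + 1) / 4 / 2)) * Real.exp ((Y ω ^ 2 + 1) / 8) := by
          gcongr; nlinarith
      _ = 256 * Real.exp (Y ω ^ 2 / 4) * Real.exp (1 / 4) := by rw [mul_assoc, h3]; ring
      _ ≤ 256 * Real.exp (Y ω ^ 2 / 4) * 2 := by gcongr
      _ = _ := by ring
  have hfint : ∫ ω, 512 * Real.exp (Y ω ^ 2 / 4) ∂P ≤ 1024 := by
    rw [integral_const_mul]; linarith
  have hf : Integrable (fun ω => Y ω ^ 2 - 1) P := hsq.sub (integrable_const 1)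
  have hf0 : ∫ ω, (Y ω ^ 2 - 1) ∂P = 0 := by
    rw [integral_sub hsq (integrable_const 1), h2]; simp
  have hexp : ∀ (a b : ℝ) , 0 ≤ b → b ≤ 1 / 8 → ∀ ω, a ≤ Y ω ^ 2 + 1 →
      (Y ω ^ 2 - 1) ^ 2 * Real.exp (b * max a 0) ≤ 512 * Real.exp (Y ω ^ 2 / 4) := by
    intro a b hb0 hb ω ha
    refine le_trans ?_ (hbd ω)
    gcongr
    have : max a 0 ≤ Y ω ^ 2 + 1 := max_le ha (by positivity)
    nlinarith [le_max_right a 0]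
  rcases le_total 0 lam with h0 | h0
  · rw [abs_of_nonneg h0] at hlam
    have := mgf_le_exp_of_sq_mul_exp_le h0 hf hf0.le (hi.const_mul 512)
      (fun ω => hexp _ _ h0 hlam ω (by linarith)) hfint
    refine ⟨this.1, this.2.trans (le_of_eq ?_)⟩
    ring_nf
  · rw [abs_of_nonpos h0] at hlam
    have := mgf_le_exp_of_sq_mul_exp_le (f := fun ω => -(Y ω ^ 2 - 1)) (m := 0)
      (neg_nonneg.2 h0) hf.neg
      (by rw [integral_neg, hf0]; simp) (hi.const_mul 512)
      (fun ω => by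
        rw [neg_sq]
        exact hexp _ _ (neg_nonneg.2 h0) hlam ω (by nlinarith [sq_nonneg (Y ω)])) hfint
    simp only [neg_mul_neg] at this
    refine ⟨this.1, ?_⟩
    have e : mgf (fun ω => Y ω ^ 2 - 1) P lam = mgf (fun ω => -(Y ω ^ 2 - 1)) P (-lam) := by
      simp only [mgf, neg_mul_neg]
    rw [e]
    refine this.2.trans (le_of_eq ?_)
    ring_nf

/-- A random vector with independent centred coordinates of unit variance that are subgaussian
with variance proxy `1`. -/
structure IsIsotropic {d : ℕ} (P : Measure Ω) (u : Ω → EuclideanSpace ℝ (Fin d)) : Prop where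
  measurable : Measurable u
  indep : iIndepFun (fun k ω => u ω k) P
  subgaussian : ∀ k, HasSubgaussianMGF (fun ω => u ω k) 1 P
  mean : ∀ k, ∫ ω, u ω k ∂P = 0
  second_moment : ∀ k, ∫ ω, u ω k ^ 2 ∂P = 1

namespace IsIsotropic

variable {d : ℕ} {u : Ω → EuclideanSpace ℝ (Fin d)}

theorem measurable_apply (h : IsIsotropic P u) (k : Fin d) : Measurable fun ω => u ω k := by
  have := h.measurable
  fun_prop

theorem measurable_inner (h : IsIsotropic P u) (w : EuclideanSpace ℝ (Fin d)) :
    Measurable fun ω => inner ℝ w (u ω) := by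
  have := h.measurable
  fun_prop

theorem inner_eq_sum (w v : EuclideanSpace ℝ (Fin d)) : inner ℝ w v = ∑ k, w k * v k := by
  simp [PiLp.inner_apply, mul_comm]

theorem subgaussian_inner (h : IsIsotropic P u) {w : EuclideanSpace ℝ (Fin d)} (hw : ‖w‖ = 1) :
    HasSubgaussianMGF (fun ω => inner ℝ w (u ω)) 1 P := by
  have h1 : iIndepFun (fun k ω => w k * u ω k) P :=
    h.indep.comp (fun k x => w k * x) fun k => by fun_prop
  have h2 : ∀ k, HasSubgaussianMGF (fun ω => w k * u ω k) (‖w k‖₊ ^ 2) P := fun k => by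
    convert! (h.subgaussian k).const_mul (w k) using 1
    refine NNReal.eq ?_
    rw [NNReal.coe_pow, coe_nnnorm, Real.norm_eq_abs, sq_abs]
    exact (mul_one _).symm
  have h3 := HasSubgaussianMGF.sum_of_iIndepFun h1 (s := Finset.univ) fun k _ => h2 k
  have h4 : ∑ k, ‖w k‖₊ ^ 2 = 1 := by
    ext
    push_cast
    rw [← one_pow 2, ← hw, EuclideanSpace.norm_sq_eq]
  rw [h4] at h3
  simpa only [inner_eq_sum] using h3

theorem integrable_pow_four (h : IsIsotropic P u) (k : Fin d) :
    Integrable (fun ω => u ω k ^ 4) P := by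
  have := ((h.subgaussian k).memLp 4).integrable_norm_pow (p := 4) (by norm_num)
  simpa [Real.norm_eq_abs, abs_pow, Even.pow_abs (show Even 4 by decide)] using this

theorem integrable_mul_mul (h : IsIsotropic P u) (k l m : Fin d) :
    Integrable (fun ω => (u ω k ^ 2 - 1) * (u ω l * u ω m)) P := by
  refine ((((integrable_const (2 : ℝ)).add ((h.integrable_pow_four k).const_mul 2)).add
    (h.integrable_pow_four l)).add (h.integrable_pow_four m)).mono' ?_ (.of_forall fun ω => ?_)
  · have := h.measurable; fun_prop
  · simp only [Pi.add_apply, Real.norm_eq_abs]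
    generalize u ω k = s
    generalize u ω l = t
    generalize u ω m = r
    rw [abs_mul, abs_mul]
    have h1 : |s ^ 2 - 1| ≤ s ^ 2 + 1 := abs_le.2 ⟨by nlinarith [sq_nonneg s], by linarith⟩
    have h2 : |t| * |r| ≤ (t ^ 2 + r ^ 2) / 2 := by
      nlinarith [sq_nonneg (|t| - |r|), sq_abs t, sq_abs r]
    calc |s ^ 2 - 1| * (|t| * |r|) ≤ (s ^ 2 + 1) * ((t ^ 2 + r ^ 2) / 2) := by gcongr
      _ ≤ _ := by
        nlinarith [sq_nonneg (s ^ 2 + 1 - t ^ 2), sq_nonneg (s ^ 2 + 1 - r ^ 2),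
          sq_nonneg (s ^ 2 - 1), sq_nonneg (t ^ 2), sq_nonneg (r ^ 2)]

theorem integrable_mul (h : IsIsotropic P u) (l m : Fin d) :
    Integrable (fun ω => u ω l * u ω m) P :=
  MemLp.integrable_mul (p := 2) (q := 2) (by exact_mod_cast (h.subgaussian l).memLp 2)
    (by exact_mod_cast (h.subgaussian m).memLp 2)

theorem integral_mul (h : IsIsotropic P u) (l m : Fin d) :
    ∫ ω, u ω l * u ω m ∂P = if l = m then 1 else 0 := by
  split_ifs with hlm
  · subst hlm
    simpa [sq] using h.second_moment l
  · have := h.measurable_apply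
    rw [(h.indep.indepFun hlm).integral_fun_mul_eq_mul_integral
      (this l).aestronglyMeasurable (this m).aestronglyMeasurable, h.mean, zero_mul]

/-- If one of `l`, `m` differs from the two other indices, its zero mean kills the integral; if `l =
m ≠ k`, the factor `u k ^ 2 - 1` is centred and independent of the rest. -/
theorem integral_mul_mul (h : IsIsotropic P u) (k l m : Fin d) :
    ∫ ω, (u ω k ^ 2 - 1) * (u ω l * u ω m) ∂P =
      if l = m ∧ l = k then ∫ ω, u ω k ^ 4 ∂P - 1 else 0 := by
  have hm := h.measurable_apply
  have hsq : Integrable (fun ω => u ω k ^ 2) P := by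
    simpa [sq] using h.integrable_mul k k
  have step : ∀ l m : Fin d, l ≠ m → m ≠ k →
      ∫ ω, (u ω k ^ 2 - 1) * (u ω l * u ω m) ∂P = 0 := by
    intro l m hlm hmk
    have h1 : IndepFun (fun ω => (u ω k ^ 2 - 1) * u ω l) (fun ω => u ω m) P :=
      (h.indep.indepFun_prodMk hm k l m hmk.symm hlm).comp
        (φ := fun p : ℝ × ℝ => (p.1 ^ 2 - 1) * p.2) (ψ := id) (by fun_prop) measurable_id
    have h2 := h1.integral_fun_mul_eq_mul_integral
      ((((hm k).pow_const 2).sub_const 1).mul (hm l)).aestronglyMeasurable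
      (hm m).aestronglyMeasurable
    rw [h.mean, mul_zero] at h2
    simpa only [mul_assoc] using h2
  by_cases hlm : l = m
  · subst hlm
    by_cases hlk : l = k
    · subst hlk
      have e : ∀ ω, (u ω l ^ 2 - 1) * (u ω l * u ω l) = u ω l ^ 4 - u ω l ^ 2 := fun ω => by ring
      simp only [true_and, if_true, e]
      rw [integral_sub (h.integrable_pow_four l) hsq, h.second_moment]
    · have h1 : IndepFun (fun ω => u ω k ^ 2 - 1) (fun ω => u ω l * u ω l) P :=
        (h.indep.indepFun (Ne.symm hlk)).comp
          (φ := fun p : ℝ => p ^ 2 - 1) (ψ := fun p : ℝ => p * p) (by fun_prop) (by fun_prop)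
      have h2 := h1.integral_fun_mul_eq_mul_integral
        (((hm k).pow_const 2).sub_const 1).aestronglyMeasurable
        ((hm l).mul (hm l)).aestronglyMeasurable
      rw [h2, integral_sub hsq (integrable_const 1), h.second_moment, if_neg fun hc => hlk hc.2]
      simp
  · rw [if_neg (fun hc => hlm hc.1)]
    by_cases hmk : m = k
    · have := step m l (Ne.symm hlm) (fun hc => hlm (hc.trans hmk.symm))
      rw [← this]
      exact integral_congr_ae (.of_forall fun ω => by dsimp only; ring)
    · exact step l m hlm hmk

theorem norm_sq_sub_eq_sum (v : EuclideanSpace ℝ (Fin d)) :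
    ‖v‖ ^ 2 - d = ∑ k, (v k ^ 2 - 1) := by
  rw [EuclideanSpace.real_norm_sq_eq, Finset.sum_sub_distrib]; simp

theorem integrable_weight_mul (h : IsIsotropic P u) (l m : Fin d) :
    Integrable (fun ω => (‖u ω‖ ^ 2 - d) * (u ω l * u ω m)) P := by
  simp_rw [norm_sq_sub_eq_sum, Finset.sum_mul]
  exact integrable_finsetSum _ fun k _ => h.integrable_mul_mul k l m

theorem integral_weight_mul (h : IsIsotropic P u) (l m : Fin d) :
    ∫ ω, (‖u ω‖ ^ 2 - d) * (u ω l * u ω m) ∂P =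
      if l = m then ∫ ω, u ω l ^ 4 ∂P - 1 else 0 := by
  simp_rw [norm_sq_sub_eq_sum, Finset.sum_mul]
  rw [integral_finsetSum _ fun k _ => h.integrable_mul_mul k l m]
  simp_rw [h.integral_mul_mul]
  by_cases hlm : l = m
  · simp [hlm]
  · simp [hlm]

theorem inner_sq_eq_sum (w v : EuclideanSpace ℝ (Fin d)) :
    inner ℝ w v ^ 2 = ∑ l, ∑ m, w l * w m * (v l * v m) := by
  rw [inner_eq_sum, sq, Finset.sum_mul_sum]
  exact Finset.sum_congr rfl fun l _ => Finset.sum_congr rfl fun m _ => by ring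

theorem integral_inner_sq (h : IsIsotropic P u) (w : EuclideanSpace ℝ (Fin d)) :
    ∫ ω, inner ℝ w (u ω) ^ 2 ∂P = ‖w‖ ^ 2 := by
  simp_rw [inner_sq_eq_sum]
  rw [integral_finsetSum _ fun l _ => integrable_finsetSum _ fun m _ =>
    (h.integrable_mul l m).const_mul _, EuclideanSpace.real_norm_sq_eq]
  refine Finset.sum_congr rfl fun l _ => ?_
  rw [integral_finsetSum _ fun m _ => (h.integrable_mul l m).const_mul _]
  simp_rw [integral_const_mul, h.integral_mul]
  simp [sq]

theorem weight_mul_inner_sq_eq_sum (c : ℝ) (w v : EuclideanSpace ℝ (Fin d)) :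
    c * inner ℝ w v ^ 2 = ∑ l, ∑ m, w l * w m * (c * (v l * v m)) := by
  rw [inner_sq_eq_sum, Finset.mul_sum]
  refine Finset.sum_congr rfl fun l _ => ?_
  rw [Finset.mul_sum]
  exact Finset.sum_congr rfl fun m _ => by ring

theorem integrable_weight_inner_sq (h : IsIsotropic P u) (w : EuclideanSpace ℝ (Fin d)) :
    Integrable (fun ω => (‖u ω‖ ^ 2 - d) * inner ℝ w (u ω) ^ 2) P := by
  simp_rw [weight_mul_inner_sq_eq_sum]
  exact integrable_finsetSum _ fun l _ => integrable_finsetSum _ fun m _ =>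
    (h.integrable_weight_mul l m).const_mul _

/-- The spectral gap behind the algorithm: the population form is diagonal and separates coordinates
by their fourth moments. -/
theorem integral_weight_inner_sq (h : IsIsotropic P u) (w : EuclideanSpace ℝ (Fin d)) :
    ∫ ω, (‖u ω‖ ^ 2 - d) * inner ℝ w (u ω) ^ 2 ∂P =
      ∑ l, w l ^ 2 * (∫ ω, u ω l ^ 4 ∂P - 1) := by
  simp_rw [weight_mul_inner_sq_eq_sum]
  rw [integral_finsetSum _ fun l _ => integrable_finsetSum _ fun m _ =>
    (h.integrable_weight_mul l m).const_mul _]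
  refine Finset.sum_congr rfl fun l _ => ?_
  rw [integral_finsetSum _ fun m _ => (h.integrable_weight_mul l m).const_mul _]
  simp_rw [integral_const_mul, h.integral_weight_mul]
  simp [sq]

theorem mgf_weight_le (h : IsIsotropic P u) {lam : ℝ} (hlam : |lam| ≤ 1 / 8) :
    Integrable (fun ω => Real.exp (lam * (‖u ω‖ ^ 2 - d))) P ∧
      ∫ ω, Real.exp (lam * (‖u ω‖ ^ 2 - d)) ∂P ≤ Real.exp (1024 * lam ^ 2 * d) := by
  have hk := fun k =>
    (h.subgaussian k).mgf_sq_sub_one_le (h.measurable_apply k) (h.second_moment k) hlam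
  have hind : iIndepFun (fun k ω => u ω k ^ 2 - 1) P :=
    h.indep.comp (fun (_ : Fin d) (x : ℝ) => x ^ 2 - 1) fun _ =>
      (measurable_id.pow_const 2).sub_const 1
  have hm : ∀ k, Measurable fun ω => u ω k ^ 2 - 1 := fun k =>
    ((h.measurable_apply k).pow_const 2).sub_const 1
  have e : (fun ω => ‖u ω‖ ^ 2 - (d : ℝ)) = ∑ k, fun ω => u ω k ^ 2 - 1 := by
    ext ω; rw [norm_sq_sub_eq_sum, Finset.sum_apply]
  have h1 : Integrable (fun ω => Real.exp (lam * (‖u ω‖ ^ 2 - d))) P := by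
    have := hind.integrable_exp_mul_sum hm (s := Finset.univ) (t := lam) fun k _ => (hk k).1
    rwa [← e] at this
  have h2 : mgf (fun ω => ‖u ω‖ ^ 2 - (d : ℝ)) P lam =
      ∏ k, mgf (fun ω => u ω k ^ 2 - 1) P lam := by
    rw [e]; exact hind.mgf_sum hm Finset.univ
  refine ⟨h1, ?_⟩
  change mgf (fun ω => ‖u ω‖ ^ 2 - (d : ℝ)) P lam ≤ _
  rw [h2]
  calc ∏ k, mgf (fun ω => u ω k ^ 2 - 1) P lam ≤ ∏ _k : Fin d, Real.exp (1024 * lam ^ 2) :=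
        Finset.prod_le_prod (fun _ _ => mgf_nonneg) fun k _ => (hk k).2
    _ = Real.exp (1024 * lam ^ 2 * d) := by
        rw [Finset.prod_const, ← Real.exp_nat_mul, Finset.card_univ, Fintype.card_fin, mul_comm]

theorem integrable_exp_abs_weight (h : IsIsotropic P u) (hd : 0 < d) :
    Integrable (fun ω => Real.exp (|‖u ω‖ ^ 2 - d| / (32 * √d))) P ∧
      ∫ ω, Real.exp (|‖u ω‖ ^ 2 - d| / (32 * √d)) ∂P ≤ 6 := by
  have hd1 : (1 : ℝ) ≤ √d := by rw [Real.one_le_sqrt]; exact_mod_cast hd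
  have hd0 : (0 : ℝ) < √d := by linarith
  -- Chosen so that `1024 * lam ^ 2 * d = 1`; each of the two signed exponentials then has mean at
  -- most `e`, and `2 e ≤ 6`.
  set lam := (32 * √d)⁻¹ with hlam
  have hl0 : 0 < lam := by positivity
  have hl : lam ≤ 1 / 8 := by
    rw [hlam, ← one_div]
    exact one_div_le_one_div_of_le (by norm_num) (by linarith)
  have hl2 : 1024 * lam ^ 2 * d = 1 := by
    rw [hlam, inv_pow, mul_pow, Real.sq_sqrt (Nat.cast_nonneg d)]
    have : (d : ℝ) ≠ 0 := by positivity
    field_simp; norm_num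
  obtain ⟨i1, b1⟩ := h.mgf_weight_le (lam := lam) (by rwa [abs_of_pos hl0])
  obtain ⟨i2, b2⟩ := h.mgf_weight_le (lam := -lam) (by rwa [abs_neg, abs_of_pos hl0])
  rw [neg_sq, hl2] at b2
  rw [hl2] at b1
  have hle : ∀ ω, Real.exp (|‖u ω‖ ^ 2 - d| / (32 * √d)) ≤
      Real.exp (lam * (‖u ω‖ ^ 2 - d)) + Real.exp (-lam * (‖u ω‖ ^ 2 - d)) := by
    intro ω
    rw [div_eq_mul_inv, ← hlam, mul_comm]
    rcases abs_cases (‖u ω‖ ^ 2 - (d : ℝ)) with ⟨e, _⟩ | ⟨e, _⟩ <;> rw [e]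
    · linarith [Real.exp_pos (-lam * (‖u ω‖ ^ 2 - d))]
    · rw [mul_neg, neg_mul]; linarith [Real.exp_pos (lam * (‖u ω‖ ^ 2 - d))]
  have hi : Integrable (fun ω => Real.exp (|‖u ω‖ ^ 2 - d| / (32 * √d))) P :=
    (i1.add i2).mono' (by have := h.measurable; fun_prop)
      (.of_forall fun ω => by rw [Real.norm_eq_abs, Real.abs_exp]; exact hle ω)
  refine ⟨hi, (integral_mono hi (i1.add i2) hle).trans ?_⟩
  simp only [Pi.add_apply]
  rw [integral_add i1 i2]
  linarith [Real.exp_one_lt_d9]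

end IsIsotropic

end Subgaussian

/-! ### Deviation inequalities for the quadratic and quartic sample averages. -/

section Deviations

set_option linter.unusedSectionVars false

variable {Ω : Type*} [MeasurableSpace Ω] {P : Measure Ω} [IsProbabilityMeasure P]

/-- Two-sided deviations of sums of squares of normalised subgaussian variables. -/
theorem measureReal_abs_sum_sq_sub_one_gt_le {n : ℕ} {Y : Fin n → Ω → ℝ}
    (hind : iIndepFun Y P) (hmeas : ∀ i, Measurable (Y i))
    (hsub : ∀ i, HasSubgaussianMGF (Y i) 1 P) (h2 : ∀ i, ∫ ω, Y i ω ^ 2 ∂P = 1)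
    (J : Finset (Fin n)) {s : ℝ} (hs0 : 0 ≤ s) (hs : s ≤ 256) :
    P.real {ω | n * s < |∑ j ∈ J, (Y j ω ^ 2 - 1)|} ≤ 2 * Real.exp (-(n * s ^ 2 / 4096)) := by
  -- The minimiser of `-lam * n * s + 1024 * n * lam ^ 2`; the hypothesis `s ≤ 256` is exactly `lam
  -- ≤ 1 / 8`.
  set lam := s / 2048 with hlam
  have hl0 : 0 ≤ lam := by positivity
  have hl8 : lam ≤ 1 / 8 := by rw [hlam]; linarith
  have hcard : (J.card : ℝ) ≤ n := by
    exact_mod_cast (Finset.card_le_univ J).trans (by simp)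
  have hφ : Measurable fun x : ℝ => x ^ 2 - 1 := (measurable_id.pow_const 2).sub_const 1
  have hexp : -lam * (n * s) + J.card * (1024 * lam ^ 2) ≤ -(n * s ^ 2 / 4096) := by
    have : (J.card : ℝ) * (1024 * lam ^ 2) ≤ n * (1024 * lam ^ 2) := by gcongr
    refine (add_le_add_right this _).trans (le_of_eq ?_)
    rw [hlam]; ring
  have up := measureReal_sum_ge_le_exp (f := fun i ω => Y i ω ^ 2 - 1)
    (hind.comp (fun (_ : Fin n) (x : ℝ) => x ^ 2 - 1) fun _ => hφ) (fun i => hφ.comp (hmeas i))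
    hl0 J
    (fun i => ((hsub i).mgf_sq_sub_one_le (hmeas i) (h2 i) (by rwa [abs_of_nonneg hl0])).1)
    (fun i => ((hsub i).mgf_sq_sub_one_le (hmeas i) (h2 i) (by rwa [abs_of_nonneg hl0])).2)
    (n * s)
  have hneg := fun i => (hsub i).mgf_sq_sub_one_le (hmeas i) (h2 i) (lam := -lam)
    (by rwa [abs_neg, abs_of_nonneg hl0])
  have lo := measureReal_sum_ge_le_exp (f := fun i ω => -(Y i ω ^ 2 - 1))
    (hind.comp (fun (_ : Fin n) (x : ℝ) => -(x ^ 2 - 1)) fun _ => hφ.neg)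
    (fun i => (hφ.comp (hmeas i)).neg) hl0 J (b := 1024 * lam ^ 2)
    (fun i => by simpa only [mul_neg, neg_mul] using (hneg i).1)
    (fun i => by
      have := (hneg i).2
      rw [neg_sq] at this
      refine le_trans (le_of_eq ?_) this
      simp only [mgf, mul_neg, neg_mul])
    (n * s)
  have hsub' : {ω | n * s < |∑ j ∈ J, (Y j ω ^ 2 - 1)|} ⊆
      {ω | n * s ≤ ∑ j ∈ J, (Y j ω ^ 2 - 1)} ∪ {ω | n * s ≤ ∑ j ∈ J, -(Y j ω ^ 2 - 1)} := by
    intro ω hω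
    simp only [Set.mem_ofPred_eq, Set.mem_union, Finset.sum_neg_distrib] at hω ⊢
    rcases lt_abs.1 hω with h | h
    · exact Or.inl h.le
    · exact Or.inr h.le
  calc _ ≤ _ := measureReal_mono hsub'
    _ ≤ _ := measureReal_union_le _ _
    _ ≤ Real.exp (-(n * s ^ 2 / 4096)) + Real.exp (-(n * s ^ 2 / 4096)) :=
      add_le_add (up.trans (Real.exp_le_exp.2 hexp)) (lo.trans (Real.exp_le_exp.2 hexp))
    _ = _ := by ring

variable {n d : ℕ} {u : Fin n → Ω → EuclideanSpace ℝ (Fin d)}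

/-- The homogeneous form, with a strict inequality that makes the event empty at `w = 0`, allows a
random independent vector to be substituted for `w`; the subset `J` serves to leave one sample out.
-/
theorem measureReal_abs_sum_inner_sq_gt_le (hu : ∀ i, IsIsotropic P (u i))
    (hind : iIndepFun u P) (w : EuclideanSpace ℝ (Fin d)) (J : Finset (Fin n)) {s : ℝ}
    (hs0 : 0 ≤ s) (hs : s ≤ 256) :
    P.real {ω | n * s * ‖w‖ ^ 2 < |∑ j ∈ J, (inner ℝ w (u j ω) ^ 2 - ‖w‖ ^ 2)|} ≤
      2 * Real.exp (-(n * s ^ 2 / 4096)) := by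
  rcases eq_or_ne w 0 with rfl | hw
  · simp; positivity
  have hw0 : 0 < ‖w‖ := norm_pos_iff.2 hw
  set e := ‖w‖⁻¹ • w with he
  have he1 : ‖e‖ = 1 := norm_smul_inv_norm (𝕜 := ℝ) hw
  have hwe : ∀ j ω, inner ℝ w (u j ω) ^ 2 - ‖w‖ ^ 2 =
      ‖w‖ ^ 2 * (inner ℝ e (u j ω) ^ 2 - 1) := by
    intro j ω
    rw [he, real_inner_smul_left]
    field_simp
  have key := measureReal_abs_sum_sq_sub_one_gt_le (Y := fun j ω => inner ℝ e (u j ω))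
    (hind.comp (fun (_ : Fin n) (x : EuclideanSpace ℝ (Fin d)) => inner ℝ e x)
      fun _ => by fun_prop)
    (fun j => (hu j).measurable_inner e) (fun j => (hu j).subgaussian_inner he1)
    (fun j => by rw [(hu j).integral_inner_sq, he1, one_pow]) J hs0 hs
  refine le_trans (measureReal_mono fun ω hω => ?_) key
  simp only [Set.mem_ofPred_eq] at hω ⊢
  simp_rw [hwe] at hω
  rw [← Finset.mul_sum, abs_mul, abs_of_nonneg (sq_nonneg ‖w‖), mul_comm] at hω
  exact lt_of_mul_lt_mul_left hω (sq_nonneg _)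

/-- The quadratic form of the other samples, evaluated at one of the samples. -/
theorem measureReal_abs_sum_erase_inner_sq_gt_le (hu : ∀ i, IsIsotropic P (u i))
    (hind : iIndepFun u P) (i : Fin n) {s : ℝ} (hs0 : 0 ≤ s) (hs : s ≤ 256) :
    P.real {ω | n * s * ‖u i ω‖ ^ 2 <
        |∑ j ∈ Finset.univ.erase i, (inner ℝ (u i ω) (u j ω) ^ 2 - ‖u i ω‖ ^ 2)|} ≤
      2 * Real.exp (-(n * s ^ 2 / 4096)) := by
  set T : Finset (Fin n) := Finset.univ.erase i with hT
  have hm : ∀ i, Measurable (u i) := fun i => (hu i).measurable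
  let Z : Ω → (T → EuclideanSpace ℝ (Fin d)) := fun ω j => u j ω
  have hZ : Measurable Z := measurable_pi_lambda _ fun j => hm j
  -- Sample `i` is independent of the others, so Fubini reduces the claim to a fixed direction. No
  -- net is needed, hence no factor `√d` in the deviation.
  have hiZ : IndepFun (u i) Z P :=
    (hind.indepFun_finset {i} T (by simp [hT]) hm).comp
      (φ := fun z : ({i} : Finset (Fin n)) → EuclideanSpace ℝ (Fin d) =>
        z ⟨i, Finset.mem_singleton_self i⟩) (ψ := id) (by fun_prop) measurable_id
  let B : Set (EuclideanSpace ℝ (Fin d) × (T → EuclideanSpace ℝ (Fin d))) :=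
    {p | n * s * ‖p.1‖ ^ 2 < |∑ j, (inner ℝ p.1 (p.2 j) ^ 2 - ‖p.1‖ ^ 2)|}
  have hB : MeasurableSet B := by
    refine measurableSet_lt (by fun_prop) ?_
    refine Measurable.abs (Finset.measurable_sum _ fun j _ => ?_)
    have : Measurable fun p : EuclideanSpace ℝ (Fin d) × (T → EuclideanSpace ℝ (Fin d)) =>
      p.2 j := by fun_prop
    exact ((measurable_fst.inner this).pow_const 2).sub (by fun_prop)
  have hset : {ω | n * s * ‖u i ω‖ ^ 2 <
      |∑ j ∈ T, (inner ℝ (u i ω) (u j ω) ^ 2 - ‖u i ω‖ ^ 2)|} =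
      (fun ω => (u i ω, Z ω)) ⁻¹' B := by
    ext ω
    simp only [Set.mem_ofPred_eq, Set.mem_preimage, B, Z]
    rw [← Finset.sum_coe_sort T fun j => inner ℝ (u i ω) (u j ω) ^ 2 - ‖u i ω‖ ^ 2]
  have hle : P {ω | n * s * ‖u i ω‖ ^ 2 <
      |∑ j ∈ T, (inner ℝ (u i ω) (u j ω) ^ 2 - ‖u i ω‖ ^ 2)|} ≤
      ENNReal.ofReal (2 * Real.exp (-(n * s ^ 2 / 4096))) := by
    rw [hset, ← Measure.map_apply ((hm i).prodMk hZ) hB,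
      (indepFun_iff_map_prod_eq_prod_map_map (hm i).aemeasurable hZ.aemeasurable).1 hiZ,
      Measure.prod_apply hB]
    have := Measure.isProbabilityMeasure_map (μ := P) (hm i).aemeasurable
    refine (lintegral_mono (g := fun _ => ENNReal.ofReal (2 * Real.exp (-(n * s ^ 2 / 4096))))
      fun w => ?_).trans (by simp)
    rw [Measure.map_apply hZ (measurable_prodMk_left hB)]
    refine (ENNReal.le_ofReal_iff_toReal_le (measure_ne_top _ _) (by positivity)).2 ?_
    refine le_trans (le_of_eq ?_) (measureReal_abs_sum_inner_sq_gt_le hu hind w T hs0 hs)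
    rw [measureReal_def]
    congr 2
    ext ω
    simp only [Set.mem_ofPred_eq, Set.mem_preimage, B, Z]
    rw [← Finset.sum_coe_sort T fun j => inner ℝ w (u j ω) ^ 2 - ‖w‖ ^ 2]
  exact ENNReal.toReal_le_of_le_ofReal (by positivity) hle

theorem measureReal_abs_weight_gt_le {u : Ω → EuclideanSpace ℝ (Fin d)} (hu : IsIsotropic P u)
    (hd : 0 < d) (t : ℝ) :
    P.real {ω | 32 * √d * t < |‖u ω‖ ^ 2 - d|} ≤ 6 * Real.exp (-t) := by
  obtain ⟨hi, hle⟩ := hu.integrable_exp_abs_weight hd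
  have hd0 : (0 : ℝ) < 32 * √d := by positivity
  have h1 := mul_meas_ge_le_integral_of_nonneg
    (.of_forall fun ω => (Real.exp_pos (|‖u ω‖ ^ 2 - d| / (32 * √d))).le) hi (Real.exp t)
  have h2 : P.real {ω | 32 * √d * t < |‖u ω‖ ^ 2 - d|} ≤
      P.real {ω | Real.exp t ≤ Real.exp (|‖u ω‖ ^ 2 - d| / (32 * √d))} := by
    refine measureReal_mono fun ω hω => ?_
    simp only [Set.mem_ofPred_eq, Real.exp_le_exp] at hω ⊢
    rw [le_div_iff₀ hd0]
    linarith
  rw [Real.exp_neg, ← div_eq_mul_inv, le_div_iff₀ (Real.exp_pos _), mul_comm]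
  exact (mul_le_mul_of_nonneg_left h2 (Real.exp_pos _).le).trans (h1.trans hle)

/-- Lower deviations of the weighted quadratic form in a direction of Gaussian fourth moments. -/
theorem measureReal_sum_weight_inner_sq_lt_le (hu : ∀ i, IsIsotropic P (u i))
    (hind : iIndepFun u P) (hd : 0 < d) {k₀ : Fin d}
    (h4 : ∀ i k, k ≠ k₀ → ∫ ω, u i ω k ^ 4 ∂P = 3) {w : EuclideanSpace ℝ (Fin d)}
    (hw : w k₀ = 0) :
    P.real {ω | ∑ i, (‖u i ω‖ ^ 2 - d) * inner ℝ w (u i ω) ^ 2 < 3 / 2 * n * ‖w‖ ^ 2} ≤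
      Real.exp (-(n / (16 * 10 ^ 9 * d))) := by
  rcases eq_or_ne w 0 with rfl | hw'
  · simp; positivity
  have hw0 : 0 < ‖w‖ := norm_pos_iff.2 hw'
  set e := ‖w‖⁻¹ • w with he
  have he1 : ‖e‖ = 1 := norm_smul_inv_norm (𝕜 := ℝ) hw'
  have hek : e k₀ = 0 := by simp [he, hw]
  have hdr : (0 : ℝ) < d := by exact_mod_cast hd
  have hsd : (0 : ℝ) < √d := Real.sqrt_pos.2 hdr
  have hsd2 : √(d : ℝ) ^ 2 = d := Real.sq_sqrt hdr.le
  -- The mean `-2` of `f` and the threshold `-3 / 2` leave a gap of `1 / 2`; this is the minimiser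
  -- of `-lam / 2 + lam ^ 2 * 10 ^ 9 * d`.
  set lam : ℝ := 1 / (4 * 10 ^ 9 * d) with hlam
  have hl0 : 0 ≤ lam := by positivity
  have hld : lam * d ≤ 1 / 16 := by
    have : lam * d = 1 / (4 * 10 ^ 9) := by rw [hlam]; field_simp
    rw [this]; norm_num
  let f : Fin n → Ω → ℝ := fun i ω => -((‖u i ω‖ ^ 2 - d) * inner ℝ e (u i ω) ^ 2)
  let φ : EuclideanSpace ℝ (Fin d) → ℝ := fun v => -((‖v‖ ^ 2 - d) * inner ℝ e v ^ 2)
  have hφ : Measurable φ := by fun_prop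
  have hf0 : ∀ i, ∫ ω, f i ω ∂P = -2 := by
    intro i
    simp only [f]
    rw [integral_neg, (hu i).integral_weight_inner_sq]
    have : ∀ l, e l ^ 2 * (∫ ω, u i ω l ^ 4 ∂P - 1) = 2 * e l ^ 2 := by
      intro l
      by_cases hl : l = k₀
      · rw [hl, hek]; ring
      · rw [h4 i l hl]; ring
    simp_rw [this]
    rw [← Finset.mul_sum, ← EuclideanSpace.real_norm_sq_eq, he1]; norm_num
  have hmgf : ∀ i, Integrable (fun ω => Real.exp (lam * f i ω)) P ∧
      mgf (f i) P lam ≤ Real.exp (lam * (-2) + lam ^ 2 * (10 ^ 9 * d)) := by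
    intro i
    obtain ⟨ia, ba⟩ := (hu i).integrable_exp_abs_weight hd
    obtain ⟨iy, bY⟩ := ((hu i).subgaussian_inner he1).integrable_exp_sq
      ((hu i).measurable_inner e)
    refine mgf_le_exp_of_sq_mul_exp_le
      (g := fun ω => d / 2 * (32 ^ 4 * 256 * Real.exp (|‖u i ω‖ ^ 2 - d| / (32 * √d)) +
        8 ^ 4 * 256 * Real.exp (inner ℝ e (u i ω) ^ 2 / 4))) hl0
      ((hu i).integrable_weight_inner_sq e).neg (hf0 i).le
      (((ia.const_mul _).add (iy.const_mul _)).const_mul _) (fun ω => ?_) ?_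
    · simp only [f]
      have hx : -(d : ℝ) ≤ ‖u i ω‖ ^ 2 - d := by nlinarith [sq_nonneg ‖u i ω‖]
      generalize ‖u i ω‖ ^ 2 - (d : ℝ) = a at hx ⊢
      generalize inner ℝ e (u i ω) = y
      -- Only the deterministic bound `-d ≤ a` enters the exponential, so `lam` of order `1 / d` is
      -- admissible although `a * y ^ 2` has heavy upper tails.
      have h1 : lam * max (-(a * y ^ 2)) 0 ≤ y ^ 2 / 16 := by
        have : max (-(a * y ^ 2)) 0 ≤ d * y ^ 2 :=
          max_le (by nlinarith [sq_nonneg y]) (by positivity)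
        calc lam * max (-(a * y ^ 2)) 0 ≤ lam * (d * y ^ 2) := by gcongr
          _ = lam * d * y ^ 2 := by ring
          _ ≤ 1 / 16 * y ^ 2 := by gcongr
          _ = _ := by ring
      have h2 := pow_four_le_exp (x := |a| / (32 * √d)) (by positivity)
      have h3 := pow_four_le_exp (x := y ^ 2 / 8) (by positivity)
      have h4 : a ^ 4 = 32 ^ 4 * d ^ 2 * (|a| / (32 * √d)) ^ 4 := by
        have hd4 : √(d : ℝ) ^ 4 = d ^ 2 := by
          rw [show √(d : ℝ) ^ 4 = (√(d : ℝ) ^ 2) ^ 2 by ring, hsd2]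
        rw [div_pow, mul_pow, hd4, Even.pow_abs (by decide)]
        field_simp
      have h5 : Real.exp (y ^ 2 / 16) ^ 2 = Real.exp (y ^ 2 / 8) := by
        rw [← Real.exp_nat_mul]; push_cast; ring_nf
      have h6 : Real.exp (y ^ 2 / 8) * Real.exp (y ^ 2 / 8) = Real.exp (y ^ 2 / 4) := by
        rw [← Real.exp_add]; ring_nf
      set E := Real.exp (y ^ 2 / 16)
      -- The weight `d` balances the two terms, because `a` is typically of order `√d`.
      have h7 : a ^ 2 * (y ^ 4 * E) ≤ 1 / 2 * (a ^ 4 / d + d * (y ^ 8 * E ^ 2)) := by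
        have : 0 ≤ 1 / d * (a ^ 2 - d * (y ^ 4 * E)) ^ 2 := by positivity
        have e1 : 1 / d * (a ^ 2 - d * (y ^ 4 * E)) ^ 2 =
            a ^ 4 / d - 2 * (a ^ 2 * (y ^ 4 * E)) + d * (y ^ 8 * E ^ 2) := by
          field_simp; ring
        linarith
      calc (-(a * y ^ 2)) ^ 2 * Real.exp (lam * max (-(a * y ^ 2)) 0)
          ≤ (-(a * y ^ 2)) ^ 2 * E := by gcongr; exact Real.exp_le_exp.2 h1
        _ = a ^ 2 * (y ^ 4 * E) := by ring
        _ ≤ 1 / 2 * (a ^ 4 / d + d * (y ^ 8 * E ^ 2)) := h7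
        _ = d / 2 * (32 ^ 4 * (|a| / (32 * √d)) ^ 4 +
              8 ^ 4 * ((y ^ 2 / 8) ^ 4 * Real.exp (y ^ 2 / 8))) := by
            rw [h4, h5]; field_simp
        _ ≤ d / 2 * (32 ^ 4 * (256 * Real.exp (|a| / (32 * √d))) +
              8 ^ 4 * ((256 * Real.exp (y ^ 2 / 8)) * Real.exp (y ^ 2 / 8))) := by gcongr
        _ = _ := by rw [mul_assoc 256, h6]; ring
    · rw [integral_const_mul, integral_add (ia.const_mul _) (iy.const_mul _),
        integral_const_mul, integral_const_mul]
      have : (32 ^ 4 * 256 * ∫ ω, Real.exp (|‖u i ω‖ ^ 2 - d| / (32 * √d)) ∂P) +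
          8 ^ 4 * 256 * ∫ ω, Real.exp (inner ℝ e (u i ω) ^ 2 / 4) ∂P ≤ 2 * 10 ^ 9 := by
        linarith
      nlinarith
  have hch := measureReal_sum_ge_le_exp (f := f) (hind.comp (fun _ : Fin n => φ) fun _ => hφ)
    (fun i => hφ.comp (hu i).measurable) hl0 Finset.univ (fun i => (hmgf i).1)
    (fun i => (hmgf i).2) (-(3 / 2 * n))
  refine le_trans (measureReal_mono fun ω hω => ?_) (hch.trans (Real.exp_le_exp.2 ?_))
  · simp only [Set.mem_ofPred_eq, f, Finset.sum_neg_distrib] at hω ⊢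
    have hwe : ∀ i, (‖u i ω‖ ^ 2 - d) * inner ℝ w (u i ω) ^ 2 =
        ‖w‖ ^ 2 * ((‖u i ω‖ ^ 2 - d) * inner ℝ e (u i ω) ^ 2) := by
      intro i
      rw [he, real_inner_smul_left]
      field_simp
    simp_rw [hwe] at hω
    rw [← Finset.mul_sum, mul_comm] at hω
    exact neg_le_neg (lt_of_mul_lt_mul_right hω (sq_nonneg _)).le
  · rw [Finset.card_univ, Fintype.card_fin, hlam]
    apply le_of_eq
    field_simp
    ring

/-- Upper deviations of a weighted entry of the sample covariance. -/
theorem measureReal_sum_weight_mul_ge_le (hu : ∀ i, IsIsotropic P (u i)) (hind : iIndepFun u P)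
    (hd : 0 < d) (l l' : Fin d) {κ c m : ℝ} (hκ : 1 ≤ κ) (hn : 3 ≤ n)
    (hsmall : √(Real.log n / n) * ((κ + 1) * Real.log n) ^ 2 ≤ 1) (hc : |c| ≤ 1)
    (hm : ∀ i, c * ∫ ω, (‖u i ω‖ ^ 2 - d) * (u i ω l * u i ω l') ∂P ≤ m) :
    P.real {ω | n * m + 128 * √d * ((3072 + κ) * √(n * Real.log n)) ≤
        c * ∑ i, (‖u i ω‖ ^ 2 - d) * (u i ω l * u i ω l')} ≤
      (Real.exp 64 + 4) * (n : ℝ) ^ (-κ) := by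
  have hdr : (0 : ℝ) < d := by exact_mod_cast hd
  have hsd : (0 : ℝ) < 128 * √d := by positivity
  let φ : EuclideanSpace ℝ (Fin d) → ℝ := fun v =>
    c * ((‖v‖ ^ 2 - d) * (v l * v l')) / (128 * √d)
  have hφ : Measurable φ := by fun_prop
  -- The square root of a product is at most the average of its factors, and convexity of `exp` then
  -- separates the weight from the two coordinates.
  have hφb : ∀ v, Real.exp √|φ v| ≤ 1 / 2 * Real.exp (|‖v‖ ^ 2 - d| / (32 * √d)) +
      1 / 4 * (Real.exp (v l ^ 2 / 4) + Real.exp (v l' ^ 2 / 4)) := by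
    intro v
    have hexp2 : ∀ x y : ℝ, Real.exp ((x + y) / 2) ≤ (Real.exp x + Real.exp y) / 2 := by
      intro x y
      have h1 : Real.exp ((x + y) / 2) = Real.exp (x / 2) * Real.exp (y / 2) := by
        rw [← Real.exp_add]; ring_nf
      have h2 : ∀ z : ℝ, Real.exp z = Real.exp (z / 2) ^ 2 := fun z => by
        rw [← Real.exp_nat_mul]; push_cast; ring_nf
      rw [h1, h2 x, h2 y]
      nlinarith [sq_nonneg (Real.exp (x / 2) - Real.exp (y / 2))]
    set α := |‖v‖ ^ 2 - d| / (32 * √d) with hα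
    have hα0 : 0 ≤ α := by positivity
    have hβ : |v l| * |v l'| ≤ (v l ^ 2 + v l' ^ 2) / 2 := by
      nlinarith [sq_nonneg (|v l| - |v l'|), sq_abs (v l), sq_abs (v l')]
    have h1 : |φ v| ≤ α * ((v l ^ 2 + v l' ^ 2) / 8) := by
      calc |φ v| = |c| * (α * (|v l| * |v l'| / 4)) := by
            simp only [φ]
            rw [abs_div, abs_mul, abs_mul, abs_mul, abs_of_pos hsd, hα]
            field_simp; ring
        _ ≤ 1 * (α * ((v l ^ 2 + v l' ^ 2) / 2 / 4)) := by gcongr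
        _ = _ := by ring
    have h2 : √|φ v| ≤ (α + (v l ^ 2 / 4 + v l' ^ 2 / 4) / 2) / 2 := by
      rw [Real.sqrt_le_iff]
      refine ⟨by positivity, h1.trans ?_⟩
      nlinarith [sq_nonneg (α - (v l ^ 2 / 4 + v l' ^ 2 / 4) / 2)]
    have h3 := hexp2 α ((v l ^ 2 / 4 + v l' ^ 2 / 4) / 2)
    have h4 := hexp2 (v l ^ 2 / 4) (v l' ^ 2 / 4)
    have h5 := Real.exp_le_exp.2 h2
    linarith
  have hdom : ∀ i, Integrable (fun ω => 1 / 2 * Real.exp (|‖u i ω‖ ^ 2 - d| / (32 * √d)) +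
      1 / 4 * (Real.exp (u i ω l ^ 2 / 4) + Real.exp (u i ω l' ^ 2 / 4))) P ∧
      ∫ ω, (1 / 2 * Real.exp (|‖u i ω‖ ^ 2 - d| / (32 * √d)) +
      1 / 4 * (Real.exp (u i ω l ^ 2 / 4) + Real.exp (u i ω l' ^ 2 / 4))) ∂P ≤ 4 := by
    intro i
    obtain ⟨ia, ba⟩ := (hu i).integrable_exp_abs_weight hd
    obtain ⟨i1, b1⟩ := ((hu i).subgaussian l).integrable_exp_sq ((hu i).measurable_apply l)
    obtain ⟨i2, b2⟩ := ((hu i).subgaussian l').integrable_exp_sq ((hu i).measurable_apply l')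
    have i12 := (i1.add i2).const_mul (1 / 4)
    refine ⟨(ia.const_mul _).add i12, ?_⟩
    simp only [Pi.add_apply] at i12
    rw [integral_add (ia.const_mul _) i12, integral_const_mul, integral_const_mul,
      integral_add i1 i2]
    linarith
  have hfint : ∀ i, Integrable (fun ω => Real.exp √|φ (u i ω)|) P := fun i =>
    (hdom i).1.mono'
      (hφ.comp (hu i).measurable).abs.sqrt.exp.aestronglyMeasurable
      (.of_forall fun ω => by rw [Real.norm_eq_abs, Real.abs_exp]; exact hφb _)
  have key := measureReal_sum_ge_le_of_exp_sqrt (f := fun i ω => φ (u i ω)) (K := 4)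
    (m := m / (128 * √d))
    (hind.comp (fun _ : Fin n => φ) fun _ => hφ) (fun i => hφ.comp (hu i).measurable) hκ hn hfint
    (fun i => (integral_mono (hfint i) (hdom i).1 fun ω => hφb _).trans (hdom i).2)
    (fun i => by
      simp only [φ]
      rw [integral_div, integral_const_mul]
      exact div_le_div_of_nonneg_right (hm i) hsd.le) hsmall
  rw [show (768 : ℝ) * 4 = 3072 by norm_num, show (16 : ℝ) * 4 = 64 by norm_num] at key
  refine le_trans (measureReal_mono fun ω hω => ?_) key
  simp only [Set.mem_ofPred_eq, φ] at hω ⊢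
  rw [← Finset.sum_div, ← Finset.mul_sum, le_div_iff₀ hsd]
  refine le_trans (le_of_eq ?_) hω
  field_simp

end Deviations

/-! ### Perturbation of quadratic forms, error counting and nets. -/

section Deterministic

variable {n d : ℕ}

/-- The bilinear form `n⁻¹ ∑ i, c i ⟪u i, v⟫ ⟪u i, w⟫`. -/
noncomputable def wform (c : Fin n → ℝ) (u : Fin n → EuclideanSpace ℝ (Fin d))
    (v w : EuclideanSpace ℝ (Fin d)) : ℝ :=
  (n : ℝ)⁻¹ * ∑ i, c i * (inner ℝ (u i) v * inner ℝ (u i) w)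

variable {u : Fin n → EuclideanSpace ℝ (Fin d)} {c c' : Fin n → ℝ}

theorem wform_comm (v w : EuclideanSpace ℝ (Fin d)) : wform c u v w = wform c u w v := by
  simp only [wform, mul_comm (inner ℝ (u _) v)]

theorem wform_add_left (v v' w : EuclideanSpace ℝ (Fin d)) :
    wform c u (v + v') w = wform c u v w + wform c u v' w := by
  simp only [wform, inner_add_right, add_mul, mul_add, Finset.sum_add_distrib]

theorem wform_smul_left (r : ℝ) (v w : EuclideanSpace ℝ (Fin d)) :
    wform c u (r • v) w = r * wform c u v w := by
  simp only [wform, real_inner_smul_right, Finset.mul_sum]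
  exact Finset.sum_congr rfl fun i _ => by ring

theorem wform_add_right (v w w' : EuclideanSpace ℝ (Fin d)) :
    wform c u v (w + w') = wform c u v w + wform c u v w' := by
  rw [wform_comm, wform_add_left, wform_comm w, wform_comm w']

theorem wform_smul_right (r : ℝ) (v w : EuclideanSpace ℝ (Fin d)) :
    wform c u v (r • w) = r * wform c u v w := by
  rw [wform_comm, wform_smul_left, wform_comm]

theorem wform_sub_right (v w w' : EuclideanSpace ℝ (Fin d)) :
    wform c u v (w - w') = wform c u v w - wform c u v w' := by
  rw [sub_eq_add_neg, ← neg_one_smul ℝ, wform_add_right, wform_smul_right]; ring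

theorem wform_sub_left (v v' w : EuclideanSpace ℝ (Fin d)) :
    wform c u (v - v') w = wform c u v w - wform c u v' w := by
  rw [wform_comm, wform_sub_right, wform_comm w, wform_comm w]

theorem wform_sub_weight (v w : EuclideanSpace ℝ (Fin d)) :
    wform (c - c') u v w = wform c u v w - wform c' u v w := by
  simp only [wform, Pi.sub_apply, sub_mul, Finset.sum_sub_distrib, mul_sub]

theorem wform_one_self_nonneg (v : EuclideanSpace ℝ (Fin d)) : 0 ≤ wform 1 u v v := by
  simp only [wform, Pi.one_apply, one_mul]
  exact mul_nonneg (by positivity) (Finset.sum_nonneg fun i _ => mul_self_nonneg _)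

theorem abs_wform_le {M : ℝ} (hM : ∀ i, |c i| ≤ M) (hM0 : 0 ≤ M)
    (v w : EuclideanSpace ℝ (Fin d)) :
    |wform c u v w| ≤ M * (√(wform 1 u v v) * √(wform 1 u w w)) := by
  have hn : (0 : ℝ) ≤ (n : ℝ)⁻¹ := by positivity
  have h1 := Real.sum_mul_le_sqrt_mul_sqrt Finset.univ (fun i => |inner ℝ (u i) v|)
    fun i => |inner ℝ (u i) w|
  have e : ∀ v, wform 1 u v v = (n : ℝ)⁻¹ * ∑ i, |inner ℝ (u i) v| ^ 2 := by
    intro v; simp only [wform, Pi.one_apply, one_mul, sq_abs]; simp only [sq]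
  calc |wform c u v w| = (n : ℝ)⁻¹ * |∑ i, c i * (inner ℝ (u i) v * inner ℝ (u i) w)| := by
        rw [wform, abs_mul, abs_of_nonneg hn]
    _ ≤ (n : ℝ)⁻¹ * ∑ i, M * (|inner ℝ (u i) v| * |inner ℝ (u i) w|) := by
        refine mul_le_mul_of_nonneg_left ((Finset.abs_sum_le_sum_abs _ _).trans ?_) hn
        refine Finset.sum_le_sum fun i _ => ?_
        rw [abs_mul, abs_mul]
        exact mul_le_mul_of_nonneg_right (hM i) (by positivity)
    _ ≤ (n : ℝ)⁻¹ * (M * (√(∑ i, |inner ℝ (u i) v| ^ 2) * √(∑ i, |inner ℝ (u i) w| ^ 2))) := by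
        rw [← Finset.mul_sum]
        gcongr
    _ = _ := by
        rw [e, e, Real.sqrt_mul hn, Real.sqrt_mul hn]
        have := Real.mul_self_sqrt hn
        linear_combination (-M * √(∑ i, |inner ℝ (u i) v| ^ 2) *
          √(∑ i, |inner ℝ (u i) w| ^ 2)) * this

/-- A symmetric form that is close to the inner product on the diagonal is close to it. -/
theorem abs_wform_one_sub_inner_le {η : ℝ}
    (hη : ∀ v, |wform 1 u v v - ‖v‖ ^ 2| ≤ η * ‖v‖ ^ 2) (v w : EuclideanSpace ℝ (Fin d)) :
    |wform 1 u v w - inner ℝ v w| ≤ η * (‖v‖ * ‖w‖) := by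
  rcases eq_or_ne v 0 with rfl | hv
  · simp [wform]
  rcases eq_or_ne w 0 with rfl | hw
  · simp [wform]
  have hv0 : 0 < ‖v‖ := norm_pos_iff.2 hv
  have hw0 : 0 < ‖w‖ := norm_pos_iff.2 hw
  -- Rescaling to equal norms before polarising gives the product `‖v‖ * ‖w‖` in the bound.
  set x := ‖w‖ • v
  set y := ‖v‖ • w
  have hx : ‖x‖ ^ 2 = (‖v‖ * ‖w‖) ^ 2 := by simp [x, norm_smul]; ring
  have hy : ‖y‖ ^ 2 = (‖v‖ * ‖w‖) ^ 2 := by simp [y, norm_smul]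
  have e1 : wform 1 u (x + y) (x + y) - wform 1 u (x - y) (x - y) = 4 * wform 1 u x y := by
    rw [wform_add_left, wform_add_right, wform_add_right, wform_sub_left, wform_sub_right,
      wform_sub_right, wform_comm y x]; ring
  have e2 : ‖x + y‖ ^ 2 - ‖x - y‖ ^ 2 = 4 * inner ℝ x y := by
    rw [norm_add_sq_real, norm_sub_sq_real]; ring
  have e3 : ‖x + y‖ ^ 2 + ‖x - y‖ ^ 2 = 4 * (‖v‖ * ‖w‖) ^ 2 := by
    rw [norm_add_sq_real, norm_sub_sq_real, hx, hy]; ring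
  have e4 : wform 1 u x y - inner ℝ x y =
      (‖v‖ * ‖w‖) * (wform 1 u v w - inner ℝ v w) := by
    simp only [x, y, wform_smul_left, wform_smul_right, real_inner_smul_left,
      real_inner_smul_right]; ring
  have h1 := abs_le.1 (hη (x + y))
  have h2 := abs_le.1 (hη (x - y))
  have h3 : |wform 1 u x y - inner ℝ x y| ≤ η * (‖v‖ * ‖w‖) ^ 2 := by
    rw [abs_le]
    have : η * ‖x + y‖ ^ 2 + η * ‖x - y‖ ^ 2 = 4 * (η * (‖v‖ * ‖w‖) ^ 2) := by
      rw [← mul_add, e3]; ring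
    constructor <;> linarith
  rw [e4, abs_mul, abs_of_pos (by positivity)] at h3
  have : 0 < ‖v‖ * ‖w‖ := by positivity
  refine le_of_mul_le_mul_left (h3.trans (le_of_eq ?_)) this
  ring

/-- If `p` solves `Ĝ p = u` for the sample second moment form `Ĝ`, then `⟪u, p⟫` is close to
`‖u‖²`. -/
theorem abs_inner_sub_norm_sq_le {η ε R : ℝ} (hη0 : 0 ≤ η) (hη2 : η ≤ 1 / 2)
    (hη : ∀ v, |wform 1 u v v - ‖v‖ ^ 2| ≤ η * ‖v‖ ^ 2) {x p : EuclideanSpace ℝ (Fin d)}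
    (hp : ∀ z, wform 1 u p z = inner ℝ x z)
    (hx : |wform 1 u x x - ‖x‖ ^ 2| ≤ ε) (hR : ‖x‖ ^ 2 ≤ R) :
    |inner ℝ x p - ‖x‖ ^ 2| ≤ ε + 2 * η ^ 2 * R := by
  have hD := abs_wform_one_sub_inner_le hη
  have h1 : ‖p - x‖ ≤ η * ‖p‖ := by
    have e : ‖p - x‖ ^ 2 = -(wform 1 u p (p - x) - inner ℝ p (p - x)) := by
      rw [hp, ← real_inner_self_eq_norm_sq, inner_sub_left]; ring
    have h2 := hD p (p - x)
    have h3 : ‖p - x‖ ^ 2 ≤ η * ‖p‖ * ‖p - x‖ := by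
      rw [e]; refine (neg_le_abs _).trans (h2.trans (le_of_eq (by ring)))
    rcases (norm_nonneg (p - x)).eq_or_lt with h0 | h0
    · rw [← h0]; positivity
    · rw [sq] at h3; exact le_of_mul_le_mul_right h3 h0
  have h2 : ‖p‖ ≤ 2 * ‖x‖ := by
    have h3 : ‖p‖ ≤ ‖p - x‖ + ‖x‖ := by simpa using norm_add_le (p - x) x
    nlinarith [norm_nonneg p]
  -- With `D = Ĝ - 1` this is the expansion `-⟪x, D x⟫ - ⟪p - x, D x⟫`. Since `p - x = -D p`, the
  -- last term is of second order in `η`.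
  have e : inner ℝ x p - ‖x‖ ^ 2 =
      -(wform 1 u x x - ‖x‖ ^ 2) - (wform 1 u (p - x) x - inner ℝ (p - x) x) := by
    rw [wform_sub_left, hp, inner_sub_left, real_inner_self_eq_norm_sq, real_inner_comm p x]
    ring
  have h4 := hD (p - x) x
  have h5 : η * (‖p - x‖ * ‖x‖) ≤ 2 * η ^ 2 * R := by
    calc η * (‖p - x‖ * ‖x‖) ≤ η * ((η * (2 * ‖x‖)) * ‖x‖) := by
          gcongr; exact h1.trans (by gcongr)
      _ = 2 * η ^ 2 * ‖x‖ ^ 2 := by ring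
      _ ≤ _ := by gcongr
  rw [e]
  refine (abs_sub _ _).trans ?_
  rw [abs_neg]
  linarith

/-- Perturbation bound for the minimiser of a weighted quadratic form. -/
theorem exists_decomposition_of_bottom {e q : EuclideanSpace ℝ (Fin d)} {h : Fin n → ℝ}
    {l ε η : ℝ} (he : ‖e‖ = 1) (hη0 : 0 ≤ η) (hηε : η ≤ ε) (hε : ε ≤ 1 / 100)
    (hη : ∀ v, |wform 1 u v v - ‖v‖ ^ 2| ≤ η * ‖v‖ ^ 2)
    (hh : ∀ i, |h i - ‖u i‖ ^ 2| ≤ ε)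
    (hee : wform (fun i => ‖u i‖ ^ 2 - d) u e e ≤ 1 / 2)
    (heb : ∀ b, inner ℝ e b = 0 → |wform (fun i => ‖u i‖ ^ 2 - d) u e b| ≤ ε * ‖b‖)
    (hbb : ∀ b, inner ℝ e b = 0 → 7 / 5 * ‖b‖ ^ 2 ≤ wform (fun i => ‖u i‖ ^ 2 - d) u b b)
    (hq : wform 1 u q q = 1)
    (heig : ∀ p, wform (fun i => h i - d) u q p = l * wform 1 u q p)
    (hray : ∀ p, l * wform 1 u p p ≤ wform (fun i => h i - d) u p p) :
    ∃ (α : ℝ) (b : EuclideanSpace ℝ (Fin d)), q = α • e + b ∧ inner ℝ e b = 0 ∧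
      ‖b‖ ≤ 20 * ε ∧ 1 / 2 ≤ α ^ 2 ∧ α ^ 2 ≤ 2 := by
  have hη1 : η ≤ 1 / 100 := hηε.trans hε
  have hε0 : 0 ≤ ε := hη0.trans hηε
  set α := inner ℝ e q with hα
  set b := q - α • e with hb
  have hqe : q = α • e + b := by rw [hb]; abel
  have hob : inner ℝ e b = 0 := by
    rw [hb, inner_sub_right, real_inner_smul_right, real_inner_self_eq_norm_sq, he, ← hα]; ring
  have hqn : ‖q‖ ^ 2 = α ^ 2 + ‖b‖ ^ 2 := by
    rw [hqe, norm_add_sq_real, real_inner_smul_left, hob, norm_smul, he, Real.norm_eq_abs,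
      mul_one, sq_abs]; ring
  have hqb := abs_le.1 (hη q)
  rw [hq] at hqb
  have hq2 : ‖q‖ ^ 2 ≤ 100 / 99 := by nlinarith [sq_nonneg ‖q‖]
  have hq1 : 100 / 101 ≤ ‖q‖ ^ 2 := by nlinarith [sq_nonneg ‖q‖]
  have hα2 : α ^ 2 ≤ 2 := by nlinarith [sq_nonneg ‖b‖]
  have hαabs : |α| ≤ 2 := abs_le_of_sq_le_sq (by linarith) (by norm_num)
  set a : Fin n → ℝ := fun i => ‖u i‖ ^ 2 - d with ha
  set h' : Fin n → ℝ := fun i => h i - d with hh'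
  have hdiff : ∀ v w, |wform h' u v w - wform a u v w| ≤
      ε * (√(wform 1 u v v) * √(wform 1 u w w)) := by
    intro v w
    rw [← wform_sub_weight]
    exact abs_wform_le (fun i => by
      simp only [Pi.sub_apply, ha, hh', sub_sub_sub_cancel_right]; exact hh i) hε0 v w
  have hsq : ∀ v, √(wform 1 u v v) ≤ 2 * ‖v‖ := by
    intro v
    rw [Real.sqrt_le_iff]
    refine ⟨by positivity, ?_⟩
    have := (abs_le.1 (hη v)).2
    nlinarith [sq_nonneg ‖v‖]
  -- the smallest eigenvalue
  have hl : l ≤ 3 / 5 := by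
    by_contra hc
    rw [not_le] at hc
    have h1 := hray e
    have h2 := (abs_le.1 (hdiff e e)).2
    rw [Real.mul_self_sqrt (wform_one_self_nonneg e)] at h2
    have h3 := abs_le.1 (hη e)
    rw [he] at h3
    nlinarith
  have hbnn := norm_nonneg b
  have hbn := abs_le.1 (hη b)
  have hebη := abs_wform_one_sub_inner_le hη e b
  rw [hob, sub_zero, he, one_mul] at hebη
  -- The eigenvalue equation is tested against `b`: the left side is at least `7 / 5 * ‖b‖ ^ 2` and
  -- the right side about `3 / 5 * ‖b‖ ^ 2` at most, both up to errors of order `ε * ‖b‖`.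
  have hb1 : ‖b‖ ≤ 20 * ε := by
    have k1 := heig b
    have k2 := (abs_le.1 (hdiff q b)).1
    rw [hq, Real.sqrt_one, one_mul] at k2
    have k3 : wform a u q b = α * wform a u e b + wform a u b b := by
      rw [hqe, wform_add_left, wform_smul_left]
    have k4 : wform 1 u q b = α * wform 1 u e b + wform 1 u b b := by
      rw [hqe, wform_add_left, wform_smul_left]
    have k5 := hbb b hob
    have k6 : |α * wform a u e b| ≤ 2 * (ε * ‖b‖) := by
      rw [abs_mul]; exact mul_le_mul hαabs (heb b hob) (abs_nonneg _) (by norm_num)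
    have k7 : |α * wform 1 u e b| ≤ 2 * (η * ‖b‖) := by
      rw [abs_mul]; exact mul_le_mul hαabs hebη (abs_nonneg _) (by norm_num)
    have k8 : ε * √(wform 1 u b b) ≤ ε * (2 * ‖b‖) := by gcongr; exact hsq b
    rw [abs_le] at k6 k7
    rw [k1, k4] at k2
    by_contra hc
    rw [not_le] at hc
    have hbpos : 0 < ‖b‖ := by linarith
    have hηb : η * ‖b‖ ≤ ε * ‖b‖ := by gcongr
    have hεb : ε * ‖b‖ ≤ 1 / 20 * ‖b‖ ^ 2 := by nlinarith
    have hbsq : 0 < ‖b‖ ^ 2 := by positivity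
    have hηbb : η * ‖b‖ ^ 2 ≤ 1 / 100 * ‖b‖ ^ 2 := by gcongr
    -- `X` is the form of the second argument in the eigenvalue equation
    set X := α * wform 1 u e b + wform 1 u b b with hX
    -- This sign lets `l` be replaced by `3 / 5` without any lower bound on `l`.
    have hX0 : 0 ≤ X := by linarith
    have hX1 : X ≤ (1 + 1 / 100 + 1 / 10) * ‖b‖ ^ 2 := by linarith
    have hlX : l * X ≤ 3 / 5 * X := by gcongr
    linarith
  refine ⟨α, b, hqe, hob, hb1, ?_, hα2⟩
  have : ‖b‖ ^ 2 ≤ (1 / 5) ^ 2 := by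
    gcongr; linarith
  nlinarith

/-- Counting the sign errors of a vector that is close to a multiple of the label vector. -/
theorem misclass_le {y : Fin n → ℤˣ} {z r : Fin n → ℝ} {t : ℝ} (hn : 0 < n)
    (hz : ∀ i, z i = t * (((y i : ℤˣ) : ℤ) : ℝ) + r i) (ht : 1 / 4 ≤ t ^ 2) :
    misclass (fun i => sgn (z i)) y ≤ 4 * ((n : ℝ)⁻¹ * ∑ i, r i ^ 2) := by
  -- Chebyshev: a wrong sign forces `|r i| ≥ |t|`. The sign of `t` decides which global flip in the
  -- minimum is used.
  have hcount : ∀ s : Finset (Fin n), (∀ i ∈ s, t ^ 2 ≤ r i ^ 2) →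
      (s.card : ℝ) ≤ 4 * ∑ i, r i ^ 2 := by
    intro s hs
    have h1 : (s.card : ℝ) * (1 / 4) ≤ ∑ i ∈ s, r i ^ 2 := by
      rw [← nsmul_eq_mul]
      exact Finset.card_nsmul_le_sum _ _ _ fun i hi => ht.trans (hs i hi)
    have h2 : ∑ i ∈ s, r i ^ 2 ≤ ∑ i, r i ^ 2 :=
      Finset.sum_le_sum_of_subset_of_nonneg (Finset.subset_univ _) fun _ _ _ => sq_nonneg _
    linarith
  have hn0 : (0 : ℝ) < n := by exact_mod_cast hn
  rw [misclass, mul_left_comm]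
  refine mul_le_mul_of_nonneg_left ?_ (by positivity)
  rcases le_total 0 t with h0 | h0
  · refine (min_le_left _ _).trans (hcount _ fun i hi => ?_)
    simp only [Finset.mem_filter, Finset.mem_univ, true_and] at hi
    have hzi := hz i
    rcases Int.units_eq_one_or (y i) with hy | hy
    · rw [hy] at hi hzi
      have : z i < 0 := by by_contra hc; exact hi (if_pos (not_lt.1 hc))
      push_cast at hzi
      nlinarith
    · rw [hy] at hi hzi
      have : 0 ≤ z i := by by_contra hc; exact hi (if_neg hc)
      push_cast at hzi
      nlinarith
  · refine (min_le_right _ _).trans (hcount _ fun i hi => ?_)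
    simp only [Finset.mem_filter, Finset.mem_univ, true_and] at hi
    have hzi := hz i
    rcases Int.units_eq_one_or (y i) with hy | hy
    · rw [hy] at hi hzi
      have : 0 ≤ z i := by
        by_contra hc; apply hi; rw [sgn, if_neg hc]; exact neg_neg _
      push_cast at hzi
      nlinarith
    · rw [hy] at hi hzi
      have : z i < 0 := by
        by_contra hc; apply hi; rw [sgn, if_pos (not_lt.1 hc)]
      push_cast at hzi
      nlinarith

/-- The lattice points of mesh `1 / N` in the cube `[-1, 1]^d`. -/
noncomputable def gridNet (d N : ℕ) : Finset (EuclideanSpace ℝ (Fin d)) :=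
  (Fintype.piFinset fun _ : Fin d => Finset.Icc (-(N : ℤ)) N).image fun g =>
    WithLp.toLp 2 fun k => (g k : ℝ) / N

theorem card_gridNet_le (d N : ℕ) : (gridNet d N).card ≤ (2 * N + 1) ^ d := by
  refine Finset.card_image_le.trans (le_of_eq ?_)
  rw [Fintype.card_piFinset]
  simp only [Int.card_Icc, Finset.prod_const, Finset.card_univ, Fintype.card_fin]
  congr 1
  omega

/-- Rounding down coordinatewise fixes zero coordinates, so the same grid is also a net of the
hyperplane orthogonal to a basis vector. -/
theorem exists_mem_gridNet {N : ℕ} (hN : 0 < N) (v : EuclideanSpace ℝ (Fin d)) (hv : ‖v‖ ≤ 1) :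
    ∃ p ∈ gridNet d N, ‖v - p‖ ≤ d / N ∧ ∀ k, v k = 0 → p k = 0 := by
  have hN0 : (0 : ℝ) < N := by exact_mod_cast hN
  have hvk : ∀ k, |v k| ≤ 1 := fun k => (PiLp.norm_apply_le v k).trans hv
  refine ⟨WithLp.toLp 2 fun k => ((⌊N * v k⌋ : ℤ) : ℝ) / N, ?_, ?_, ?_⟩
  · refine Finset.mem_image.2 ⟨fun k => ⌊N * v k⌋, ?_, rfl⟩
    rw [Fintype.mem_piFinset]
    intro k
    have h1 := abs_le.1 (hvk k)
    rw [Finset.mem_Icc]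
    constructor
    · rw [Int.le_floor]; push_cast; nlinarith
    · have : ((⌊N * v k⌋ : ℤ) : ℝ) ≤ N := (Int.floor_le _).trans (by nlinarith)
      exact_mod_cast this
  · rw [EuclideanSpace.norm_eq, Real.sqrt_le_iff]
    refine ⟨by positivity, ?_⟩
    have hk : ∀ k, ‖(v - WithLp.toLp 2 fun k => ((⌊N * v k⌋ : ℤ) : ℝ) / N) k‖ ^ 2 ≤
        (1 / N : ℝ) ^ 2 := by
      intro k
      rw [Real.norm_eq_abs, sq_abs]
      have h1 := Int.floor_le ((N : ℝ) * v k)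
      have h2 := Int.lt_floor_add_one ((N : ℝ) * v k)
      have e : (v - WithLp.toLp 2 fun k => ((⌊N * v k⌋ : ℤ) : ℝ) / N) k =
          (N * v k - (⌊N * v k⌋ : ℤ)) / N := by
        simp only [PiLp.sub_apply]; field_simp
      rw [e]
      exact pow_le_pow_left₀ (div_nonneg (by linarith) hN0.le)
        (div_le_div_of_nonneg_right (by linarith) hN0.le) 2
    refine (Finset.sum_le_sum fun k _ => hk k).trans ?_
    rw [Finset.sum_const, Finset.card_univ, Fintype.card_fin, nsmul_eq_mul, div_pow, div_pow,
      one_pow, mul_one_div]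
    gcongr
    rcases Nat.eq_zero_or_pos d with h | h
    · simp [h]
    · have : (1 : ℝ) ≤ d := by exact_mod_cast h
      nlinarith
  · intro k hk
    simp [hk]

/-- Comparison of a quadratic form at two nearby points. -/
theorem abs_wform_self_sub_le {M R r : ℝ} (hM : ∀ i, |c i| ≤ M) (hM0 : 0 ≤ M)
    (hR : ∀ i, ‖u i‖ ^ 2 ≤ R) (hR0 : 0 ≤ R) {v p : EuclideanSpace ℝ (Fin d)} (hv : ‖v‖ ≤ 1)
    (hvp : ‖v - p‖ ≤ r) (hr : r ≤ 1) :
    |wform c u v v - wform c u p p| ≤ 3 * M * R * r := by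
  have hone : ∀ x, wform 1 u x x ≤ R * ‖x‖ ^ 2 := by
    intro x
    have h1 : ∀ i, inner ℝ (u i) x * inner ℝ (u i) x ≤ R * ‖x‖ ^ 2 := by
      intro i
      rw [← sq, ← sq_abs]
      calc |inner ℝ (u i) x| ^ 2 ≤ (‖u i‖ * ‖x‖) ^ 2 := by
            gcongr; exact abs_real_inner_le_norm _ _
        _ = ‖u i‖ ^ 2 * ‖x‖ ^ 2 := by ring
        _ ≤ _ := by gcongr; exact hR i
    simp only [wform, Pi.one_apply, one_mul]
    rcases Nat.eq_zero_or_pos n with h | h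
    · subst h; simp; positivity
    · have hn0 : (0 : ℝ) < n := by exact_mod_cast h
      rw [inv_mul_le_iff₀ hn0]
      refine (Finset.sum_le_sum fun i _ => h1 i).trans (le_of_eq (by simp))
  have hsq : ∀ x, √(wform 1 u x x) ≤ √R * ‖x‖ := by
    intro x
    rw [← Real.sqrt_sq (norm_nonneg x), ← Real.sqrt_mul hR0]
    exact Real.sqrt_le_sqrt (hone x)
  have hr0 : 0 ≤ r := (norm_nonneg _).trans hvp
  have hp : ‖v + p‖ ≤ 3 := by
    have : v + p = (2 : ℝ) • v - (v - p) := by rw [two_smul]; abel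
    rw [this]
    refine (norm_sub_le _ _).trans ?_
    rw [norm_smul, Real.norm_two]; linarith
  have e : wform c u v v - wform c u p p = wform c u (v - p) (v + p) := by
    rw [wform_sub_left, wform_add_right, wform_add_right, wform_comm p v]; ring
  rw [e]
  refine (abs_wform_le hM hM0 _ _).trans ?_
  calc M * (√(wform 1 u (v - p) (v - p)) * √(wform 1 u (v + p) (v + p)))
      ≤ M * ((√R * r) * (√R * 3)) := by
        gcongr
        · exact (hsq _).trans (by gcongr)
        · exact (hsq _).trans (by gcongr)
    _ = 3 * M * (√R * √R) * r := by ring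
    _ = _ := by rw [Real.mul_self_sqrt hR0]

end Deterministic

/-! ### Linear invariance of the whitened spectral problem. -/

section Whitening

variable {n d : ℕ}

theorem invSqrt_isHermitian (A : Matrix (Fin d) (Fin d) ℝ) :
    (invSqrt A).transpose = invSqrt A := by
  have : IsSelfAdjoint (invSqrt A) := cfc_predicate _ A
  rw [← Matrix.conjTranspose_eq_transpose_of_trivial]
  exact this

theorem invSqrt_mul_mul_invSqrt {A : Matrix (Fin d) (Fin d) ℝ} (hA : A.PosDef) :
    invSqrt A * A * invSqrt A = 1 := by
  have hsa : IsSelfAdjoint A := hA.isHermitian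
  have hpos : ∀ t ∈ spectrum ℝ A, 0 < t := by
    intro t ht
    rw [hA.isHermitian.spectrum_real_eq_range_eigenvalues] at ht
    obtain ⟨i, rfl⟩ := ht
    exact hA.eigenvalues_pos i
  have hc : ContinuousOn (fun t : ℝ => (√t)⁻¹) (spectrum ℝ A) :=
    Real.continuous_sqrt.continuousOn.inv₀ fun t ht => (Real.sqrt_pos.2 (hpos t ht)).ne'
  have h1 : invSqrt A * A * invSqrt A =
      cfc (fun t : ℝ => (√t)⁻¹ * t * (√t)⁻¹) A := by
    rw [cfc_mul (fun t : ℝ => (√t)⁻¹ * t) (fun t => (√t)⁻¹) A (hc.mul continuousOn_id) hc,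
      cfc_mul (fun t : ℝ => (√t)⁻¹) (fun t => t) A hc continuousOn_id, cfc_id' ℝ A]
    rfl
  rw [h1, cfc_congr (g := fun _ => (1 : ℝ)) fun t ht => ?_, cfc_const_one ℝ A]
  have h0 := hpos t ht
  have := Real.sqrt_pos.2 h0
  have h2 := Real.mul_self_sqrt h0.le
  dsimp only
  field_simp
  nlinarith

theorem le_inner_of_isLeast_eigenvalue {S : Matrix (Fin d) (Fin d) ℝ}
    (hS : S.IsHermitian) {l : ℝ}
    (hl : IsLeast {t : ℝ | Module.End.HasEigenvalue (Matrix.toEuclideanLin S) t} l)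
    (t : EuclideanSpace ℝ (Fin d)) : l * inner ℝ t t ≤ inner ℝ t (Matrix.toEuclideanLin S t) := by
  have hT : (Matrix.toEuclideanLin S).IsSymmetric := Matrix.isSymmetric_toEuclideanLin_iff.2 hS
  have hfr : Module.finrank ℝ (EuclideanSpace ℝ (Fin d)) = d := by simp
  set b := hT.eigenvectorBasis hfr with hb
  rw [← b.sum_inner_mul_inner t t, ← b.sum_inner_mul_inner t (Matrix.toEuclideanLin S t),
    Finset.mul_sum]
  refine Finset.sum_le_sum fun j _ => ?_
  have h1 : inner ℝ (b j) (Matrix.toEuclideanLin S t) = hT.eigenvalues hfr j * inner ℝ (b j) t := by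
    rw [← hT (b j) t, hb, hT.apply_eigenvectorBasis, real_inner_smul_left]
    rfl
  have h2 : l ≤ hT.eigenvalues hfr j := hl.2 (hT.hasEigenvalue_eigenvalues hfr j)
  rw [h1, real_inner_comm t (b j)]
  nlinarith [mul_self_nonneg (inner ℝ (b j) t)]

theorem weightedCov_isHermitian (W : Matrix (Fin n) (Fin d) ℝ) : (weightedCov W).IsHermitian := by
  ext i j
  simp only [weightedCov, Matrix.conjTranspose_apply, Matrix.smul_apply, Matrix.sum_apply,
    Matrix.vecMulVec_apply, star_trivial, mul_comm (W _ j)]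

/-- The whitened matrix is a linear image of any linear transformation of the data. -/
theorem exists_whiten_eq {x u : Fin n → EuclideanSpace ℝ (Fin d)}
    {A : Matrix (Fin d) (Fin d) ℝ} (hA : IsUnit A) (hn : 0 < n)
    (hx : ∀ i, (x i).ofLp = A.mulVec (u i).ofLp) (hpos : ∀ v, v ≠ 0 → 0 < wform 1 u v v) :
    ∃ K : Matrix (Fin d) (Fin d) ℝ, IsUnit K ∧ whiten (dataMatrix x) = dataMatrix u * K ∧
      (whiten (dataMatrix x)).transpose * whiten (dataMatrix x) = (n : ℝ) • 1 := by
  have hn0 : (0 : ℝ) < n := by exact_mod_cast hn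
  set X := dataMatrix x with hX
  have hXU : X = dataMatrix u * A.transpose := by
    ext i j
    have := congrFun (hx i) j
    simp only [hX, dataMatrix, Matrix.mul_apply, Matrix.of_apply, Matrix.transpose_apply, this,
      Matrix.mulVec, dotProduct, mul_comm]
  have hAT : IsUnit A.transpose := by rwa [Matrix.isUnit_transpose]
  have hG : (X.transpose * X).PosDef := by
    rw [← Matrix.conjTranspose_eq_transpose_of_trivial]
    refine Matrix.PosDef.conjTranspose_mul_self _ fun v w hvw => ?_
    by_contra hne
    set z := A.transpose.mulVec (v - w) with hz
    have hz0 : z ≠ 0 := by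
      intro h0
      apply sub_ne_zero.2 hne
      refine Matrix.mulVec_injective_iff_isUnit.2 hAT ?_
      rw [← hz, h0, Matrix.mulVec_zero]
    have h1 := hpos (WithLp.toLp 2 z) (by simpa using hz0)
    have h2 : (dataMatrix u).mulVec z = 0 := by
      rw [hz, Matrix.mulVec_mulVec, ← hXU, Matrix.mulVec_sub]
      exact sub_eq_zero.2 hvw
    have h3 : ∀ i, inner ℝ (u i) (WithLp.toLp 2 z) = 0 := fun i => by
      rw [IsIsotropic.inner_eq_sum]; exact congrFun h2 i
    simp [wform, h3] at h1
  set R := invSqrt (X.transpose * X) with hR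
  have hRGR := invSqrt_mul_mul_invSqrt hG
  rw [← hR] at hRGR
  have hRu : IsUnit R := by
    refine IsUnit.of_mul_eq_one (X.transpose * X * R) ?_
    rw [← mul_assoc]; exact hRGR
  have hsn : √(n : ℝ) ≠ 0 := (Real.sqrt_pos.2 hn0).ne'
  refine ⟨√(n : ℝ) • (A.transpose * R), ?_, ?_, ?_⟩
  · exact (hAT.mul hRu).smul (Units.mk0 _ hsn)
  · rw [whiten, ← hR, Matrix.mul_smul, ← Matrix.mul_assoc, ← hXU]
  · rw [whiten, ← hR, Matrix.transpose_smul, Matrix.transpose_mul, hR, invSqrt_isHermitian, ← hR,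
      Matrix.smul_mul, Matrix.mul_smul, smul_smul, Real.mul_self_sqrt hn0.le, ← hRGR]
    simp only [Matrix.mul_assoc]

/-- The output of the spectral algorithm, described in transformed coordinates: the sign vector of
`⟪u i, q⟫` for a minimiser `q` of the form weighted by the leverages `h`. -/
theorem IsSpectralOutput.exists_bottom {x u : Fin n → EuclideanSpace ℝ (Fin d)}
    {A : Matrix (Fin d) (Fin d) ℝ} (hA : IsUnit A) (hn : 0 < n)
    (hx : ∀ i, (x i).ofLp = A.mulVec (u i).ofLp) (hpos : ∀ v, v ≠ 0 → 0 < wform 1 u v v)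
    {yhat : Fin n → ℤˣ} (hy : IsSpectralOutput (dataMatrix x) yhat) :
    ∃ (q : EuclideanSpace ℝ (Fin d)) (h : Fin n → ℝ) (l : ℝ),
      (yhat = fun i => sgn (inner ℝ (u i) q)) ∧ wform 1 u q q = 1 ∧
      (∀ p, wform (fun i => h i - d) u q p = l * wform 1 u q p) ∧
      (∀ p, l * wform 1 u p p ≤ wform (fun i => h i - d) u p p) ∧
      ∀ i, ∃ p, (∀ z, wform 1 u p z = inner ℝ (u i) z) ∧ inner ℝ (u i) p = h i := by
  obtain ⟨v, ⟨hv1, l, hl, hv⟩, rfl⟩ := hy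
  obtain ⟨K, hK, hWK, hWW⟩ := exists_whiten_eq hA hn hx hpos
  set W := whiten (dataMatrix x) with hW
  have hn0 : (0 : ℝ) < n := by exact_mod_cast hn
  let k : EuclideanSpace ℝ (Fin d) → EuclideanSpace ℝ (Fin d) := fun t =>
    WithLp.toLp 2 (K.mulVec t.ofLp)
  have hk : ∀ i t, inner ℝ (u i) (k t) = W.mulVec t.ofLp i := by
    intro i t
    rw [hWK, ← Matrix.mulVec_mulVec, IsIsotropic.inner_eq_sum]
    rfl
  have hsurj : ∀ p, ∃ t, k t = p := by
    intro p
    obtain ⟨t, ht⟩ := Matrix.mulVec_surjective_iff_isUnit.2 hK p.ofLp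
    exact ⟨WithLp.toLp 2 t, by simp only [k, ht]⟩
  -- From `Wᵀ W = n`: the map `k` is an isometry from Euclidean space to the geometry of `wform 1
  -- u`, which transports the eigenvalue problem to the coordinates `u`.
  have hone : ∀ t t', wform 1 u (k t) (k t') = inner ℝ t t' := by
    intro t t'
    have h1 : W.mulVec t.ofLp ⬝ᵥ W.mulVec t'.ofLp = n * (t.ofLp ⬝ᵥ t'.ofLp) := by
      rw [Matrix.dotProduct_mulVec, ← Matrix.mulVec_transpose, Matrix.mulVec_mulVec, hWW,
        Matrix.smul_mulVec, Matrix.one_mulVec, smul_dotProduct, smul_eq_mul]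
    simp only [wform, hk, Pi.one_apply, one_mul]
    rw [IsIsotropic.inner_eq_sum, inv_mul_eq_iff_eq_mul₀ hn0.ne']
    exact h1
  have hrow : ∀ i (t : EuclideanSpace ℝ (Fin d)),
      W.mulVec t.ofLp i = inner ℝ (WithLp.toLp 2 (W i)) t := by
    intro i t; rw [IsIsotropic.inner_eq_sum]; rfl
  let h : Fin n → ℝ := fun i => ∑ j, W i j ^ 2
  have hS : ∀ t t', wform (fun i => h i - d) u (k t) (k t') =
      inner ℝ t' (Matrix.toEuclideanLin (weightedCov W) t) := by
    intro t t'
    simp only [wform, hk]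
    have e : (Matrix.toEuclideanLin (weightedCov W) t).ofLp =
        (n : ℝ)⁻¹ • ∑ i, ((h i - d) * W.mulVec t.ofLp i) • W i := by
      rw [Matrix.ofLp_toLpLin, Matrix.toLin'_apply, weightedCov, Matrix.smul_mulVec,
        Matrix.sum_mulVec]
      congr 1
      refine Finset.sum_congr rfl fun i _ => ?_
      rw [Matrix.smul_mulVec, Matrix.vecMulVec_mulVec, mul_smul, op_smul_eq_smul]
      rfl
    rw [IsIsotropic.inner_eq_sum, e]
    simp only [Pi.smul_apply, Finset.sum_apply, smul_eq_mul]
    rw [Finset.mul_sum]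
    simp_rw [Finset.mul_sum]
    rw [Finset.sum_comm]
    refine Finset.sum_congr rfl fun i _ => ?_
    have : W.mulVec t'.ofLp i = ∑ j, W i j * t' j := rfl
    rw [this, Finset.mul_sum, Finset.mul_sum, Finset.mul_sum]
    exact Finset.sum_congr rfl fun j _ => by ring
  refine ⟨k v, h, l, ?_, ?_, ?_, ?_, ?_⟩
  · ext i; rw [hk]
  · rw [hone, real_inner_self_eq_norm_sq, hv1, one_pow]
  · intro p
    obtain ⟨t, rfl⟩ := hsurj p
    rw [hS, hv, real_inner_smul_right, hone, real_inner_comm]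
  · intro p
    obtain ⟨t, rfl⟩ := hsurj p
    rw [hS, hone]
    exact le_inner_of_isLeast_eigenvalue (weightedCov_isHermitian W) hl t
  · intro i
    -- The image of the `i`-th whitened row is `Ĝ⁻¹ (u i)`, so `‖w i‖²` is the leverage of sample
    -- `i`.
    refine ⟨k (WithLp.toLp 2 (W i)), fun z => ?_, ?_⟩
    · obtain ⟨t, rfl⟩ := hsurj z
      rw [hone, hk, hrow]
    · rw [hk]
      simp only [Matrix.mulVec, dotProduct, h, sq]

end Whitening

/-! ### Second and fourth moments of the standard Gaussian. -/

section GaussianMoments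

theorem hasSubgaussianMGF_id_gaussianReal : HasSubgaussianMGF id 1 (gaussianReal 0 1) where
  integrable_exp_mul t := integrable_exp_mul_gaussianReal t
  mgf_le t := by rw [mgf_id_gaussianReal]; simp

theorem zero_mem_interior_integrableExpSet_gaussianReal :
    (0 : ℝ) ∈ interior (integrableExpSet id (gaussianReal 0 1)) := by
  rw [hasSubgaussianMGF_id_gaussianReal.integrableExpSet_eq_univ]; simp

/-- These are the moments read off the moment generating function. Differentiating `p(t) exp (t² /
2)` replaces `p` by `p' + t p`. -/
theorem iteratedDeriv_exp_half_sq :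
    iteratedDeriv 2 (fun t : ℝ => Real.exp (t ^ 2 / 2)) 0 = 1 ∧
      iteratedDeriv 4 (fun t : ℝ => Real.exp (t ^ 2 / 2)) 0 = 3 := by
  have hE : ∀ t : ℝ, HasDerivAt (fun t : ℝ => Real.exp (t ^ 2 / 2))
      (t * Real.exp (t ^ 2 / 2)) t := by
    intro t
    have h1 : HasDerivAt (fun t : ℝ => t ^ 2 / 2) t t := by
      convert! ((hasDerivAt_id t).pow 2).div_const 2 using 1
      simp
    convert! h1.exp using 1
    ring
  have hp : ∀ (p p' : ℝ → ℝ), (∀ t, HasDerivAt p (p' t) t) →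
      deriv (fun t => p t * Real.exp (t ^ 2 / 2)) =
        fun t => (p' t + t * p t) * Real.exp (t ^ 2 / 2) := by
    intro p p' h
    ext t
    have := ((h t).mul (hE t)).deriv
    simp only [Pi.mul_def] at this
    rw [this]
    ring
  have h1 : deriv (fun t : ℝ => Real.exp (t ^ 2 / 2)) = fun t => t * Real.exp (t ^ 2 / 2) := by
    ext t; exact (hE t).deriv
  have h2 : deriv (fun t : ℝ => t * Real.exp (t ^ 2 / 2)) =
      fun t => (1 + t * t) * Real.exp (t ^ 2 / 2) :=
    hp (fun t => t) (fun _ => 1) fun t => hasDerivAt_id t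
  have h3 : deriv (fun t : ℝ => (1 + t * t) * Real.exp (t ^ 2 / 2)) =
      fun t => ((t + t) + t * (1 + t * t)) * Real.exp (t ^ 2 / 2) :=
    hp (fun t => 1 + t * t) (fun t => t + t) fun t => by
      convert! ((hasDerivAt_id t).mul (hasDerivAt_id t)).const_add 1 using 1
      simp
  have h4 : deriv (fun t : ℝ => ((t + t) + t * (1 + t * t)) * Real.exp (t ^ 2 / 2)) =
      fun t => ((1 + 1 + (1 * (1 + t * t) + t * (t + t))) + t * ((t + t) + t * (1 + t * t))) *
        Real.exp (t ^ 2 / 2) :=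
    hp (fun t => (t + t) + t * (1 + t * t)) (fun t => 1 + 1 + (1 * (1 + t * t) + t * (t + t)))
      fun t => by
      have ha : HasDerivAt (fun t : ℝ => 1 + t * t) (t + t) t := by
        convert! ((hasDerivAt_id t).mul (hasDerivAt_id t)).const_add 1 using 1
        simp
      exact ((hasDerivAt_id t).add (hasDerivAt_id t)).add ((hasDerivAt_id t).mul ha)
  simp only [iteratedDeriv_succ, iteratedDeriv_zero, h1, h2, h3, h4]
  norm_num

theorem integral_sq_gaussianReal : ∫ t, t ^ 2 ∂(gaussianReal 0 1) = 1 := by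
  have h := iteratedDeriv_mgf_zero zero_mem_interior_integrableExpSet_gaussianReal 2
  rw [mgf_id_gaussianReal] at h
  simp only [zero_mul, zero_add, NNReal.coe_one, one_mul, iteratedDeriv_exp_half_sq.1] at h
  simpa using h.symm

theorem integral_pow_four_gaussianReal : ∫ t, t ^ 4 ∂(gaussianReal 0 1) = 3 := by
  have h := iteratedDeriv_mgf_zero zero_mem_interior_integrableExpSet_gaussianReal 4
  rw [mgf_id_gaussianReal] at h
  simp only [zero_mul, zero_add, NNReal.coe_one, one_mul, iteratedDeriv_exp_half_sq.2] at h
  simpa using h.symm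

end GaussianMoments

/-! ### The standardised mixture vector is isotropic. -/

section Mixture

set_option linter.unusedSectionVars false

variable {Ω : Type*} [MeasurableSpace Ω] {P : Measure Ω} [IsProbabilityMeasure P]

theorem measurableSet_singleton_units (s : ℤˣ) : MeasurableSet ({s} : Set ℤˣ) := by
  refine ⟨{(s : ℤ)}, .singleton _, ?_⟩
  ext t; simp [Units.ext_iff]

theorem measurable_units_cast : Measurable fun s : ℤˣ => (((s : ℤ)) : ℝ) :=
  (measurable_from_top (f := fun z : ℤ => (z : ℝ))).comp (comap_measurable _)

theorem measure_eq_add_units {y : Ω → ℤˣ} (hy : Measurable y) (B : Set Ω) :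
    P B = P (y ⁻¹' {1} ∩ B) + P (y ⁻¹' {-1} ∩ B) := by
  rw [← measure_inter_add_sdiff B (hy (measurableSet_singleton_units 1)), Set.inter_comm]
  congr 2
  ext ω
  rcases Int.units_eq_one_or (y ω) with h | h
  · simp [h]
  · simp [h]

variable {d : ℕ} {y : Ω → ℤˣ} {Γ : Ω → Fin d → ℝ}

/-- The noise `Γ` is a standard Gaussian vector given either label. -/
def IsGaussianNoise (P : Measure Ω) (y : Ω → ℤˣ) (Γ : Ω → Fin d → ℝ) : Prop :=
  ∀ (s : ℤˣ) (B : Set (Fin d → ℝ)), MeasurableSet B →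
    P (y ⁻¹' {s} ∩ Γ ⁻¹' B) = 1 / 2 * Measure.pi (fun _ => gaussianReal 0 1) B

namespace IsGaussianNoise

/-- Total probability over the label. Since `D` may depend on the label, this gives the law of `Γ`,
its independence from `y`, and the joint law of the mixture coordinates. -/
theorem measure_mem (h : IsGaussianNoise P y Γ) (hy : Measurable y) {D : ℤˣ → Set (Fin d → ℝ)}
    (hD : ∀ s, MeasurableSet (D s)) :
    P {ω | Γ ω ∈ D (y ω)} = 1 / 2 * Measure.pi (fun _ => gaussianReal 0 1) (D 1) +
      1 / 2 * Measure.pi (fun _ => gaussianReal 0 1) (D (-1)) := by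
  rw [measure_eq_add_units hy, ← h 1 _ (hD 1), ← h (-1) _ (hD (-1))]
  congr 2
  · ext ω; simp +contextual
  · ext ω; simp +contextual

theorem half_mul_add (a : ENNReal) : 1 / 2 * a + 1 / 2 * a = a := by
  rw [← add_mul, ENNReal.add_halves, one_mul]

theorem map_eq (h : IsGaussianNoise P y Γ) (hy : Measurable y) (hΓ : Measurable Γ) :
    P.map Γ = Measure.pi (fun _ => gaussianReal 0 1) := by
  ext B hB
  rw [Measure.map_apply hΓ hB]
  exact (h.measure_mem hy (D := fun _ => B) fun _ => hB).trans (half_mul_add _)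

theorem map_apply_eq (h : IsGaussianNoise P y Γ) (hy : Measurable y) (hΓ : Measurable Γ)
    (k : Fin d) : P.map (fun ω => Γ ω k) = gaussianReal 0 1 := by
  have h1 := (measurePreserving_eval (fun _ : Fin d => gaussianReal 0 1) k).map_eq
  rw [← h.map_eq hy hΓ, Measure.map_map (measurable_pi_apply k) hΓ] at h1
  exact h1

theorem indepFun (h : IsGaussianNoise P y Γ) (hy : Measurable y) (hΓ : Measurable Γ)
    (k : Fin d) :
    IndepFun (fun ω => (((y ω : ℤˣ) : ℤ) : ℝ)) (fun ω => Γ ω k) P := by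
  classical
  rw [indepFun_iff_measure_inter_preimage_eq_mul]
  intro A B hA hB
  have hk : Measurable fun g : Fin d → ℝ => g k := measurable_pi_apply k
  have hBk : P ((fun ω => Γ ω k) ⁻¹' B) =
      Measure.pi (fun _ => gaussianReal 0 1) ((fun g : Fin d → ℝ => g k) ⁻¹' B) := by
    rw [← h.map_eq hy hΓ, Measure.map_apply hΓ (hk hB)]; rfl
  have h1 := h.measure_mem hy
    (D := fun s => if (((s : ℤˣ) : ℤ) : ℝ) ∈ A then (fun g : Fin d → ℝ => g k) ⁻¹' B else ∅)
    (fun s => by split_ifs; exacts [hk hB, .empty])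
  have h2 := h.measure_mem hy
    (D := fun s => if (((s : ℤˣ) : ℤ) : ℝ) ∈ A then Set.univ else ∅)
    (fun s => by split_ifs; exacts [.univ, .empty])
  have e1 : {ω | Γ ω ∈ if (((y ω : ℤˣ) : ℤ) : ℝ) ∈ A then
      (fun g : Fin d → ℝ => g k) ⁻¹' B else ∅} =
      (fun ω => (((y ω : ℤˣ) : ℤ) : ℝ)) ⁻¹' A ∩ (fun ω => Γ ω k) ⁻¹' B := by
    ext ω
    by_cases hω : (((y ω : ℤˣ) : ℤ) : ℝ) ∈ A <;> simp [hω]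
  have e2 : {ω | Γ ω ∈ if (((y ω : ℤˣ) : ℤ) : ℝ) ∈ A then (Set.univ : Set (Fin d → ℝ)) else ∅} =
      (fun ω => (((y ω : ℤˣ) : ℤ) : ℝ)) ⁻¹' A := by
    ext ω
    by_cases hω : (((y ω : ℤˣ) : ℤ) : ℝ) ∈ A <;> simp [hω]
  rw [e1] at h1
  rw [e2] at h2
  rw [h1, h2, hBk, add_mul]
  congr 1 <;> split_ifs <;> simp

theorem integral_label (hy : Measurable y) (hyp : ∀ s, P (y ⁻¹' {s}) = 1 / 2) :
    ∫ ω, (((y ω : ℤˣ) : ℤ) : ℝ) ∂P = 0 := by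
  have e : (fun ω => (((y ω : ℤˣ) : ℤ) : ℝ)) = fun ω =>
      (y ⁻¹' {1}).indicator (fun _ => (1 : ℝ)) ω - (y ⁻¹' {-1}).indicator (fun _ => (1 : ℝ)) ω := by
    ext ω
    rcases Int.units_eq_one_or (y ω) with h | h <;> simp [Set.indicator, h]
  have hm := fun s => hy (measurableSet_singleton_units s)
  rw [e, integral_sub ((integrable_const _).indicator (hm 1))
    ((integrable_const _).indicator (hm (-1))), integral_indicator_const _ (hm 1),
    integral_indicator_const _ (hm (-1)), measureReal_def, measureReal_def, hyp, hyp]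
  simp

end IsGaussianNoise

/-- The whitened mixture vector: all coordinates are those of `Γ`, except for the coordinate `k₀`,
which carries the label. -/
noncomputable def mixtureVector (ρ σ : ℝ) (k₀ : Fin d) (y : Ω → ℤˣ) (Γ : Ω → Fin d → ℝ) (ω : Ω) :
    EuclideanSpace ℝ (Fin d) :=
  WithLp.toLp 2 fun k => if k = k₀ then ρ * (((y ω : ℤˣ) : ℤ) : ℝ) + σ * Γ ω k else Γ ω k

theorem mixtureVector_self (ρ σ : ℝ) (k₀ : Fin d) (ω : Ω) :
    mixtureVector ρ σ k₀ y Γ ω k₀ = ρ * (((y ω : ℤˣ) : ℤ) : ℝ) + σ * Γ ω k₀ := by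
  simp [mixtureVector]

theorem mixtureVector_of_ne (ρ σ : ℝ) {k₀ k : Fin d} (hk : k ≠ k₀) (ω : Ω) :
    mixtureVector ρ σ k₀ y Γ ω k = Γ ω k := by
  simp [mixtureVector, hk]

/-- The coefficient of `a` must stay near 1; the large one of `b` is harmless, since `b` will carry
a factor `σ` with `σ ^ 4 ≤ 10⁻⁶`. -/
theorem add_pow_four_le (a b : ℝ) : (a + b) ^ 4 ≤ 6 / 5 * a ^ 4 + 9261 * b ^ 4 := by
  have h1 : (a + b) ^ 2 ≤ 21 / 20 * a ^ 2 + 21 * b ^ 2 := by nlinarith [sq_nonneg (a - 20 * b)]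
  have h2 : ((a + b) ^ 2) ^ 2 ≤ (21 / 20 * a ^ 2 + 21 * b ^ 2) ^ 2 := by gcongr
  nlinarith [sq_nonneg (a ^ 2 - 400 * b ^ 2), sq_nonneg (a ^ 2), sq_nonneg (b ^ 2)]

/-- A sign has variance proxy 1 by Hoeffding's lemma, so variance and proxy of coordinate `k₀` are
both `ρ² + σ² = 1`. Its fourth moment is near that of a sign for small `σ`. -/
theorem IsGaussianNoise.isIsotropic_mixtureVector (h : IsGaussianNoise P y Γ) (hy : Measurable y)
    (hΓ : Measurable Γ) (hyp : ∀ s, P (y ⁻¹' {s}) = 1 / 2) {ρ σ : ℝ} (hρσ : ρ ^ 2 + σ ^ 2 = 1)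
    (k₀ : Fin d) :
    IsIsotropic P (mixtureVector ρ σ k₀ y Γ) ∧
      (∀ k ≠ k₀, ∫ ω, mixtureVector ρ σ k₀ y Γ ω k ^ 4 ∂P = 3) ∧
      (σ ^ 2 ≤ 1 / 1000 → ∫ ω, mixtureVector ρ σ k₀ y Γ ω k₀ ^ 4 ∂P ≤ 5 / 4) := by
  have hΓk : ∀ k, Measurable fun ω => Γ ω k := fun k => (measurable_pi_apply k).comp hΓ
  have hY : Measurable fun ω => (((y ω : ℤˣ) : ℤ) : ℝ) := measurable_units_cast.comp hy
  have hmap := h.map_apply_eq hy hΓ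
  have hΓint : ∀ k (f : ℝ → ℝ), Measurable f →
      ∫ ω, f (Γ ω k) ∂P = ∫ t, f t ∂(gaussianReal 0 1) := by
    intro k f hf
    rw [← hmap k, integral_map (hΓk k).aemeasurable hf.aestronglyMeasurable]
  have hΓsub : ∀ k, HasSubgaussianMGF (fun ω => Γ ω k) 1 P := fun k => by
    rw [← HasSubgaussianMGF.id_map_iff (hΓk k).aemeasurable, hmap k]
    exact hasSubgaussianMGF_id_gaussianReal
  have hΓ1 : ∀ k, ∫ ω, Γ ω k ∂P = 0 := fun k => by
    rw [hΓint k (fun t => t) measurable_id]; simp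
  have hΓ2 : ∀ k, ∫ ω, Γ ω k ^ 2 ∂P = 1 := fun k => by
    rw [hΓint k (fun t => t ^ 2) (measurable_id.pow_const 2), integral_sq_gaussianReal]
  have hΓ4 : ∀ k, ∫ ω, Γ ω k ^ 4 ∂P = 3 := fun k => by
    rw [hΓint k (fun t => t ^ 4) (measurable_id.pow_const 4), integral_pow_four_gaussianReal]
  have hYabs : ∀ ω, (((y ω : ℤˣ) : ℤ) : ℝ) ^ 2 = 1 := fun ω => by
    rcases Int.units_eq_one_or (y ω) with h | h <;> simp [h]
  have hY0 := IsGaussianNoise.integral_label hy hyp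
  have hYsub : HasSubgaussianMGF (fun ω => (((y ω : ℤˣ) : ℤ) : ℝ)) 1 P := by
    have := hasSubgaussianMGF_of_mem_Icc_of_integral_eq_zero (a := -1) (b := 1) hY.aemeasurable
      (.of_forall fun ω => abs_le.1 ((sq_le_one_iff_abs_le_one _).1 (hYabs ω).le)) hY0
    convert! this using 1
    refine NNReal.eq ?_
    push_cast
    norm_num
  have hindY := h.indepFun hy hΓ k₀
  have hmeas : Measurable (mixtureVector ρ σ k₀ y Γ) := by
    refine (by fun_prop : Measurable fun v : Fin d → ℝ =>
      (WithLp.toLp 2 v : EuclideanSpace ℝ (Fin d))).comp (measurable_pi_lambda _ fun k => ?_)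
    split_ifs
    · exact (hY.const_mul ρ).add ((hΓk k).const_mul σ)
    · exact hΓk k
  have hmk : ∀ k, Measurable fun ω => mixtureVector ρ σ k₀ y Γ ω k := fun k =>
    (by fun_prop : Measurable fun v : EuclideanSpace ℝ (Fin d) => v k).comp hmeas
  have hsub0 : HasSubgaussianMGF (fun ω => mixtureVector ρ σ k₀ y Γ ω k₀) 1 P := by
    simp_rw [mixtureVector_self]
    have := (hYsub.const_mul ρ).add_of_indepFun ((hΓsub k₀).const_mul σ)
      (hindY.comp (φ := fun t => ρ * t) (ψ := fun t => σ * t) (by fun_prop) (by fun_prop))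
    convert! this using 1
    refine NNReal.eq ?_
    have e : (1 : ℝ) = ρ ^ 2 * 1 + σ ^ 2 * 1 := by linarith
    exact e
  have hsub : ∀ k, HasSubgaussianMGF (fun ω => mixtureVector ρ σ k₀ y Γ ω k) 1 P := by
    intro k
    by_cases hk : k = k₀
    · rw [hk]; exact hsub0
    · simp_rw [mixtureVector_of_ne ρ σ hk]; exact hΓsub k
  refine ⟨⟨hmeas, ?_, hsub, fun k => ?_, fun k => ?_⟩, fun k hk => ?_, fun hσ => ?_⟩
  · rw [iIndepFun_iff_map_fun_eq_pi_map fun k => (hmk k).aemeasurable]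
    have : ∀ k, IsProbabilityMeasure (P.map fun ω => mixtureVector ρ σ k₀ y Γ ω k) := fun k =>
      Measure.isProbabilityMeasure_map (hmk k).aemeasurable
    symm
    refine Measure.pi_eq fun A hA => ?_
    rw [Measure.map_apply (measurable_pi_lambda _ hmk) (.univ_pi hA)]
    simp_rw [Measure.map_apply (hmk _) (hA _)]
    -- the section of the rectangle given the label `s`
    let D : ℤˣ → Fin d → Set ℝ := fun s k =>
      if k = k₀ then (fun t => ρ * ((s : ℤ) : ℝ) + σ * t) ⁻¹' A k else A k
    have hD : ∀ s k, MeasurableSet (D s k) := by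
      intro s k
      simp only [D]
      split_ifs
      · exact (by fun_prop : Measurable fun t : ℝ => ρ * ((s : ℤ) : ℝ) + σ * t) (hA k)
      · exact hA k
    have hmem : ∀ ω k, mixtureVector ρ σ k₀ y Γ ω k ∈ A k ↔ Γ ω k ∈ D (y ω) k := by
      intro ω k
      by_cases hk : k = k₀ <;> simp [mixtureVector, D, hk]
    have h1 : P ((fun ω k => mixtureVector ρ σ k₀ y Γ ω k) ⁻¹' Set.univ.pi A) =
        1 / 2 * ∏ k, gaussianReal 0 1 (D 1 k) + 1 / 2 * ∏ k, gaussianReal 0 1 (D (-1) k) := by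
      rw [← Measure.pi_pi, ← Measure.pi_pi,
        ← h.measure_mem hy (D := fun s => Set.univ.pi (D s)) fun s => .univ_pi (hD s)]
      congr 1
      ext ω
      simp [Set.mem_pi, hmem]
    have h2 : ∀ k, P ((fun ω => mixtureVector ρ σ k₀ y Γ ω k) ⁻¹' A k) =
        1 / 2 * gaussianReal 0 1 (D 1 k) + 1 / 2 * gaussianReal 0 1 (D (-1) k) := by
      intro k
      have hpre : ∀ s, gaussianReal 0 1 (D s k) =
          Measure.pi (fun _ : Fin d => gaussianReal 0 1) (Function.eval k ⁻¹' D s k) := fun s =>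
        ((measurePreserving_eval (fun _ : Fin d => gaussianReal 0 1) k).measure_preimage
          (hD s k).nullMeasurableSet).symm
      rw [hpre, hpre, ← h.measure_mem hy (D := fun s => Function.eval k ⁻¹' D s k)
        fun s => measurable_pi_apply k (hD s k)]
      congr 1
      ext ω
      simp [hmem]
    rw [h1, ← Finset.mul_prod_erase _ _ (Finset.mem_univ k₀),
      ← Finset.mul_prod_erase _ _ (Finset.mem_univ k₀),
      ← Finset.mul_prod_erase _ _ (Finset.mem_univ k₀), h2]
    -- Only the factor at `k₀` depends on the label, so averaging over the label preserves the
    -- product structure.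
    have h3 : ∀ s, ∏ k ∈ Finset.univ.erase k₀, gaussianReal 0 1 (D s k) =
        ∏ k ∈ Finset.univ.erase k₀, P ((fun ω => mixtureVector ρ σ k₀ y Γ ω k) ⁻¹' A k) := by
      intro s
      refine Finset.prod_congr rfl fun k hk => ?_
      have hk' : k ≠ k₀ := Finset.ne_of_mem_erase hk
      have hs : ∀ s, D s k = A k := fun s => if_neg hk'
      rw [h2, hs, hs, hs, IsGaussianNoise.half_mul_add]
    rw [h3, h3]
    ring
  · by_cases hk : k = k₀
    · subst hk
      simp_rw [mixtureVector_self]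
      rw [integral_add (hYsub.integrable.const_mul _) ((hΓsub k).integrable.const_mul _),
        integral_const_mul, integral_const_mul, hY0, hΓ1]
      simp
    · simp_rw [mixtureVector_of_ne ρ σ hk]; exact hΓ1 k
  · by_cases hk : k = k₀
    · subst hk
      have hsqi : Integrable (fun ω => Γ ω k ^ 2) P := by
        by_contra hc
        have := hΓ2 k
        rw [integral_undef hc] at this
        norm_num at this
      have hpi : Integrable (fun ω => (((y ω : ℤˣ) : ℤ) : ℝ) * Γ ω k) P :=
        hindY.integrable_mul hYsub.integrable (hΓsub k).integrable
      have hp0 : ∫ ω, (((y ω : ℤˣ) : ℤ) : ℝ) * Γ ω k ∂P = 0 := by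
        rw [hindY.integral_fun_mul_eq_mul_integral hY.aestronglyMeasurable
          (hΓk k).aestronglyMeasurable, hY0, zero_mul]
      have e : ∀ ω, mixtureVector ρ σ k y Γ ω k ^ 2 =
          ρ ^ 2 + (2 * ρ * σ * ((((y ω : ℤˣ) : ℤ) : ℝ) * Γ ω k) + σ ^ 2 * Γ ω k ^ 2) := by
        intro ω
        rw [mixtureVector_self]
        linear_combination ρ ^ 2 * hYabs ω
      simp_rw [e]
      have i1 := hpi.const_mul (2 * ρ * σ)
      have i2 := hsqi.const_mul (σ ^ 2)
      have i12 := i1.add i2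
      simp only [Pi.add_def] at i12
      rw [integral_add (integrable_const _) i12, integral_add i1 i2,
        integral_const_mul, integral_const_mul, hp0, hΓ2]
      simpa using hρσ
    · simp_rw [mixtureVector_of_ne ρ σ hk]; exact hΓ2 k
  · simp_rw [mixtureVector_of_ne ρ σ hk]; exact hΓ4 k
  · have hi : ∀ {Z : Ω → ℝ}, HasSubgaussianMGF Z 1 P → Integrable (fun ω => Z ω ^ 4) P := by
      intro Z hZ
      have := (hZ.memLp 4).integrable_norm_pow (p := 4) (by norm_num)
      simpa [Real.norm_eq_abs, abs_pow, Even.pow_abs (show Even 4 by decide)] using this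
    have hiΓ := (hi (hΓsub k₀)).const_mul (9261 * σ ^ 4)
    calc ∫ ω, mixtureVector ρ σ k₀ y Γ ω k₀ ^ 4 ∂P
        ≤ ∫ ω, (6 / 5 + 9261 * σ ^ 4 * Γ ω k₀ ^ 4) ∂P := by
          refine integral_mono (hi hsub0) ((integrable_const _).add hiΓ) fun ω => ?_
          dsimp only
          rw [mixtureVector_self]
          refine (add_pow_four_le _ _).trans ?_
          have h1 : (ρ * (((y ω : ℤˣ) : ℤ) : ℝ)) ^ 4 ≤ 1 := by
            have e1 : (ρ * (((y ω : ℤˣ) : ℤ) : ℝ)) ^ 4 =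
                (ρ ^ 2) ^ 2 * ((((y ω : ℤˣ) : ℤ) : ℝ) ^ 2) ^ 2 := by ring
            rw [e1, hYabs, one_pow, mul_one]
            nlinarith [sq_nonneg ρ, sq_nonneg σ]
          have e2 : (σ * Γ ω k₀) ^ 4 = σ ^ 4 * Γ ω k₀ ^ 4 := by ring
          rw [e2]
          linarith
      _ = 6 / 5 + 9261 * σ ^ 4 * 3 := by
          rw [integral_add (integrable_const _) hiΓ, integral_const_mul, hΓ4]
          simp
      _ ≤ 5 / 4 := by
          have : σ ^ 4 ≤ (1 / 1000) ^ 2 := by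
            have e : σ ^ 4 = (σ ^ 2) ^ 2 := by ring
            rw [e]; gcongr
          linarith

end Mixture

/-! ### Reduction to standardised coordinates. -/

section Reduction

open scoped MatrixOrder

theorem snr_eq_norm_sq {d : ℕ} (m : EuclideanSpace ℝ (Fin d)) {Sig : Matrix (Fin d) (Fin d) ℝ}
    (hS : Sig.PosDef) :
    IsUnit (CFC.sqrt Sig) ∧
      snr m Sig =
        ‖(WithLp.toLp 2 ((CFC.sqrt Sig)⁻¹.mulVec m.ofLp) : EuclideanSpace ℝ (Fin d))‖ ^ 2 := by
  set r := CFC.sqrt Sig with hr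
  have hrr : r * r = Sig := CFC.sqrt_mul_sqrt_self Sig hS.posSemidef.nonneg
  have hu : IsUnit r := by
    have h1 : IsUnit (r * r) := by rw [hrr]; exact hS.isUnit
    exact isUnit_of_mul_isUnit_left h1
  refine ⟨hu, ?_⟩
  have hsa : r.transpose = r := by
    rw [← Matrix.conjTranspose_eq_transpose_of_trivial]
    exact (CFC.sqrt_nonneg Sig).isSelfAdjoint
  rw [EuclideanSpace.real_norm_sq_eq, snr, ← hrr, Matrix.mul_inv_rev, ← Matrix.mulVec_mulVec,
    Matrix.dotProduct_mulVec, ← Matrix.mulVec_transpose, Matrix.transpose_nonsing_inv, hsa]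
  simp only [dotProduct, sq]

variable {Ω : Type*} [MeasurableSpace Ω] {P : Measure Ω} [IsProbabilityMeasure P] {d : ℕ}

/-- Coordinates, in an orthonormal basis, of the standardised noise of a mixture sample. -/
theorem isGaussianNoise_of_law_cond {m : EuclideanSpace ℝ (Fin d)}
    {Sig : Matrix (Fin d) (Fin d) ℝ} (hS : IsUnit (CFC.sqrt Sig))
    {x : Ω → EuclideanSpace ℝ (Fin d)} {y : Ω → ℤˣ} (hx : Measurable x) (hy : Measurable y)
    (hyp : ∀ s, P (y ⁻¹' {s}) = 1 / 2)
    (hlaw : ∀ s : ℤˣ, (cond P (y ⁻¹' {s})).map x = multivariateGaussian (((s : ℤ) : ℝ) • m) Sig)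
    (b : OrthonormalBasis (Fin d) ℝ (EuclideanSpace ℝ (Fin d))) :
    IsGaussianNoise P y fun ω k => inner ℝ (b k)
      (Matrix.toEuclideanCLM (𝕜 := ℝ) (CFC.sqrt Sig)⁻¹ (x ω - (((y ω : ℤˣ) : ℤ) : ℝ) • m)) := by
  intro s B hB
  set r := CFC.sqrt Sig with hr
  have hys := hy (measurableSet_singleton_units s)
  let f : EuclideanSpace ℝ (Fin d) → Fin d → ℝ := fun z k =>
    inner ℝ (b k) (Matrix.toEuclideanCLM (𝕜 := ℝ) r⁻¹ (z - ((s : ℤ) : ℝ) • m))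
  have hf : Measurable f := by
    refine measurable_pi_lambda _ fun k => ?_
    fun_prop
  have h1 : y ⁻¹' {s} ∩ (fun ω k => inner ℝ (b k)
      (Matrix.toEuclideanCLM (𝕜 := ℝ) r⁻¹ (x ω - (((y ω : ℤˣ) : ℤ) : ℝ) • m))) ⁻¹' B =
      y ⁻¹' {s} ∩ x ⁻¹' (f ⁻¹' B) := by
    ext ω
    simp only [Set.mem_inter_iff, Set.mem_preimage, Set.mem_singleton_iff, and_congr_right_iff]
    rintro hω
    rw [hω]
  rw [h1, ← cond_mul_eq_inter hys, hyp, mul_comm, ← Measure.map_apply hx (hf hB), hlaw,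
    multivariateGaussian, ← hr, Measure.map_apply (by fun_prop) (hf hB),
    stdGaussian_eq_map_pi_orthonormalBasis b, Measure.map_apply (by fun_prop)]
  · congr 2
    ext c
    simp only [Set.mem_preimage]
    have : f (((s : ℤ) : ℝ) • m + Matrix.toEuclideanCLM (𝕜 := ℝ) r (∑ i, c i • b i)) = c := by
      ext k
      simp only [f]
      rw [add_sub_cancel_left, ← mul_apply_eq_comp, ← map_mul,
        Matrix.nonsing_inv_mul _ ((Matrix.isUnit_iff_isUnit_det _).1 hS), map_one,
        one_apply_eq_self, b.orthonormal.inner_right_fintype]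
    rw [this]
  · exact (by fun_prop : Measurable fun z =>
      ((s : ℤ) : ℝ) • m + Matrix.toEuclideanCLM (𝕜 := ℝ) r z) (hf hB)

/-- A mixture sample is an invertible linear image of vectors with independent coordinates, one of
which carries the label. -/
theorem IsMixtureSample.exists_whitened {n : ℕ} {m : EuclideanSpace ℝ (Fin d)}
    {Sig : Matrix (Fin d) (Fin d) ℝ} {x : Fin n → Ω → EuclideanSpace ℝ (Fin d)}
    {y : Fin n → Ω → ℤˣ} (hS : Sig.PosDef) (hd : 0 < d) (h : IsMixtureSample P m Sig x y)
    (hσ : noiseLevel m Sig < 1) :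
    ∃ (A : Matrix (Fin d) (Fin d) ℝ) (k₀ : Fin d) (Γ : Fin n → Ω → Fin d → ℝ),
      IsUnit A ∧ (∀ i, Measurable (Γ i)) ∧ (∀ i, IsGaussianNoise P (y i) (Γ i)) ∧
      iIndepFun (fun i => mixtureVector √(1 - noiseLevel m Sig ^ 2) (noiseLevel m Sig) k₀
        (y i) (Γ i)) P ∧
      iIndepFun (fun i ω => Γ i ω k₀) P ∧
      ∀ i ω, (x i ω).ofLp = A.mulVec (mixtureVector √(1 - noiseLevel m Sig ^ 2)
        (noiseLevel m Sig) k₀ (y i) (Γ i) ω).ofLp := by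
  obtain ⟨hr, hsnr⟩ := snr_eq_norm_sq m hS
  set r := CFC.sqrt Sig with hrdef
  set σ := noiseLevel m Sig with hσdef
  let L := Matrix.toEuclideanCLM (n := Fin d) (𝕜 := ℝ) r⁻¹
  set θ := L m with hθ
  have hsnr' : snr m Sig = ‖θ‖ ^ 2 := hsnr
  -- A noise level below 1 excludes a zero mean, so `θ` has a direction that can serve as a basis
  -- vector.
  have hθ0 : 0 < ‖θ‖ := by
    rw [norm_pos_iff]
    intro h0
    rw [hσdef, noiseLevel, hsnr', h0] at hσ
    simp at hσ
  have hσ2 : σ ^ 2 = 1 / (‖θ‖ ^ 2 + 1) := by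
    rw [hσdef, noiseLevel, hsnr', div_pow, one_pow, Real.sq_sqrt (by positivity)]
  have hσ0 : 0 < σ := by rw [hσdef, noiseLevel, hsnr']; positivity
  -- Along `θ` the standardised sample is `‖θ‖ y + γ`; multiplying by `σ = 1 / √(‖θ‖² + 1)`
  -- normalises its variance.
  have hρ : √(1 - σ ^ 2) = σ * ‖θ‖ := by
    rw [Real.sqrt_eq_iff_mul_self_eq_of_pos (by positivity)]
    have : σ ^ 2 * (‖θ‖ ^ 2 + 1) = 1 := by rw [hσ2]; field_simp
    nlinarith
  let k₀ : Fin d := ⟨0, hd⟩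
  have hon : Orthonormal ℝ (({k₀} : Set (Fin d)).domRestrict fun _ => ‖θ‖⁻¹ • θ) := by
    refine ⟨fun i => norm_smul_inv_norm (𝕜 := ℝ) (norm_pos_iff.1 hθ0), fun i j hij => ?_⟩
    exact absurd (Subsingleton.elim i j) hij
  obtain ⟨b, hb⟩ := hon.exists_orthonormalBasis_extension_of_card_eq (by simp)
  have hb0 : b k₀ = ‖θ‖⁻¹ • θ := hb k₀ rfl
  have hbθ : ∀ k, inner ℝ (b k) θ = if k = k₀ then ‖θ‖ else 0 := by
    intro k
    have e : θ = ‖θ‖ • b k₀ := by rw [hb0, smul_smul, mul_inv_cancel₀ hθ0.ne', one_smul]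
    rw [e, real_inner_smul_right, orthonormal_iff_ite.1 b.orthonormal, ← e]
    split_ifs <;> simp
  let Γ : Fin n → Ω → Fin d → ℝ := fun i ω k =>
    inner ℝ (b k) (L (x i ω - (((y i ω : ℤˣ) : ℤ) : ℝ) • m))
  -- the whitened vector as a function of `x`
  have hu : ∀ i ω k, mixtureVector √(1 - σ ^ 2) σ k₀ (y i) (Γ i) ω k =
      (if k = k₀ then σ else 1) * inner ℝ (b k) (L (x i ω)) := by
    intro i ω k
    have e : inner ℝ (b k) (L (x i ω)) = (((y i ω : ℤˣ) : ℤ) : ℝ) * inner ℝ (b k) θ + Γ i ω k := by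
      simp only [Γ, map_sub, map_smul, inner_sub_right, real_inner_smul_right, ← hθ]; ring
    rw [e, hbθ]
    by_cases hk : k = k₀
    · rw [hk, mixtureVector_self, hρ]; simp; ring
    · rw [mixtureVector_of_ne _ _ hk]; simp [hk]
  let O : Matrix (Fin d) (Fin d) ℝ := Matrix.of fun k j => b k j
  let D : Matrix (Fin d) (Fin d) ℝ := Matrix.diagonal fun k => if k = k₀ then σ else 1
  have hO : IsUnit O := by
    refine IsUnit.of_mul_eq_one O.transpose ?_
    ext k l
    have := orthonormal_iff_ite.1 b.orthonormal k l
    rw [IsIsotropic.inner_eq_sum] at this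
    simpa [O, Matrix.mul_apply, Matrix.one_apply] using this
  have hD : IsUnit D := by
    rw [Matrix.isUnit_diagonal, Pi.isUnit_iff]
    intro k
    split_ifs
    · exact hσ0.ne'.isUnit
    · exact isUnit_one
  -- Standardise the noise, send the direction of `θ` to the axis `k₀`, then shrink that axis by
  -- `σ`.
  have hB : IsUnit (D * (O * r⁻¹)) := hD.mul (hO.mul (Matrix.isUnit_nonsing_inv_iff.2 hr))
  have hBx : ∀ i ω, (mixtureVector √(1 - σ ^ 2) σ k₀ (y i) (Γ i) ω).ofLp =
      (D * (O * r⁻¹)).mulVec (x i ω).ofLp := by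
    intro i ω
    ext k
    rw [hu, ← Matrix.mulVec_mulVec, ← Matrix.mulVec_mulVec, Matrix.mulVec_diagonal,
      IsIsotropic.inner_eq_sum]
    rfl
  have hyc : Measurable fun s : ℤˣ => (((s : ℤ)) : ℝ) := measurable_units_cast
  have hΓm : ∀ i, Measurable (Γ i) := fun i => by
    have h1 := h.measurable_x i
    have h2 := hyc.comp (h.measurable_y i)
    refine measurable_pi_lambda _ fun k => ?_
    exact (by fun_prop : Measurable fun z => inner ℝ (b k) (L z)).comp
      (h1.sub (h2.smul_const m))
  refine ⟨(D * (O * r⁻¹))⁻¹, k₀, Γ, Matrix.isUnit_nonsing_inv_iff.2 hB, hΓm, ?_, ?_, ?_, ?_⟩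
  · exact fun i => isGaussianNoise_of_law_cond hr (h.measurable_x i) (h.measurable_y i)
      (h.prob_label i) (h.law_cond i) b
  · have e : (fun i => mixtureVector √(1 - σ ^ 2) σ k₀ (y i) (Γ i)) = fun i ω =>
        (WithLp.toLp 2 fun k => (if k = k₀ then σ else 1) * inner ℝ (b k) (L (x i ω)) :
          EuclideanSpace ℝ (Fin d)) := by
      ext i ω k; exact hu i ω k
    rw [e]
    exact h.indep.comp (fun _ p => (WithLp.toLp 2 fun k =>
      (if k = k₀ then σ else 1) * inner ℝ (b k) (L p.1) : EuclideanSpace ℝ (Fin d)))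
      fun _ => by fun_prop
  · exact h.indep.comp (fun _ p => inner ℝ (b k₀) (L (p.1 - (((p.2 : ℤˣ) : ℤ) : ℝ) • m)))
      fun _ => (by fun_prop : Measurable fun z => inner ℝ (b k₀) (L z)).comp
        (measurable_fst.sub ((hyc.comp measurable_snd).smul_const m))
  · intro i ω
    rw [hBx, Matrix.mulVec_mulVec,
      Matrix.nonsing_inv_mul _ ((Matrix.isUnit_iff_isUnit_det _).1 hB), Matrix.one_mulVec]

end Reduction

/-! ### The union bound over exceptional events. -/

section GoodEvent

set_option linter.unusedSectionVars false

variable {n d : ℕ}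

/-- The deviation bounds that hold with high probability, at scale `q = √(log n / n)`. -/
structure IsGoodSample (κ q : ℝ) (k₀ : Fin d) (u : Fin n → EuclideanSpace ℝ (Fin d))
    (γ : Fin n → ℝ) : Prop where
  grid : ∀ p ∈ gridNet d (n ^ 5), |∑ j, (inner ℝ p (u j) ^ 2 - ‖p‖ ^ 2)| ≤
    n * (64 * (7 + κ) * √d * q) * ‖p‖ ^ 2
  weight : ∀ i, |‖u i‖ ^ 2 - d| ≤ 32 * √d * (κ * Real.log n)
  leave : ∀ i, |∑ j ∈ Finset.univ.erase i, (inner ℝ (u i) (u j) ^ 2 - ‖u i‖ ^ 2)| ≤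
    n * (64 * κ * q) * ‖u i‖ ^ 2
  diag : ∑ i, (‖u i‖ ^ 2 - d) * (u i k₀ * u i k₀) ≤ n / 4 + 128 * √d * ((3072 + κ) * (n * q))
  cross : ∀ k, k ≠ k₀ → |∑ i, (‖u i‖ ^ 2 - d) * (u i k₀ * u i k)| ≤
    128 * √d * ((3072 + κ) * (n * q))
  lower : ∀ p ∈ gridNet d (n ^ 5), p k₀ = 0 →
    3 / 2 * n * ‖p‖ ^ 2 ≤ ∑ i, (‖u i‖ ^ 2 - d) * inner ℝ p (u i) ^ 2
  noise : ∑ i, γ i ^ 2 ≤ 2 * n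

variable {Ω : Type*} [MeasurableSpace Ω] {P : Measure Ω} [IsProbabilityMeasure P]

theorem measureReal_exists_le {ι : Type*} (s : Finset ι) (B : ι → Set Ω) {c : ℝ}
    (h : ∀ i ∈ s, P.real (B i) ≤ c) : P.real (⋃ i ∈ s, B i) ≤ s.card * c := by
  refine (measureReal_biUnion_finset_le s B).trans ((Finset.sum_le_sum h).trans (le_of_eq ?_))
  rw [Finset.sum_const, nsmul_eq_mul]

/-- For `n ≥ 3` the grid has at most `(2 n⁵ + 1)^d ≤ n^{7d}` points, which explains the constant `7
+ κ`. -/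
theorem card_gridNet_mul_exp_le (hn : 3 ≤ n) (hd : 0 < d) {κ a : ℝ} (hκ : 0 ≤ κ)
    (ha : (7 + κ) * d * Real.log n ≤ a) :
    ((gridNet d (n ^ 5)).card : ℝ) * Real.exp (-a) ≤ (n : ℝ) ^ (-κ) := by
  have hn0 : (0 : ℝ) < n := by positivity
  have hn1 : (1 : ℝ) ≤ n := by exact_mod_cast (by omega : 1 ≤ n)
  have hd1 : (1 : ℝ) ≤ d := by exact_mod_cast hd
  have hL : 0 ≤ Real.log n := Real.log_nonneg hn1
  have h1 : (gridNet d (n ^ 5)).card ≤ (n ^ 7) ^ d := by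
    refine (card_gridNet_le d (n ^ 5)).trans (Nat.pow_le_pow_left ?_ d)
    have h9 : 9 ≤ n ^ 2 := by nlinarith
    have h5 : 1 ≤ n ^ 5 := Nat.one_le_pow _ _ (by omega)
    calc 2 * n ^ 5 + 1 ≤ 9 * n ^ 5 := by omega
      _ ≤ n ^ 2 * n ^ 5 := Nat.mul_le_mul_right _ h9
      _ = n ^ 7 := by ring
  have h2 : ((gridNet d (n ^ 5)).card : ℝ) ≤ Real.exp (7 * d * Real.log n) := by
    have e : Real.exp (7 * d * Real.log n) = ((n : ℝ) ^ 7) ^ d := by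
      rw [← Real.exp_log hn0, ← Real.exp_nat_mul, ← Real.exp_nat_mul, Real.exp_log hn0]
      push_cast; ring_nf
    rw [e]; exact_mod_cast h1
  calc _ ≤ Real.exp (7 * d * Real.log n) * Real.exp (-a) := by gcongr
    _ = Real.exp (7 * d * Real.log n - a) := by rw [← Real.exp_add]; ring_nf
    _ ≤ Real.exp (Real.log n * -κ) := by
      rw [Real.exp_le_exp]
      have : κ * Real.log n ≤ κ * Real.log n * d := le_mul_of_one_le_right (by positivity) hd1
      nlinarith
    _ = _ := (Real.rpow_def_of_pos hn0 _).symm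

set_option maxHeartbeats 1000000 in
-- Deviations `64 (7 + κ) √d q` give the exponent `(7 + κ)² d log n`, which pays for the net; `64 κ
-- q` gives `κ² log n`, enough for `n` events. The lower tail exponent `n / (16 · 10⁹ d)` dominates
-- `(7 + κ) d log n` by `hreg`.
theorem exists_isGoodSample {u : Fin n → Ω → EuclideanSpace ℝ (Fin d)} {γ : Fin n → Ω → ℝ}
    {k₀ : Fin d} {κ q : ℝ} (hu : ∀ i, IsIsotropic P (u i)) (hind : iIndepFun u P)
    (h4 : ∀ i k, k ≠ k₀ → ∫ ω, u i ω k ^ 4 ∂P = 3) (h4' : ∀ i, ∫ ω, u i ω k₀ ^ 4 ∂P ≤ 5 / 4)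
    (hγind : iIndepFun γ P) (hγm : ∀ i, Measurable (γ i))
    (hγs : ∀ i, HasSubgaussianMGF (γ i) 1 P) (hγ2 : ∀ i, ∫ ω, γ i ω ^ 2 ∂P = 1)
    (hn : 3 ≤ n) (hκ : 1 ≤ κ) (hq : q = √(Real.log n / n))
    (hsmall : q * ((κ + 1) * Real.log n) ^ 2 ≤ 1)
    (hreg : 16 * 10 ^ 9 * (7 + κ) ^ 2 * d ^ 2 * q ^ 2 ≤ 1) :
    ∃ B : Set Ω, P.real B ≤ (13 + 3 * (Real.exp 64 + 4)) * n * (n : ℝ) ^ (-κ) ∧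
      ∀ ω ∉ B, IsGoodSample κ q k₀ (fun i => u i ω) fun i => γ i ω := by
  have hd : 0 < d := k₀.pos
  have hd1 : (1 : ℝ) ≤ d := by exact_mod_cast hd
  have hn0 : (0 : ℝ) < n := by positivity
  have hn3 : (3 : ℝ) ≤ n := by exact_mod_cast hn
  set L := Real.log n with hL
  have hL1 : 1 ≤ L := by
    rw [hL, Real.le_log_iff_exp_le hn0]
    exact (Real.exp_one_lt_d9.le.trans (by norm_num)).trans hn3
  have hq0 : 0 ≤ q := by rw [hq]; positivity
  have hq2 : n * q ^ 2 = L := by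
    rw [hq, Real.sq_sqrt (by positivity)]; field_simp
  have hnL : √(n * L) = n * q := by
    rw [← hq2, show (n : ℝ) * (n * q ^ 2) = (n * q) ^ 2 by ring, Real.sqrt_sq (by positivity)]
  have hsd : √(d : ℝ) ^ 2 = d := Real.sq_sqrt (by positivity)
  have hsd1 : √(d : ℝ) ≤ d := by
    rw [Real.sqrt_le_iff]; exact ⟨by positivity, by nlinarith⟩
  have hκdq : (7 + κ) * d * q ≤ 1 := by
    have h0 : 0 ≤ (7 + κ) * d * q := by positivity
    nlinarith
  have hκq : κ * q ≤ 1 := by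
    refine le_trans ?_ hκdq
    gcongr
    nlinarith
  have hdn : (d : ℝ) ≤ n := by
    have h1 : 16 * 10 ^ 9 * (7 + κ) ^ 2 * d ^ 2 * L ≤ n := by
      have := mul_le_mul_of_nonneg_left hreg hn0.le
      rw [mul_one] at this
      refine le_trans (le_of_eq ?_) this
      rw [← hq2]; ring
    have h2 : (d : ℝ) ≤ 16 * 10 ^ 9 * (7 + κ) ^ 2 * d ^ 2 * L := by
      have : (1 : ℝ) ≤ 16 * 10 ^ 9 * (7 + κ) ^ 2 * L := by
        have h3 : (1 : ℝ) ≤ (7 + κ) ^ 2 := by nlinarith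
        nlinarith
      nlinarith
    linarith
  have hrpow : (n : ℝ) ^ (-κ) = Real.exp (-(κ * L)) := by
    rw [Real.rpow_def_of_pos hn0, hL]; ring_nf
  set Q := (n : ℝ) ^ (-κ) with hQ
  have hQ0 : 0 ≤ Q := by positivity
  -- the exceptional events
  let B₁ : Set Ω := ⋃ p ∈ gridNet d (n ^ 5), {ω | n * (64 * (7 + κ) * √d * q) * ‖p‖ ^ 2 <
    |∑ j, (inner ℝ p (u j ω) ^ 2 - ‖p‖ ^ 2)|}
  let B₂ : Set Ω := ⋃ i ∈ Finset.univ, {ω | 32 * √d * (κ * L) < |‖u i ω‖ ^ 2 - d|}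
  let B₃ : Set Ω := ⋃ i ∈ Finset.univ, {ω | n * (64 * κ * q) * ‖u i ω‖ ^ 2 <
    |∑ j ∈ Finset.univ.erase i, (inner ℝ (u i ω) (u j ω) ^ 2 - ‖u i ω‖ ^ 2)|}
  let B₄ : Set Ω := {ω | n * (1 / 4) + 128 * √d * ((3072 + κ) * √(n * L)) ≤
    1 * ∑ i, (‖u i ω‖ ^ 2 - d) * (u i ω k₀ * u i ω k₀)}
  -- The values `c = 1` and `c = -1` turn the one-sided tail bound into a two-sided one.
  let B₅ : ℝ → Set Ω := fun c => ⋃ k ∈ Finset.univ.erase k₀,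
    {ω | n * 0 + 128 * √d * ((3072 + κ) * √(n * L)) ≤
      c * ∑ i, (‖u i ω‖ ^ 2 - d) * (u i ω k₀ * u i ω k)}
  let B₆ : Set Ω := ⋃ p ∈ (gridNet d (n ^ 5)).filter fun p => p k₀ = 0,
    {ω | ∑ i, (‖u i ω‖ ^ 2 - d) * inner ℝ p (u i ω) ^ 2 < 3 / 2 * n * ‖p‖ ^ 2}
  let B₇ : Set Ω := {ω | (n : ℝ) * 1 < |∑ j, (γ j ω ^ 2 - 1)|}
  have b₁ : P.real B₁ ≤ 2 * Q := by
    have hs : 64 * (7 + κ) * √d * q ≤ 256 := by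
      have : (7 + κ) * √d * q ≤ (7 + κ) * d * q := by gcongr
      nlinarith
    refine (measureReal_exists_le _ _ fun p _ => measureReal_abs_sum_inner_sq_gt_le hu hind p
      Finset.univ (by positivity) hs).trans ?_
    rw [mul_left_comm]
    refine mul_le_mul_of_nonneg_left (card_gridNet_mul_exp_le hn hd (by linarith) ?_) two_pos.le
    have e : n * (64 * (7 + κ) * √d * q) ^ 2 / 4096 = (7 + κ) * ((7 + κ) * (d * (n * q ^ 2))) := by
      rw [← hsd]; simp only [hsd]; ring_nf; rw [hsd]; ring
    rw [e, hq2]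
    have h0 : 0 ≤ (7 + κ) * (d * L) := by positivity
    nlinarith
  have b₂ : P.real B₂ ≤ n * (6 * Q) := by
    refine (measureReal_exists_le _ _ fun i _ =>
      measureReal_abs_weight_gt_le (hu i) hd (κ * L)).trans (le_of_eq ?_)
    rw [hrpow]; simp
  have b₃ : P.real B₃ ≤ n * (2 * Q) := by
    have hs : 64 * κ * q ≤ 256 := by nlinarith
    refine (measureReal_exists_le _ _ fun i _ => measureReal_abs_sum_erase_inner_sq_gt_le hu hind i
      (by positivity) hs).trans ?_
    rw [hrpow, Finset.card_univ, Fintype.card_fin]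
    gcongr
    have e : n * (64 * κ * q) ^ 2 / 4096 = κ * (κ * (n * q ^ 2)) := by ring
    rw [e, hq2]
    have h0 : 0 ≤ κ * L := by positivity
    nlinarith
  have hsm : √(L / n) * ((κ + 1) * L) ^ 2 ≤ 1 := by rw [← hq]; exact hsmall
  have b₄ : P.real B₄ ≤ (Real.exp 64 + 4) * Q :=
    measureReal_sum_weight_mul_ge_le hu hind hd k₀ k₀ hκ hn hsm (by simp) fun i => by
      rw [(hu i).integral_weight_mul, if_pos rfl]; linarith [h4' i]
  have hcard : ((Finset.univ.erase k₀).card : ℝ) ≤ n := by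
    refine le_trans ?_ hdn
    have : (Finset.univ.erase k₀).card ≤ d := (Finset.card_le_univ _).trans (by simp)
    exact_mod_cast this
  have b₅ : ∀ c : ℝ, |c| ≤ 1 → P.real (B₅ c) ≤ n * ((Real.exp 64 + 4) * Q) := by
    intro c hc
    refine (measureReal_exists_le _ _ fun k hk =>
      measureReal_sum_weight_mul_ge_le hu hind hd k₀ k hκ hn hsm hc fun i => ?_).trans ?_
    · rw [(hu i).integral_weight_mul, if_neg (Finset.ne_of_mem_erase hk).symm, mul_zero]
    · gcongr
  have b₆ : P.real B₆ ≤ Q := by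
    refine (measureReal_exists_le _ _ fun p hp => measureReal_sum_weight_inner_sq_lt_le hu hind hd
      h4 (Finset.mem_filter.1 hp).2).trans ?_
    refine le_trans ?_ (card_gridNet_mul_exp_le (a := n / (16 * 10 ^ 9 * d)) hn hd
      (by linarith : 0 ≤ κ) ?_)
    · gcongr
      exact Finset.filter_subset _ _
    · rw [le_div_iff₀ (by positivity)]
      have h1 := mul_le_mul_of_nonneg_left hreg hn0.le
      have h2 : n * (16 * 10 ^ 9 * (7 + κ) ^ 2 * d ^ 2 * q ^ 2) =
          16 * 10 ^ 9 * (7 + κ) * d ^ 2 * (n * q ^ 2) * (7 + κ) := by ring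
      rw [h2, hq2, mul_one] at h1
      refine le_trans ?_ h1
      calc (7 + κ) * d * L * (16 * 10 ^ 9 * d) = 16 * 10 ^ 9 * (7 + κ) * d ^ 2 * L * 1 := by ring
        _ ≤ _ := by gcongr; linarith
  have b₇ : P.real B₇ ≤ 2 * Q := by
    refine (measureReal_abs_sum_sq_sub_one_gt_le hγind hγm hγs hγ2 Finset.univ
      zero_le_one (by norm_num)).trans ?_
    rw [hrpow]
    gcongr
    have h1 : 16 * 10 ^ 9 * (7 + κ) ^ 2 * d ^ 2 * L ≤ n := by
      have := mul_le_mul_of_nonneg_left hreg hn0.le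
      rw [mul_one] at this
      refine le_trans (le_of_eq ?_) this
      rw [← hq2]; ring
    have h2 : κ * L * 1 ≤ (7 + κ) ^ 2 * L * d ^ 2 := by
      have h3 : κ ≤ (7 + κ) ^ 2 := by nlinarith
      have h5 : (1 : ℝ) ≤ d ^ 2 := one_le_pow₀ hd1
      gcongr
    linarith
  refine ⟨B₁ ∪ (B₂ ∪ (B₃ ∪ (B₄ ∪ (B₅ 1 ∪ (B₅ (-1) ∪ (B₆ ∪ B₇)))))), ?_, fun ω hω => ?_⟩
  · have h1 := b₅ 1 (by simp)
    have h2 := b₅ (-1) (by simp)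
    have u1 := measureReal_union_le (μ := P) B₁ (B₂ ∪ (B₃ ∪ (B₄ ∪ (B₅ 1 ∪ (B₅ (-1) ∪ (B₆ ∪ B₇))))))
    have u2 := measureReal_union_le (μ := P) B₂ (B₃ ∪ (B₄ ∪ (B₅ 1 ∪ (B₅ (-1) ∪ (B₆ ∪ B₇)))))
    have u3 := measureReal_union_le (μ := P) B₃ (B₄ ∪ (B₅ 1 ∪ (B₅ (-1) ∪ (B₆ ∪ B₇))))
    have u4 := measureReal_union_le (μ := P) B₄ (B₅ 1 ∪ (B₅ (-1) ∪ (B₆ ∪ B₇)))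
    have u5 := measureReal_union_le (μ := P) (B₅ 1) (B₅ (-1) ∪ (B₆ ∪ B₇))
    have u6 := measureReal_union_le (μ := P) (B₅ (-1)) (B₆ ∪ B₇)
    have u7 := measureReal_union_le (μ := P) B₆ B₇
    have hQn : Q ≤ n * Q := le_mul_of_one_le_left hQ0 (by linarith)
    have hE : (Real.exp 64 + 4) * Q ≤ n * ((Real.exp 64 + 4) * Q) :=
      le_mul_of_one_le_left (by positivity) (by linarith)
    have e : (13 + 3 * (Real.exp 64 + 4)) * n * Q =
        13 * (n * Q) + 3 * (n * ((Real.exp 64 + 4) * Q)) := by ring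
    rw [e]
    linarith
  · simp only [Set.mem_union, not_or] at hω
    obtain ⟨h1, h2, h3, h4, h5, h5', h6, h7⟩ := hω
    simp only [B₁, B₂, B₃, B₄, B₅, B₆, B₇, Set.mem_iUnion, Set.mem_ofPred_eq, not_exists,
      Finset.mem_univ, Finset.mem_filter, Finset.mem_erase, not_lt, not_le, hnL, forall_const,
      and_true, and_imp, exists_prop, not_and] at h1 h2 h3 h4 h5 h5' h6 h7
    refine ⟨h1, h2, h3, by linarith, fun k hk => ?_, h6, ?_⟩
    · have := h5 k hk
      have := h5' k hk
      rw [abs_le]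
      constructor <;> linarith
    · have := (abs_le.1 h7).2
      rw [Finset.sum_sub_distrib] at this
      simp at this
      linarith

end GoodEvent

/-! ### Numerical consequences of a large sample size. -/

section Regime

variable {n d : ℕ} {κ q : ℝ}

/-- The sample size is large compared with the dimension, at scale `q = √(log n / n)`. -/
structure IsLargeSample (n d : ℕ) (κ q : ℝ) : Prop where
  one_le_dim : (1 : ℝ) ≤ d
  le_size : (1000 : ℝ) ≤ n
  one_le : 1 ≤ κ
  nonneg : 0 ≤ q
  sq_eq : n * q ^ 2 = Real.log n
  small : 10 ^ 9 * ((7 + κ) ^ 2 * (d * (Real.log n * q))) ≤ 1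

namespace IsLargeSample

theorem one_le_log (h : IsLargeSample n d κ q) : 1 ≤ Real.log n := by
  have := h.le_size
  rw [Real.le_log_iff_exp_le (by linarith)]
  linarith [Real.exp_one_lt_d9]

theorem mul_le (h : IsLargeSample n d κ q) :
    (7 + κ) * (d * q) ≤ (7 + κ) ^ 2 * (d * (Real.log n * q)) := by
  have h1 := h.one_le
  have h2 := h.one_le_log
  have h3 := h.nonneg
  have h4 := h.one_le_dim
  have h5 : d * (1 * q) ≤ d * (Real.log n * q) := by gcongr
  have h6 : 7 + κ ≤ (7 + κ) ^ 2 := by nlinarith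
  have h7 : 0 ≤ d * q := by positivity
  calc (7 + κ) * (d * q) ≤ (7 + κ) ^ 2 * (d * q) := by gcongr
    _ ≤ _ := by gcongr; exact le_mul_of_one_le_left h3 h2

theorem mul_le_one (h : IsLargeSample n d κ q) : 10 ^ 9 * ((7 + κ) * (d * q)) ≤ 1 := by linarith [h.mul_le, h.small]

theorem le_one (h : IsLargeSample n d κ q) : q ≤ 1 := by
  have h1 := h.mul_le_one
  have h2 := h.one_le
  have h3 := h.one_le_dim
  have h4 := h.nonneg
  have : 1 * (1 * q) ≤ (7 + κ) * (d * q) := by gcongr; linarith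
  linarith

theorem sqrt_dim_le (h : IsLargeSample n d κ q) : √(d : ℝ) ≤ d := by
  have := h.one_le_dim
  rw [Real.sqrt_le_iff]
  exact ⟨by positivity, by nlinarith⟩

theorem inv_le (h : IsLargeSample n d κ q) : 1 ≤ n * q := by
  have h1 := h.one_le_log
  have h2 := h.le_one
  have h3 := h.nonneg
  rw [← h.sq_eq] at h1
  have h4 : (0 : ℝ) ≤ n * q := by positivity
  nlinarith

theorem radius_mul_le (h : IsLargeSample n d κ q) : (33 * κ * (d * Real.log n)) * q ≤ 1 := by
  have h1 := h.small
  have h2 := h.one_le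
  have h3 := h.nonneg
  have h4 := h.one_le_log
  have h5 : κ ≤ (7 + κ) ^ 2 := by nlinarith
  have : κ * (d * (Real.log n * q)) ≤ (7 + κ) ^ 2 * (d * (Real.log n * q)) := by gcongr
  nlinarith

theorem radius_le (h : IsLargeSample n d κ q) : 33 * κ * (d * Real.log n) ≤ n := by
  have h1 := h.radius_mul_le
  have h2 := h.one_le
  have h3 := h.nonneg
  have h4 := h.one_le_log
  have h5 := h.inv_le
  have h6 := h.one_le_dim
  have h7 : 0 ≤ 33 * κ * (d * Real.log n) := by positivity
  calc 33 * κ * (d * Real.log n) ≤ (33 * κ * (d * Real.log n)) * (n * q) :=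
        le_mul_of_one_le_right h7 h5
    _ = n * ((33 * κ * (d * Real.log n)) * q) := by ring
    _ ≤ n * 1 := by gcongr
    _ = n := mul_one _

theorem dim_le (h : IsLargeSample n d κ q) : (d : ℝ) ≤ n := by
  have h2 := h.one_le
  have h4 := h.one_le_log
  have h6 := h.one_le_dim
  refine le_trans ?_ h.radius_le
  have h8 : (d : ℝ) * 1 ≤ d * Real.log n := by gcongr
  have h9 : 0 ≤ d * Real.log n := by positivity
  nlinarith

/-- The factor `n ^ 2` comes from bounding both the weights and the squared norms by `n` when
passing from the net to the sphere; mesh `n ^ (-5)` makes the loss negligible. -/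
theorem net_le (h : IsLargeSample n d κ q) :
    (d : ℝ) / ((n ^ 5 : ℕ) : ℝ) * n ^ 2 ≤ 1 / 10 ^ 3 * q ∧
    (d : ℝ) / ((n ^ 5 : ℕ) : ℝ) * n ^ 2 ≤ 1 / 10 ^ 3 := by
  have hn := h.le_size
  have hn0 : (0 : ℝ) < n := by linarith
  have h1 : (d : ℝ) / ((n ^ 5 : ℕ) : ℝ) * n ^ 2 ≤ 1 / n ^ 2 := by
    push_cast
    rw [div_mul_eq_mul_div, div_le_div_iff₀ (by positivity) (by positivity)]
    calc (d : ℝ) * n ^ 2 * n ^ 2 ≤ n * n ^ 2 * n ^ 2 := by gcongr; exact_mod_cast h.dim_le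
      _ = _ := by ring
  have h2 : 1 / (n : ℝ) ^ 2 ≤ 1 / 10 ^ 3 * q := by
    rw [div_le_iff₀ (by positivity)]
    have := h.inv_le
    have : (1000 : ℝ) * 1 ≤ n * (n * q) := by gcongr
    nlinarith
  exact ⟨h1.trans h2, (h1.trans h2).trans (by linarith [h.le_one])⟩

end IsLargeSample

end Regime

/-! ### Deterministic analysis of a good sample. -/

namespace IsGoodSample

variable {n d : ℕ} {κ q : ℝ} {k₀ : Fin d} {u : Fin n → EuclideanSpace ℝ (Fin d)} {γ : Fin n → ℝ}

theorem abs_weight_le (hg : IsGoodSample κ q k₀ u γ) (h : IsLargeSample n d κ q) (i : Fin n) :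
    |‖u i‖ ^ 2 - d| ≤ n := by
  have h1 := h.one_le
  have h2 := h.one_le_log
  refine (hg.weight i).trans (le_trans ?_ h.radius_le)
  calc 32 * √(d : ℝ) * (κ * Real.log n) ≤ 33 * d * (κ * Real.log n) := by
        gcongr
        · norm_num
        · exact h.sqrt_dim_le
    _ = _ := by ring

theorem norm_sq_le (hg : IsGoodSample κ q k₀ u γ) (h : IsLargeSample n d κ q) (i : Fin n) :
    ‖u i‖ ^ 2 ≤ 33 * κ * (d * Real.log n) := by
  have h1 := h.one_le
  have h2 := h.one_le_log
  have h3 := (abs_le.1 (hg.weight i)).2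
  have h4 : 32 * √(d : ℝ) * (κ * Real.log n) ≤ 32 * d * (κ * Real.log n) := by
    gcongr; exact h.sqrt_dim_le
  have h5 : 1 * 1 ≤ κ * Real.log n := by gcongr
  have h6 : d * 1 ≤ d * (κ * Real.log n) := by gcongr; linarith
  nlinarith

theorem wform_one_self_eq (v : EuclideanSpace ℝ (Fin d)) :
    wform 1 u v v = (n : ℝ)⁻¹ * ∑ j, inner ℝ v (u j) ^ 2 := by
  simp only [wform, Pi.one_apply, one_mul, real_inner_comm v, sq]

theorem abs_wform_one_sub_le (hg : IsGoodSample κ q k₀ u γ) (h : IsLargeSample n d κ q)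
    (v : EuclideanSpace ℝ (Fin d)) :
    |wform 1 u v v - ‖v‖ ^ 2| ≤ 320 * (7 + κ) * √d * q * ‖v‖ ^ 2 := by
  have hn := h.le_size
  have hn0 : (0 : ℝ) < n := by linarith
  have hκ := h.one_le
  have hq0 := h.nonneg
  have hL := h.one_le_log
  have hd1 : 1 ≤ √(d : ℝ) := Real.one_le_sqrt.2 h.one_le_dim
  set s := 64 * (7 + κ) * √d * q with hs
  have hqs : q ≤ s := by
    have : 1 * 1 * 1 * q ≤ 64 * (7 + κ) * √d * q := by gcongr <;> linarith
    linarith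
  have hunit : ∀ v : EuclideanSpace ℝ (Fin d), ‖v‖ = 1 → |wform 1 u v v - 1| ≤ 5 * s := by
    intro v hv
    obtain ⟨p, hp, hvp, -⟩ := exists_mem_gridNet (N := n ^ 5)
      (pow_pos (by exact_mod_cast hn0) 5) v hv.le
    obtain ⟨hr, hr'⟩ := h.net_le
    set r := (d : ℝ) / ((n ^ 5 : ℕ) : ℝ)
    have hr0 : 0 ≤ r := (norm_nonneg _).trans hvp
    have hrn : r * n ≤ r * n ^ 2 := by gcongr; nlinarith
    have hrn' : r ≤ r * n ^ 2 := le_mul_of_one_le_right hr0 (by nlinarith)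
    have hr1 : r ≤ 1 := by linarith
    have h1 := abs_wform_self_sub_le (c := 1) (M := 1) (fun i => by simp) zero_le_one
      (fun i => (hg.norm_sq_le h i).trans h.radius_le) hn0.le hv.le hvp hr1
    have h2 : |wform 1 u p p - ‖p‖ ^ 2| ≤ s * ‖p‖ ^ 2 := by
      have e : wform 1 u p p - ‖p‖ ^ 2 =
          (n : ℝ)⁻¹ * ∑ j, (inner ℝ p (u j) ^ 2 - ‖p‖ ^ 2) := by
        rw [wform_one_self_eq, Finset.sum_sub_distrib, mul_sub]
        simp [hn0.ne']
      rw [e, abs_mul, abs_of_pos (by positivity), inv_mul_le_iff₀ hn0]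
      refine (hg.grid p hp).trans (le_of_eq (by ring))
    have h3 : ‖p‖ ≤ 1 + r := by
      have := norm_sub_norm_le p v
      rw [norm_sub_rev, hv] at this
      linarith
    have h4 : 1 - r ≤ ‖p‖ := by
      have := norm_sub_norm_le v p
      rw [hv] at this
      linarith
    have h5 : ‖p‖ ^ 2 ≤ 1 + 3 * r := by nlinarith [norm_nonneg p]
    have h6 : 1 - 2 * r ≤ ‖p‖ ^ 2 := by nlinarith [norm_nonneg p]
    have h7 : s * ‖p‖ ^ 2 ≤ s * 4 := by gcongr; linarith
    rw [abs_le] at h1 h2 ⊢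
    constructor <;> linarith
  rcases eq_or_ne v 0 with rfl | hv
  · simp [wform]
  have hv0 : 0 < ‖v‖ := norm_pos_iff.2 hv
  have h1 := hunit (‖v‖⁻¹ • v) (by rw [norm_smul, norm_inv, norm_norm, inv_mul_cancel₀ hv0.ne'])
  have e : wform 1 u v v - ‖v‖ ^ 2 =
      ‖v‖ ^ 2 * (wform 1 u (‖v‖⁻¹ • v) (‖v‖⁻¹ • v) - 1) := by
    rw [wform_smul_left, wform_smul_right]; field_simp
  rw [e, abs_mul, abs_of_pos (by positivity), mul_comm]
  refine (mul_le_mul_of_nonneg_right h1 (by positivity)).trans (le_of_eq ?_)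
  rw [hs]; ring

theorem le_wform_weight (hg : IsGoodSample κ q k₀ u γ) (h : IsLargeSample n d κ q)
    (b : EuclideanSpace ℝ (Fin d)) (hb : b k₀ = 0) :
    7 / 5 * ‖b‖ ^ 2 ≤ wform (fun i => ‖u i‖ ^ 2 - d) u b b := by
  have hn := h.le_size
  have hn0 : (0 : ℝ) < n := by linarith
  have hunit : ∀ v : EuclideanSpace ℝ (Fin d), ‖v‖ = 1 → v k₀ = 0 →
      7 / 5 ≤ wform (fun i => ‖u i‖ ^ 2 - d) u v v := by
    intro v hv hk
    obtain ⟨p, hp, hvp, hpk⟩ := exists_mem_gridNet (N := n ^ 5)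
      (pow_pos (by exact_mod_cast hn0) 5) v hv.le
    have hr := h.net_le.2
    set r := (d : ℝ) / ((n ^ 5 : ℕ) : ℝ)
    have hr0 : 0 ≤ r := (norm_nonneg _).trans hvp
    have hrn' : r ≤ r * n ^ 2 := le_mul_of_one_le_right hr0 (by nlinarith)
    have h1 := (abs_le.1 (abs_wform_self_sub_le (hg.abs_weight_le h) hn0.le
      (fun i => (hg.norm_sq_le h i).trans h.radius_le) hn0.le hv.le hvp (by linarith))).1
    have h2 : 3 / 2 * ‖p‖ ^ 2 ≤ wform (fun i => ‖u i‖ ^ 2 - d) u p p := by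
      have h3 := hg.lower p hp (hpk k₀ hk)
      have e : wform (fun i => ‖u i‖ ^ 2 - d) u p p =
          (n : ℝ)⁻¹ * ∑ i, (‖u i‖ ^ 2 - d) * inner ℝ p (u i) ^ 2 := by
        simp only [wform, real_inner_comm p, sq]
      rw [e, ← div_eq_inv_mul, le_div_iff₀ hn0]
      linarith
    have h4 : 1 - r ≤ ‖p‖ := by
      have := norm_sub_norm_le v p
      rw [hv] at this
      linarith
    have h6 : 1 - 2 * r ≤ ‖p‖ ^ 2 := by nlinarith [norm_nonneg p]
    nlinarith
  rcases eq_or_ne b 0 with rfl | hv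
  · simp [wform]
  have hv0 : 0 < ‖b‖ := norm_pos_iff.2 hv
  have h1 := hunit (‖b‖⁻¹ • b) (by rw [norm_smul, norm_inv, norm_norm, inv_mul_cancel₀ hv0.ne'])
    (by simp [hb])
  rw [wform_smul_left, wform_smul_right, ← mul_assoc, ← mul_inv, ← div_eq_inv_mul,
    le_div_iff₀ (by positivity)] at h1
  rwa [sq]

/-- With `R` of order `d log n` bounding `‖u i‖²`, the self-interaction costs `R² / n` and the other
samples cost `q R` by leave-one-out. The uniform bound on `Ĝ - 1` would lose a factor `√d` in the
latter. -/
theorem abs_wform_one_self_sub_le (hg : IsGoodSample κ q k₀ u γ) (h : IsLargeSample n d κ q)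
    (i : Fin n) :
    |wform 1 u (u i) (u i) - ‖u i‖ ^ 2| ≤ 5000 * ((7 + κ) ^ 2 * (d * (Real.log n * q))) := by
  have hn := h.le_size
  have hn0 : (0 : ℝ) < n := by linarith
  have hκ := h.one_le
  have hq0 := h.nonneg
  have hL := h.one_le_log
  have hd := h.one_le_dim
  have hR := hg.norm_sq_le h i
  have hRq := h.radius_mul_le
  set R := 33 * κ * (d * Real.log n) with hRdef
  have hR1 : 1 ≤ R := by
    have : (1 : ℝ) * 1 * (1 * 1) ≤ 33 * κ * (d * Real.log n) := by gcongr; norm_num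
    linarith
  have e : wform 1 u (u i) (u i) - ‖u i‖ ^ 2 = (n : ℝ)⁻¹ * ((‖u i‖ ^ 2) ^ 2 - ‖u i‖ ^ 2 +
      ∑ j ∈ Finset.univ.erase i, (inner ℝ (u i) (u j) ^ 2 - ‖u i‖ ^ 2)) := by
    have h1 : ∑ j, (inner ℝ (u i) (u j) ^ 2 - ‖u i‖ ^ 2) =
        (inner ℝ (u i) (u i) ^ 2 - ‖u i‖ ^ 2) +
          ∑ j ∈ Finset.univ.erase i, (inner ℝ (u i) (u j) ^ 2 - ‖u i‖ ^ 2) :=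
      (Finset.add_sum_erase _ _ (Finset.mem_univ i)).symm
    rw [real_inner_self_eq_norm_sq] at h1
    rw [← h1, wform_one_self_eq, Finset.sum_sub_distrib, mul_sub]
    simp [hn0.ne']
  have h1 : |(‖u i‖ ^ 2) ^ 2 - ‖u i‖ ^ 2| ≤ 2 * R ^ 2 := by
    have h0 : 0 ≤ ‖u i‖ ^ 2 := by positivity
    rw [abs_le]
    constructor <;> nlinarith
  have h2 : |∑ j ∈ Finset.univ.erase i, (inner ℝ (u i) (u j) ^ 2 - ‖u i‖ ^ 2)| ≤
      n * (64 * κ * q) * R := (hg.leave i).trans (by gcongr)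
  set T := (7 + κ) ^ 2 * (d * (Real.log n * q)) with hT
  have hκT : κ ^ 2 * (d * (Real.log n * q)) ≤ T := by
    rw [hT]; gcongr; linarith
  have hdq : d * q ≤ 1 := by
    have h5 := h.mul_le_one
    have h6 : 1 * (d * q) ≤ (7 + κ) * (d * q) := by gcongr; linarith
    linarith
  have h3 : R ^ 2 ≤ n * (1089 * T) := by
    calc R ^ 2 = 1089 * (κ ^ 2 * (d ^ 2 * (Real.log n * Real.log n))) := by rw [hRdef]; ring
      _ = 1089 * (κ ^ 2 * (d ^ 2 * (Real.log n * (n * q ^ 2)))) := by rw [h.sq_eq]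
      _ = n * (1089 * (κ ^ 2 * (d * (Real.log n * q)) * (d * q))) := by ring
      _ ≤ n * (1089 * (κ ^ 2 * (d * (Real.log n * q)) * 1)) := by gcongr
      _ ≤ n * (1089 * T) := by rw [mul_one]; gcongr
  have h4 : n * (64 * κ * q) * R ≤ n * (2112 * T) := by
    calc n * (64 * κ * q) * R = n * (2112 * (κ ^ 2 * (d * (Real.log n * q)))) := by
          rw [hRdef]; ring
      _ ≤ _ := by gcongr
  rw [e, abs_mul, abs_of_pos (by positivity), inv_mul_le_iff₀ hn0]
  refine (abs_add_le _ _).trans ?_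
  have h5 : 0 ≤ n * T := by rw [hT]; positivity
  linarith

/-- The uniform bound `η ∼ √d q` on `Ĝ - 1` enters only squared, through `η² R ∼ (d q) (d log n q)`,
and `d q` is small. -/
theorem abs_leverage_sub_le (hg : IsGoodSample κ q k₀ u γ) (h : IsLargeSample n d κ q)
    {i : Fin n} {p : EuclideanSpace ℝ (Fin d)} (hp : ∀ z, wform 1 u p z = inner ℝ (u i) z) :
    |inner ℝ (u i) p - ‖u i‖ ^ 2| ≤ 10 ^ 7 * ((7 + κ) ^ 2 * (d * (Real.log n * q))) := by
  have hκ := h.one_le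
  have hq0 := h.nonneg
  have hL := h.one_le_log
  have hd := h.one_le_dim
  have hs := h.mul_le_one
  have hη2 : 320 * (7 + κ) * √d * q ≤ 1 / 2 := by
    have : (7 + κ) * (√d * q) ≤ (7 + κ) * (d * q) := by gcongr; exact h.sqrt_dim_le
    linarith
  refine (abs_inner_sub_norm_sq_le (by positivity) hη2 (hg.abs_wform_one_sub_le h) hp
    (hg.abs_wform_one_self_sub_le h i) (hg.norm_sq_le h i)).trans ?_
  set T := (7 + κ) ^ 2 * (d * (Real.log n * q)) with hT
  have hT0 : 0 ≤ T := by rw [hT]; positivity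
  have h1 : 2 * (320 * (7 + κ) * √d * q) ^ 2 * (33 * κ * (d * Real.log n)) ≤ 6758400 * T := by
    have hsd : √(d : ℝ) ^ 2 = d := Real.sq_sqrt (by positivity)
    calc 2 * (320 * (7 + κ) * √d * q) ^ 2 * (33 * κ * (d * Real.log n))
        = 6758400 * (T * (κ * (√(d : ℝ) ^ 2 * q))) := by rw [hT]; ring
      _ ≤ 6758400 * (T * 1) := by
          rw [hsd]
          gcongr
          have h6 : κ * (d * q) ≤ (7 + κ) * (d * q) := by gcongr; linarith
          linarith
      _ = _ := by rw [mul_one]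
  linarith

theorem cross_const_le (h : IsLargeSample n d κ q) :
    128 * √d * ((3072 + κ) * q) * √d ≤ 10 ^ 5 * ((7 + κ) * (d * q)) := by
  have hκ := h.one_le
  have hq0 := h.nonneg
  have hd := h.one_le_dim
  have hsd : √(d : ℝ) * √d = d := Real.mul_self_sqrt (by positivity)
  calc 128 * √d * ((3072 + κ) * q) * √d = 128 * (3072 + κ) * ((√d * √d) * q) := by ring
    _ ≤ 10 ^ 5 * (7 + κ) * (d * q) := by rw [hsd]; gcongr ?_ * _; linarith
    _ = _ := by ring

theorem wform_weight_single_le (hg : IsGoodSample κ q k₀ u γ) (h : IsLargeSample n d κ q) :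
    wform (fun i => ‖u i‖ ^ 2 - d) u (EuclideanSpace.single k₀ 1) (EuclideanSpace.single k₀ 1) ≤
      1 / 2 := by
  have hn := h.le_size
  have hn0 : (0 : ℝ) < n := by linarith
  have hκ := h.one_le
  have hq0 := h.nonneg
  have h1 := cross_const_le h
  have h2 := h.mul_le_one
  have h3 : 1 ≤ √(d : ℝ) := Real.one_le_sqrt.2 h.one_le_dim
  have h4 : 128 * √d * ((3072 + κ) * q) * 1 ≤ 128 * √d * ((3072 + κ) * q) * √d := by gcongr
  have h5 : 128 * √d * ((3072 + κ) * q) ≤ 1 / 4 := by linarith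
  have h6 := hg.diag
  have e : wform (fun i => ‖u i‖ ^ 2 - d) u (EuclideanSpace.single k₀ 1)
      (EuclideanSpace.single k₀ 1) = (n : ℝ)⁻¹ * ∑ i, (‖u i‖ ^ 2 - d) * (u i k₀ * u i k₀) := by
    simp [wform, EuclideanSpace.inner_single_right]
  rw [e, inv_mul_le_iff₀ hn0]
  have h7 : n * (128 * √d * ((3072 + κ) * q)) ≤ n * (1 / 4) := by gcongr
  linarith

theorem sum_abs_le (b : EuclideanSpace ℝ (Fin d)) : ∑ k, |b k| ≤ √d * ‖b‖ := by
  have h := Real.sum_mul_le_sqrt_mul_sqrt Finset.univ (fun _ : Fin d => (1 : ℝ)) fun k => |b k|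
  simpa [EuclideanSpace.norm_eq] using h

/-- The expression is linear in `b`, so entrywise bounds of order `√d q` and `‖b‖₁ ≤ √d ‖b‖₂`
suffice without a net. -/
theorem abs_wform_weight_single_le (hg : IsGoodSample κ q k₀ u γ) (h : IsLargeSample n d κ q)
    (b : EuclideanSpace ℝ (Fin d)) (hb : b k₀ = 0) :
    |wform (fun i => ‖u i‖ ^ 2 - d) u (EuclideanSpace.single k₀ 1) b| ≤
      10 ^ 7 * ((7 + κ) ^ 2 * (d * (Real.log n * q))) * ‖b‖ := by
  have hn := h.le_size
  have hn0 : (0 : ℝ) < n := by linarith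
  have hκ := h.one_le
  have hq0 := h.nonneg
  set T := 128 * √d * ((3072 + κ) * q) with hT
  have e : wform (fun i => ‖u i‖ ^ 2 - d) u (EuclideanSpace.single k₀ 1) b =
      ∑ k, b k * ((n : ℝ)⁻¹ * ∑ i, (‖u i‖ ^ 2 - d) * (u i k₀ * u i k)) := by
    simp only [wform, EuclideanSpace.inner_single_right, IsIsotropic.inner_eq_sum, Finset.mul_sum]
    rw [Finset.sum_comm]
    refine Finset.sum_congr rfl fun k _ => Finset.sum_congr rfl fun i _ => ?_
    simp
    ring
  have h1 : ∀ k, |b k * ((n : ℝ)⁻¹ * ∑ i, (‖u i‖ ^ 2 - d) * (u i k₀ * u i k))| ≤ |b k| * T := by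
    intro k
    by_cases hk : k = k₀
    · rw [hk, hb]; simp
    · rw [abs_mul, abs_mul, abs_of_pos (inv_pos.2 hn0)]
      gcongr
      rw [inv_mul_le_iff₀ hn0]
      refine (hg.cross k hk).trans (le_of_eq ?_)
      rw [hT]; ring
  rw [e]
  refine (Finset.abs_sum_le_sum_abs _ _).trans ((Finset.sum_le_sum fun k _ => h1 k).trans ?_)
  rw [← Finset.sum_mul]
  calc (∑ k, |b k|) * T ≤ (√d * ‖b‖) * T := by gcongr; exact sum_abs_le b
    _ = T * √d * ‖b‖ := by ring
    _ ≤ _ := by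
      gcongr ?_ * _
      have h2 := cross_const_le h
      have h3 := h.mul_le
      have h4 := h.one_le_dim
      have h5 : 0 ≤ (7 + κ) * (d * q) := by positivity
      linarith

/-- On a good sample every output of the spectral algorithm has few errors. -/
theorem misclass_le (hg : IsGoodSample κ q k₀ u γ) (h : IsLargeSample n d κ q) {σ : ℝ}
    (hσ : σ ^ 2 ≤ 1 / 2) {y : Fin n → ℤˣ}
    (hu : ∀ i, u i k₀ = √(1 - σ ^ 2) * (((y i : ℤˣ) : ℤ) : ℝ) + σ * γ i)
    {A : Matrix (Fin d) (Fin d) ℝ} (hA : IsUnit A) {x : Fin n → EuclideanSpace ℝ (Fin d)}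
    (hx : ∀ i, (x i).ofLp = A.mulVec (u i).ofLp) {yhat : Fin n → ℤˣ}
    (hy : IsSpectralOutput (dataMatrix x) yhat) :
    misclass yhat y ≤ 32 * σ ^ 2 +
      6400 * (10 ^ 7 * ((7 + κ) ^ 2 * (d * (Real.log n * q)))) ^ 2 := by
  have hn := h.le_size
  have hn0 : (0 : ℝ) < n := by linarith
  have hnpos : 0 < n := by exact_mod_cast hn0
  have hκ := h.one_le
  have hq0 := h.nonneg
  have hL := h.one_le_log
  have hη := hg.abs_wform_one_sub_le h
  have hsmall := h.small
  have hmul := h.mul_le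
  set T := (7 + κ) ^ 2 * (d * (Real.log n * q)) with hT
  have hηT : 320 * (7 + κ) * √d * q ≤ 10 ^ 7 * T := by
    have : (7 + κ) * (√d * q) ≤ (7 + κ) * (d * q) := by gcongr; exact h.sqrt_dim_le
    have h0 : 0 ≤ T := by rw [hT]; positivity
    linarith
  have hη0 : 0 ≤ 320 * (7 + κ) * √d * q := by positivity
  have hη1 : 320 * (7 + κ) * √d * q ≤ 1 / 2 := by linarith
  have hpos : ∀ v ≠ 0, 0 < wform 1 u v v := by
    intro v hv
    have h1 : 0 < ‖v‖ ^ 2 := by have := norm_pos_iff.2 hv; positivity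
    have h2 := (abs_le.1 (hη v)).1
    nlinarith
  obtain ⟨p, lev, l, rfl, hp, heig, hray, hlev⟩ := hy.exists_bottom hA hnpos hx hpos
  have hk : ∀ b : EuclideanSpace ℝ (Fin d), inner ℝ (EuclideanSpace.single k₀ (1 : ℝ)) b = b k₀ := by
    intro b; simp [EuclideanSpace.inner_single_left]
  obtain ⟨α, b, hpe, hob, hb, hα1, hα2⟩ := exists_decomposition_of_bottom
    (e := EuclideanSpace.single k₀ (1 : ℝ)) (by simp) hη0 hηT (by linarith) hη
    (fun i => by
      obtain ⟨z, hz, hz'⟩ := hlev i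
      rw [← hz']; exact hg.abs_leverage_sub_le h hz)
    (hg.wform_weight_single_le h)
    (fun b hb => hg.abs_wform_weight_single_le h b (by rwa [hk] at hb))
    (fun b hb => hg.le_wform_weight h b (by rwa [hk] at hb)) hp heig hray
  have hρ : √(1 - σ ^ 2) ^ 2 = 1 - σ ^ 2 := Real.sq_sqrt (by linarith)
  -- The projection `⟪u i, α e + b⟫` splits into the label times `α ρ` and a residual made of the
  -- noise `α σ γ i` and `⟪u i, b⟫`. Both `α²` and `ρ²` are at least `1 / 2`.
  refine (_root_.misclass_le (t := α * √(1 - σ ^ 2))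
    (r := fun i => α * σ * γ i + inner ℝ (u i) b) hnpos (fun i => ?_) ?_).trans ?_
  · rw [hpe, inner_add_right, real_inner_smul_right, real_inner_comm, hk, hu]; ring
  · rw [mul_pow, hρ]; nlinarith
  · have h1 : ∑ i, (α * σ * γ i + inner ℝ (u i) b) ^ 2 ≤
        2 * (α ^ 2 * σ ^ 2) * ∑ i, γ i ^ 2 + 2 * ∑ i, inner ℝ (u i) b ^ 2 := by
      rw [Finset.mul_sum, Finset.mul_sum, ← Finset.sum_add_distrib]
      refine Finset.sum_le_sum fun i _ => ?_
      nlinarith [sq_nonneg (α * σ * γ i - inner ℝ (u i) b)]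
    have h2 : ∑ i, inner ℝ (u i) b ^ 2 = n * wform 1 u b b := by
      rw [wform_one_self_eq, mul_inv_cancel_left₀ hn0.ne']
      simp only [real_inner_comm b]
    have h3 : wform 1 u b b ≤ 2 * (20 * (10 ^ 7 * T)) ^ 2 := by
      have h4 := (abs_le.1 (hη b)).2
      have h5 : ‖b‖ ^ 2 ≤ (20 * (10 ^ 7 * T)) ^ 2 := by gcongr
      nlinarith [sq_nonneg ‖b‖]
    have h4 : 2 * (α ^ 2 * σ ^ 2) * ∑ i, γ i ^ 2 ≤ 2 * (2 * σ ^ 2) * (2 * n) := by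
      gcongr; exact hg.noise
    have h5 : (n : ℝ)⁻¹ * ∑ i, (α * σ * γ i + inner ℝ (u i) b) ^ 2 ≤
        8 * σ ^ 2 + 4 * (20 * (10 ^ 7 * T)) ^ 2 := by
      rw [inv_mul_le_iff₀ hn0]
      rw [h2] at h1
      have h6 : n * wform 1 u b b ≤ n * (2 * (20 * (10 ^ 7 * T)) ^ 2) := by gcongr
      linarith
    refine (mul_le_mul_of_nonneg_left h5 (by norm_num)).trans (le_of_eq ?_)
    ring

end IsGoodSample

/-! ### Assembly and choice of constants. -/

theorem misclass_le_one {n : ℕ} (yhat y : Fin n → ℤˣ) : misclass yhat y ≤ 1 := by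
  rcases Nat.eq_zero_or_pos n with rfl | hn
  · simp [misclass]
  have hn0 : (0 : ℝ) < n := by exact_mod_cast hn
  rw [misclass, inv_mul_le_iff₀ hn0, mul_one]
  refine (min_le_left _ _).trans ?_
  exact_mod_cast (Finset.card_le_univ _).trans (Fintype.card_fin n).le

/-- The spectral algorithm succeeds outside a set of small probability. -/
theorem IsMixtureSample.exists_exceptional {Ω : Type*} [MeasurableSpace Ω] {P : Measure Ω}
    [IsProbabilityMeasure P] {n d : ℕ} {m : EuclideanSpace ℝ (Fin d)}
    {Sig : Matrix (Fin d) (Fin d) ℝ} {x : Fin n → Ω → EuclideanSpace ℝ (Fin d)}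
    {y : Fin n → Ω → ℤˣ} {κ : ℝ} (hS : Sig.PosDef) (h : IsMixtureSample P m Sig x y)
    (hσ : noiseLevel m Sig ^ 2 ≤ 1 / 1000)
    (hlarge : IsLargeSample n d κ √(Real.log n / n))
    (hsmall : √(Real.log n / n) * ((κ + 1) * Real.log n) ^ 2 ≤ 1) :
    ∃ B : Set Ω, P.real B ≤ (13 + 3 * (Real.exp 64 + 4)) * n * (n : ℝ) ^ (-κ) ∧
      ∀ ω ∉ B, ∀ yhat : Fin n → ℤˣ, IsSpectralOutput (dataMatrix fun i => x i ω) yhat →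
        misclass yhat (fun i => y i ω) ≤ 32 * noiseLevel m Sig ^ 2 + 6400 *
          (10 ^ 7 * ((7 + κ) ^ 2 * (d * (Real.log n * √(Real.log n / n))))) ^ 2 := by
  have hd : 0 < d := by
    have := hlarge.one_le_dim
    exact_mod_cast (by linarith : (0 : ℝ) < d)
  have hn : 3 ≤ n := by
    have := hlarge.le_size
    exact_mod_cast (by linarith : (3 : ℝ) ≤ n)
  have hσ1 : noiseLevel m Sig < 1 := by nlinarith
  obtain ⟨A, k₀, Γ, hA, hΓm, hΓ, hind, hγind, hx⟩ := h.exists_whitened hS hd hσ1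
  set σ := noiseLevel m Sig
  have hρσ : √(1 - σ ^ 2) ^ 2 + σ ^ 2 = 1 := by rw [Real.sq_sqrt (by linarith)]; ring
  have hiso := fun i => (hΓ i).isIsotropic_mixtureVector (h.measurable_y i) (hΓm i)
    (h.prob_label i) hρσ k₀
  have hγm : ∀ i, Measurable fun ω => Γ i ω k₀ := fun i =>
    (measurable_pi_apply k₀).comp (hΓm i)
  have hmap : ∀ i, P.map (fun ω => Γ i ω k₀) = gaussianReal 0 1 := fun i =>
    (hΓ i).map_apply_eq (h.measurable_y i) (hΓm i) k₀
  have hreg : 16 * 10 ^ 9 * (7 + κ) ^ 2 * d ^ 2 * √(Real.log n / n) ^ 2 ≤ 1 := by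
    have h1 := hlarge.mul_le_one
    have h2 := hlarge.one_le
    have h3 : 0 ≤ (7 + κ) * (d * √(Real.log n / n)) := by positivity
    calc 16 * 10 ^ 9 * (7 + κ) ^ 2 * d ^ 2 * √(Real.log n / n) ^ 2 =
          16 * 10 ^ 9 * ((7 + κ) * (d * √(Real.log n / n))) ^ 2 := by ring
      _ ≤ 16 * 10 ^ 9 * (1 / 10 ^ 9) ^ 2 := by gcongr; linarith
      _ ≤ 1 := by norm_num
  obtain ⟨B, hB, hgood⟩ := exists_isGoodSample (κ := κ) (fun i => (hiso i).1) hind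
    (fun i k hk => (hiso i).2.1 k hk) (fun i => (hiso i).2.2 hσ) hγind hγm
    (fun i => by
      rw [← HasSubgaussianMGF.id_map_iff (hγm i).aemeasurable, hmap i]
      exact hasSubgaussianMGF_id_gaussianReal)
    (fun i => by
      rw [← integral_sq_gaussianReal, ← hmap i,
        integral_map (hγm i).aemeasurable (by fun_prop)])
    hn hlarge.one_le rfl hsmall hreg
  refine ⟨B, hB, fun ω hω yhat hy => ?_⟩
  exact (hgood ω hω).misclass_le hlarge (by linarith)
    (fun i => mixtureVector_self _ _ _ _) hA (fun i => hx i ω) hy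

theorem eventually_sqrt_log_div_mul_le (c : ℝ) :
    ∀ᶠ n : ℕ in Filter.atTop, √(Real.log n / n) * (c * Real.log n) ^ 2 ≤ 1 := by
  have h := (Real.isLittleO_pow_log_id_atTop (n := 5)).bound
    (show (0 : ℝ) < 1 / (c ^ 4 + 1) by positivity)
  filter_upwards [tendsto_natCast_atTop_atTop.eventually h, Filter.eventually_gt_atTop 0]
    with n hn hn0
  have hn0' : (0 : ℝ) < n := by exact_mod_cast hn0
  have hL : 0 ≤ Real.log n := Real.log_natCast_nonneg n
  simp only [id, Real.norm_eq_abs, abs_of_pos hn0', abs_of_nonneg (pow_nonneg hL 5)] at hn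
  rw [one_div, ← div_eq_inv_mul, le_div_iff₀ (by positivity)] at hn
  refine abs_le_one_iff_mul_self_le_one.2 ?_ |> (le_abs_self _).trans
  have e : √(Real.log n / n) * (c * Real.log n) ^ 2 * (√(Real.log n / n) * (c * Real.log n) ^ 2) =
      (Real.log n / n) * (c ^ 4 * Real.log n ^ 4) := by
    rw [mul_mul_mul_comm, Real.mul_self_sqrt (by positivity)]; ring
  rw [e, div_mul_eq_mul_div, div_le_one hn0']
  nlinarith [pow_nonneg hL 5]

theorem mainTheorem3 (δ c C₁ : ℝ) (hδ : δ ∈ Set.Ioo (0 : ℝ) 1) (hc : 0 < c) (hC₁ : 0 < C₁) :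
    ∃ C₂ : ℝ, 0 < C₂ ∧
      ∀ (n d : ℕ) (m : EuclideanSpace ℝ (Fin d)) (Sig : Matrix (Fin d) (Fin d) ℝ)
        (Ω : Type*) [MeasurableSpace Ω] (P : Measure Ω) [IsProbabilityMeasure P]
        (x : Fin n → Ω → EuclideanSpace ℝ (Fin d)) (y : Fin n → Ω → ℤˣ),
        Sig.PosDef →
        IsMixtureSample P m Sig x y →
        noiseLevel m Sig < 1 - δ →
        (n : ℝ) > c * (d : ℝ) ^ 2 * Real.log n ^ 3 →
        -- a measurable event, so that the bound holds for every choice of the eigenvector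
        ∃ E : Set Ω, MeasurableSet E ∧ 1 - (n : ℝ) ^ (-C₁) ≤ P.real E ∧
          ∀ ω ∈ E, ∀ yhat : Fin n → ℤˣ,
            IsSpectralOutput (dataMatrix fun i => x i ω) yhat →
            misclass yhat (fun i => y i ω) ≤
              C₂ * (noiseLevel m Sig ^ 2 + (d : ℝ) ^ 2 * Real.log n ^ 3 / n) := by
  set K : ℝ := 13 + 3 * (Real.exp 64 + 4) with hK
  obtain ⟨n₀, hn₀⟩ := Filter.eventually_atTop.1 ((eventually_sqrt_log_div_mul_le (C₁ + 2 + 1)).and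
    ((tendsto_natCast_atTop_atTop (R := ℝ)).eventually
      ((Filter.eventually_ge_atTop 1000).and (Filter.eventually_ge_atTop K))))
  set s : ℝ := 7 + (C₁ + 2) with hs
  -- Unless the claimed bound exceeds 1, the three summands force respectively `σ² ≤ 1 / 1000`, `n ≥
  -- n₀`, and the smallness condition of `IsLargeSample`.
  refine ⟨1000 + 8 * n₀ + 10 ^ 18 * s ^ 4, by positivity, ?_⟩
  intro n d m Sig Ω _ P _ x y hS h _ hn
  set σ := noiseLevel m Sig with hσdef
  set ρ : ℝ := (d : ℝ) ^ 2 * Real.log n ^ 3 / n with hρ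
  have hL0 : 0 ≤ Real.log n := Real.log_natCast_nonneg n
  have hρ0 : 0 ≤ ρ := by rw [hρ]; positivity
  have hn0 : (0 : ℝ) < n := lt_of_le_of_lt (by positivity) hn
  -- In dimension 0 there is no unit vector, hence no output to check.
  rcases Nat.eq_zero_or_pos d with rfl | hd
  · refine ⟨Set.univ, MeasurableSet.univ, ?_, ?_⟩
    · have : (0 : ℝ) ≤ (n : ℝ) ^ (-C₁) := by positivity
      simpa using this
    · rintro ω - yhat ⟨v, ⟨hv, -⟩, -⟩
      rw [Subsingleton.elim v 0, norm_zero] at hv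
      exact absurd hv zero_ne_one
  by_cases htriv : 1 ≤ (1000 + 8 * n₀ + 10 ^ 18 * s ^ 4) * (σ ^ 2 + ρ)
  · refine ⟨Set.univ, MeasurableSet.univ, ?_, fun ω _ yhat _ =>
      (misclass_le_one _ _).trans htriv⟩
    have : (0 : ℝ) ≤ (n : ℝ) ^ (-C₁) := by positivity
    simpa using this
  rw [not_le] at htriv
  have hnpos : 0 < n := by exact_mod_cast hn0
  -- For `n = 1` the required probability `1 - 1 ^ (-C₁)` is 0, so the empty event is enough.
  rcases Nat.lt_or_ge n 2 with hn1 | hn2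
  · obtain rfl : n = 1 := by omega
    exact ⟨∅, MeasurableSet.empty, by simp, fun ω hω => hω.elim⟩
  have hd1 : (1 : ℝ) ≤ d := by exact_mod_cast hd
  have hσ0 : 0 ≤ σ ^ 2 := sq_nonneg _
  have hs4 : 0 ≤ s ^ 4 := by positivity
  have hn₀0 : (0 : ℝ) ≤ n₀ := by positivity
  have hexp : (1000 + 8 * (n₀ : ℝ) + 10 ^ 18 * s ^ 4) * (σ ^ 2 + ρ) =
      1000 * σ ^ 2 + 8 * n₀ * σ ^ 2 + 10 ^ 18 * (s ^ 4 * σ ^ 2) + 1000 * ρ + 8 * (n₀ * ρ) +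
        10 ^ 18 * (s ^ 4 * ρ) := by ring
  have hp1 : 0 ≤ 8 * n₀ * σ ^ 2 := by positivity
  have hp2 : 0 ≤ s ^ 4 * σ ^ 2 := by positivity
  have hp3 : 0 ≤ n₀ * ρ := by positivity
  have hp4 : 0 ≤ s ^ 4 * ρ := by positivity
  rw [hexp] at htriv
  have hnn₀ : n₀ ≤ n := by
    -- This gives `n * ρ ≥ 1 / 8`, the source of the factor 8 in front of `n₀`.
    have h1 : 1 / 8 ≤ Real.log n ^ 3 := by
      have h2 : Real.log 2 ≤ Real.log n :=
        Real.log_le_log two_pos (by exact_mod_cast hn2)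
      have h3 := Real.log_two_gt_d9
      calc (1 / 8 : ℝ) = (1 / 2) ^ 3 := by norm_num
        _ ≤ _ := by gcongr; linarith
    have h4 : 1 ^ 2 * (1 / 8) ≤ (d : ℝ) ^ 2 * Real.log n ^ 3 := by gcongr
    have h5 : n * ρ = (d : ℝ) ^ 2 * Real.log n ^ 3 := by rw [hρ]; field_simp
    have h6 : 8 * (n₀ * ρ) < 1 := by linarith
    by_contra hlt
    have h7 : (n : ℝ) ≤ n₀ := by exact_mod_cast (not_le.1 hlt).le
    have h8 : n * ρ ≤ n₀ * ρ := by gcongr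
    linarith
  obtain ⟨hsmall, hn1000, hKn⟩ := hn₀ n hnn₀
  set q := √(Real.log n / n) with hq
  have hq2 : n * q ^ 2 = Real.log n := by
    rw [hq, Real.sq_sqrt (by positivity)]; field_simp
  have hDρ : (d * (Real.log n * q)) ^ 2 = ρ := by
    rw [hρ, mul_pow, mul_pow, hq, Real.sq_sqrt (by positivity)]; ring
  have hlarge : IsLargeSample n d (C₁ + 2) q := by
    refine ⟨hd1, hn1000, by linarith, by positivity, hq2, ?_⟩
    refine (le_abs_self _).trans (abs_le_one_iff_mul_self_le_one.2 ?_)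
    have e : 10 ^ 9 * (s ^ 2 * (d * (Real.log n * q))) *
        (10 ^ 9 * (s ^ 2 * (d * (Real.log n * q)))) = 10 ^ 18 * (s ^ 4 * ρ) := by
      rw [← hDρ]; ring
    rw [e]
    linarith
  obtain ⟨B, hB, hgood⟩ := h.exists_exceptional hS (by linarith) hlarge hsmall
  -- The set `B` is not known to be measurable; its measurable hull has the same measure.
  refine ⟨(toMeasurable P B)ᶜ, (measurableSet_toMeasurable _ _).compl, ?_,
    fun ω hω yhat hy => ?_⟩
  · rw [probReal_compl_eq_one_sub (measurableSet_toMeasurable _ _), measureReal_def,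
      measure_toMeasurable, ← measureReal_def]
    -- Reason for `κ = C₁ + 2`: one power of `n` pays for the union bound, the other absorbs the
    -- constant `K ≤ n`.
    have h1 : K * n * (n : ℝ) ^ (-(C₁ + 2)) ≤ (n : ℝ) ^ (-C₁) := by
      have e : (n : ℝ) ^ (-C₁) = n * n * (n : ℝ) ^ (-(C₁ + 2)) := by
        rw [show -C₁ = 2 + -(C₁ + 2) by ring, Real.rpow_add hn0, Real.rpow_two]; ring
      rw [e]
      gcongr
    linarith
  · refine (hgood ω (fun hb => hω (subset_toMeasurable P B hb)) yhat hy).trans ?_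
    have e : 6400 * (10 ^ 7 * (s ^ 2 * (d * (Real.log n * q)))) ^ 2 =
        6400 * 10 ^ 14 * (s ^ 4 * ρ) := by rw [← hDρ]; ring
    rw [hexp]
    change 32 * σ ^ 2 + 6400 * (10 ^ 7 * (s ^ 2 * (d * (Real.log n * q)))) ^ 2 ≤ _
    rw [e]
    linarith
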